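/- **Problem.** An instance $(G,s,t,A,B,\ell)$ of TJ Minimum Separator Reconfiguration consists of a finite simple undirected graph $G$, vertices $s,t\in V(G)$, two minimum $s$-$t$-separators $A,B$ of $G$, and an integer $\ell\ge 0$. Here $S\subseteq V(G)\setminus\{s,t\}$ is an $s$-$t$-separator if $s$ and $t$ lie in different components of $G-S$, and it is minimum if no $s$-$t$-separator has fewer vertices. It is a yes-instance if there are $0\le r\le \ell$ and minimum $s$-$t$-separators $A=S_0,S_1,\dots,S_r=B$ such that for each $0\le i<r$ one has $S_{i+1}=(S_i\setminus\{v\})\cup\{u\}$ for some $v\in S_i$ and $u\in V(G)\setminus S_i$ (a token jump). The parameter is $\ell$. **Theorem.** TJ Minimum Separator Reconfiguration, parameterized by the number $\ell$ of allowed jumps, admits a polynomial-time kernel with $\mathcal O(\ell^2)$ vertices and edges. More precisely, there is a polynomial-time algorithm that transforms every instance $(G,s,t,A,B,\ell)$ into an instance $(G',s',t',A',B',\ell')$ of the same problem such that 1. $(G,s,t,A,B,\ell)$ is a yes-instance if and only if $(G',s',t',A',B',\ell')$ is a yes-instance; 2. $\ell'\le \ell$; 3. with $m=\max\{1,\ell\}$,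 $\;|V(G')|\le 8m^2+5m\;$ and $\;|E(G')|\le 12m^2+7m$. (The input is encoded by the adjacency matrix of $G$, the vertices $s,t$, the characteristic vectors of $A$ and $B$, and $\ell$ in binary; polynomial time is measured in the length of this encoding.) -/

import Mathlib

namespace MSR

/-! ### Minimum separators and token jumping -/

/-- `S` is an `s`-`t`-separator of `G`: the vertices `s` and `t` survive in `G - S` and lie in
different connected components of `G - S`. -/
def IsSeparator {V : Type*} (G : SimpleGraph V) (s t : V) (S : Finset V) : Prop :=
  ∃ (hs : s ∉ S) (ht : t ∉ S), ¬ (G.induce {v | v ∉ S}).Reachable ⟨s, hs⟩ ⟨t, ht⟩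

/-- An `s`-`t`-separator of minimum size. -/
def IsMinSeparator {V : Type*} (G : SimpleGraph V) (s t : V) (S : Finset V) : Prop :=
  IsSeparator G s t S ∧ ∀ T : Finset V, IsSeparator G s t T → S.card ≤ T.card

/-- One token jump: `S' = (S \ {v}) ∪ {u}` with `v ∈ S` and `u ∉ S`. -/
def TokenJump {V : Type*} [DecidableEq V] (S S' : Finset V) : Prop :=
  ∃ v ∈ S, ∃ u, u ∉ S ∧ S' = (S \ {v}) ∪ {u}

/-- `A` can be transformed into `B` by exactly `r` token jumps through minimum
`s`-`t`-separators `S 0 = A, S 1, …, S r = B`. -/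
def ReconfigurableIn {V : Type*} [DecidableEq V] (G : SimpleGraph V) (s t : V)
    (A B : Finset V) (r : ℕ) : Prop :=
  ∃ S : ℕ → Finset V, S 0 = A ∧ S r = B ∧
    (∀ i ≤ r, IsMinSeparator G s t (S i)) ∧ ∀ i < r, TokenJump (S i) (S (i + 1))

/-- An instance of TJ Minimum Separator Reconfiguration: a finite simple graph (on the vertex set
`{0, …, n - 1}`), vertices `s` and `t`, two minimum `s`-`t`-separators `A` and `B`, and the
parameter `ℓ`, the number of allowed jumps. The existence of a separator forces
`s` and `t` to be distinct and non-adjacent. -/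
structure TJInstance where
  n : ℕ
  G : SimpleGraph (Fin n)
  s : Fin n
  t : Fin n
  A : Finset (Fin n)
  B : Finset (Fin n)
  ℓ : ℕ
  minA : IsMinSeparator G s t A
  minB : IsMinSeparator G s t B

/-- Yes-instance: at most `ℓ` token jumps transform `A` into `B`. -/
def TJInstance.IsYes (I : TJInstance) : Prop :=
  ∃ r ≤ I.ℓ, ReconfigurableIn I.G I.s I.t I.A I.B r

/-! ### Polynomial time

The model of computation is a while language over binary trees, with no built-in arithmetic
and with the size of the manipulated trees charged to every operation. A run of cost `T` only
handles trees of size at most `T` and can be replayed by a Turing machine in time polynomial in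
`T`; conversely one step of a Turing machine is simulated at a cost linear in the size of its
configuration. Hence the functions computed at polynomial cost are the usual polynomial-time
computable functions. -/

/-- Binary trees, the data of the programming language. -/
inductive Data : Type
  | leaf : Data
  | node : Data → Data → Data

namespace Data

/-- The number of nodes of a tree, leaves included. -/
def size : Data → ℕ
  | leaf => 1
  | node x y => x.size + y.size + 1

/-- Left subtree (`leaf` for `leaf`). -/
def head : Data → Data
  | leaf => leaf
  | node x _ => x

/-- Right subtree (`leaf` for `leaf`). -/
def tail : Data → Data
  | leaf => leaf
  | node _ y => y

/-- A list of trees as a tree. -/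
def ofList : List Data → Data
  | [] => leaf
  | x :: xs => node x (ofList xs)

/-- A truth value as a tree. -/
def ofBool : Bool → Data
  | false => leaf
  | true => node leaf leaf

/-- A natural number in unary. -/
def unary (n : ℕ) : Data := ofList (List.replicate n leaf)

/-- A natural number in binary, least significant bit first. -/
def binary (n : ℕ) : Data := ofList (n.bits.map ofBool)

end Data

/-- Programs; every program describes a (partial) map from trees to trees. -/
inductive Prog : Type
  /-- the input itself -/
  | id : Prog
  /-- the constant `leaf` -/
  | leaf : Prog
  /-- left subtree of the input -/
  | head : Prog
  /-- right subtree of the input -/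
  | tail : Prog
  /-- the tree whose left and right subtrees are the results of `p` and `q` on the input -/
  | pair (p q : Prog) : Prog
  /-- first `p`, then `q` on the result -/
  | seq (p q : Prog) : Prog
  /-- `p` if the test `c` gives a tree other than `leaf` on the input, and `q` otherwise -/
  | ite (c p q : Prog) : Prog
  /-- as long as the test `c` gives a tree other than `leaf` on the current tree,
  replace the current tree by the result of `p` on it -/
  | loop (c p : Prog) : Prog

/-- `Runs p x y T`: the program `p` halts on input `x` with result `y` and cost `T`. -/
inductive Runs : Prog → Data → Data → ℕ → Prop
  | id (x : Data) : Runs .id x x (x.size + 1)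
  | leaf (x : Data) : Runs .leaf x .leaf (x.size + 1)
  | head (x : Data) : Runs .head x x.head (x.size + 1)
  | tail (x : Data) : Runs .tail x x.tail (x.size + 1)
  | pair {p q : Prog} {x y z : Data} {a b : ℕ} (hp : Runs p x y a) (hq : Runs q x z b) :
      Runs (.pair p q) x (.node y z) (a + b + x.size + 1)
  | seq {p q : Prog} {x y z : Data} {a b : ℕ} (hp : Runs p x y a) (hq : Runs q y z b) :
      Runs (.seq p q) x z (a + b + 1)
  | iteTrue {c p q : Prog} {x y z : Data} {a b : ℕ} (hc : Runs c x y a) (hy : y ≠ .leaf)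
      (hp : Runs p x z b) : Runs (.ite c p q) x z (a + b + x.size + 1)
  | iteFalse {c p q : Prog} {x z : Data} {a b : ℕ} (hc : Runs c x .leaf a)
      (hq : Runs q x z b) : Runs (.ite c p q) x z (a + b + x.size + 1)
  | loopDone {c p : Prog} {x : Data} {a : ℕ} (hc : Runs c x .leaf a) :
      Runs (.loop c p) x x (a + x.size + 1)
  | loopStep {c p : Prog} {x y x' z : Data} {a b d : ℕ} (hc : Runs c x y a) (hy : y ≠ .leaf)
      (hp : Runs p x x' b) (hl : Runs (.loop c p) x' z d) :
      Runs (.loop c p) x z (a + b + d + x.size + 1)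

open Classical in
/-- The input format: number of vertices, adjacency matrix, the vertices `s` and `t` (in unary),
the characteristic vectors of `A` and `B`, and `ℓ` in binary. -/
noncomputable def TJInstance.encode (I : TJInstance) : Data :=
  Data.ofList
    [Data.unary I.n,
      Data.ofList (List.ofFn fun i : Fin I.n =>
        Data.ofList (List.ofFn fun j : Fin I.n => Data.ofBool (decide (I.G.Adj i j)))),
      Data.unary I.s,
      Data.unary I.t,
      Data.ofList (List.ofFn fun i : Fin I.n => Data.ofBool (decide (i ∈ I.A))),
      Data.ofList (List.ofFn fun i : Fin I.n => Data.ofBool (decide (i ∈ I.B))),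
      Data.binary I.ℓ]

/-- `f` is computed by one program whose cost is bounded by a polynomial in the input size. -/
def PolyTimeComputable (f : TJInstance → TJInstance) : Prop :=
  ∃ (p : Prog) (P : Polynomial ℕ), ∀ I : TJInstance,
    ∃ T ≤ P.eval I.encode.size, Runs p I.encode (f I).encode T

end MSR

open Polynomial

namespace MSR

/-! ### Programs with polynomial cost -/

/-! Order the minimum `s`-`t`-separators by the set of vertices that stay reachable from `s`. They
form a lattice: join and meet of two separators use up exactly the vertices of both, so a count of
vertices forces both to be minimum (`IsMinSeparator.join_meet`). Joining or meeting with a fixed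
separator turns a jump into a jump or into nothing. Hence sequences can be made monotone
(`exists_monotone_steps`), and since a monotone sequence never revisits a vertex, its length is
controlled by the number of vertices visited. It follows that `A` and `B` are within `ℓ` jumps of
each other if and only if their meet and join are, by jumps inside the interval between these two
(`exists_steps_meet_join`, `exists_steps_of_meet_join`).

In this interval, let tokens advance greedily from the meet by shortest jumps. Every token traces a
chain of vertices, and once the join is reached every minimum separator of the interval contains
exactly one vertex of each chain (`SweepInv`). A separator is thus a vector of ranks. The vectors
that occur are those closed under pairwise constraints coming from walks between chains: if one
token has passed `p`, the other must have reached `q` (`Layout.inIcc_iff`). A jump changes one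
coordinate.

In a yes-instance every chain with at least two vertices costs a jump, so there are `k ≤ ℓ` of them.
Only undominated constraints are needed, and a position has at most two such partners in every other
chain (`card_essentialAt_le`). Follow `c ≤ ℓ` jumps from bottom to top: if `p` is never occupied,
its token leaps over it in one jump, and the constraint read in both directions pins the other token
to `q` at that moment. So the at most `k + c` occupied positions meet all constraints
(`exists_cover`), and only `O(ℓ²)` positions lie in an essential constraint or end a chain. Dropping
the others loses nothing, because tokens may be rounded up to the next kept position
(`exists_steps_iff`).

The remaining system is again a graph: one path between the new source and target per chain and one
edge per kept constraint; its minimum separators are the closed rank vectors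
(`ColumnGraph.isMinSeparator_iff`). If the greedy process misses the join or the graph is too large,
the instance is a no-instance and a fixed small one is returned. Polynomial time follows from
closure properties of `Comp`. -/

theorem Runs.size_lt {p : Prog} {x y : Data} {T : ℕ} (h : Runs p x y T) : y.size < T := by
  induction h with
  | id x => omega
  | leaf x => cases x <;> simp [Data.size]
  | head x => cases x <;> simp [Data.size, Data.head]; omega
  | tail x => cases x <;> simp [Data.size, Data.tail]; omega
  | pair _ _ h1 h2 => simp only [Data.size]; omega
  | _ => omega

/-- `p` computes `y` from `x` at cost at most `N`. -/
def RunsLE (p : Prog) (x y : Data) (N : ℕ) : Prop := ∃ T ≤ N, Runs p x y T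

namespace RunsLE

variable {p q c : Prog} {x y z x' : Data} {a b d N : ℕ}

theorem mono (h : RunsLE p x y a) (hab : a ≤ b) : RunsLE p x y b :=
  let ⟨T, hT, hr⟩ := h; ⟨T, hT.trans hab, hr⟩

theorem id : RunsLE .id x x (x.size + 1) := ⟨_, le_rfl, .id x⟩
theorem leaf : RunsLE .leaf x .leaf (x.size + 1) := ⟨_, le_rfl, .leaf x⟩
theorem head : RunsLE .head x x.head (x.size + 1) := ⟨_, le_rfl, .head x⟩
theorem tail : RunsLE .tail x x.tail (x.size + 1) := ⟨_, le_rfl, .tail x⟩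

theorem pair (hp : RunsLE p x y a) (hq : RunsLE q x z b) :
    RunsLE (.pair p q) x (.node y z) (a + b + x.size + 1) := by
  obtain ⟨T, hT, h⟩ := hp
  obtain ⟨T', hT', h'⟩ := hq
  exact ⟨_, by omega, .pair h h'⟩

theorem seq (hp : RunsLE p x y a) (hq : RunsLE q y z b) : RunsLE (.seq p q) x z (a + b + 1) := by
  obtain ⟨T, hT, h⟩ := hp
  obtain ⟨T', hT', h'⟩ := hq
  exact ⟨_, by omega, .seq h h'⟩

theorem iteTrue (hc : RunsLE c x y a) (hy : y ≠ .leaf) (hp : RunsLE p x z b) :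
    RunsLE (.ite c p q) x z (a + b + x.size + 1) := by
  obtain ⟨T, hT, h⟩ := hc
  obtain ⟨T', hT', h'⟩ := hp
  exact ⟨_, by omega, .iteTrue h hy h'⟩

theorem iteFalse (hc : RunsLE c x .leaf a) (hq : RunsLE q x z b) :
    RunsLE (.ite c p q) x z (a + b + x.size + 1) := by
  obtain ⟨T, hT, h⟩ := hc
  obtain ⟨T', hT', h'⟩ := hq
  exact ⟨_, by omega, .iteFalse h h'⟩

theorem loopDone (hc : RunsLE c x .leaf a) : RunsLE (.loop c p) x x (a + x.size + 1) := by
  obtain ⟨T, hT, h⟩ := hc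
  exact ⟨_, by omega, .loopDone h⟩

theorem loopStep (hc : RunsLE c x y a) (hy : y ≠ .leaf) (hp : RunsLE p x x' b)
    (hl : RunsLE (.loop c p) x' z d) : RunsLE (.loop c p) x z (a + b + d + x.size + 1) := by
  obtain ⟨T, hT, h⟩ := hc
  obtain ⟨T', hT', h'⟩ := hp
  obtain ⟨T'', hT'', h''⟩ := hl
  exact ⟨_, by omega, .loopStep h hy h' h''⟩

theorem size_le (h : RunsLE p x y a) : y.size ≤ a := by
  obtain ⟨T, hT, h⟩ := h
  exact h.size_lt.le.trans hT

end RunsLE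

theorem eval_mono (P : ℕ[X]) {a b : ℕ} (h : a ≤ b) : P.eval a ≤ P.eval b := by
  rw [Polynomial.eval_eq_sum, Polynomial.eval_eq_sum]
  exact Finset.sum_le_sum fun n _ => Nat.mul_le_mul_left _ (Nat.pow_le_pow_left h n)

/-- Types whose elements are represented by trees. -/
class Enc (α : Type) where
  enc : α → Data

open Enc

/-- The size of the representation. -/
def sz {α : Type} [Enc α] (a : α) : ℕ := (enc a).size

instance : Enc Unit := ⟨fun _ => .leaf⟩
instance : Enc Bool := ⟨Data.ofBool⟩
-- Numbers are unary, so size is linear in the value. The number of jumps, which is given in binary,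
-- is kept as a list of digits instead.
instance : Enc ℕ := ⟨Data.unary⟩
instance {α β : Type} [Enc α] [Enc β] : Enc (α × β) := ⟨fun p => .node (enc p.1) (enc p.2)⟩
instance {α : Type} [Enc α] : Enc (List α) := ⟨fun l => Data.ofList (l.map enc)⟩

section sizes

variable {α β : Type} [Enc α] [Enc β]

@[simp] theorem sz_pair (a : α) (b : β) : sz (a, b) = sz a + sz b + 1 := rfl
@[simp] theorem sz_nil : sz ([] : List α) = 1 := rfl
@[simp] theorem sz_cons (a : α) (l : List α) : sz (a :: l) = sz a + sz l + 1 := rfl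

theorem sz_bool (b : Bool) : sz b ≤ 3 := by cases b <;> decide

@[simp] theorem sz_nat (n : ℕ) : sz n = 2 * n + 1 := by
  induction n with
  | zero => rfl
  | succ n ih =>
    have : sz (n + 1) = 1 + sz n + 1 := rfl
    omega

theorem length_le_sz (l : List α) : l.length ≤ sz l := by
  induction l with
  | nil => simp
  | cons a l ih => simp; omega

theorem sz_le_of_mem {l : List α} {a : α} (h : a ∈ l) : sz a ≤ sz l := by
  induction l with
  | nil => simp at h
  | cons b l ih =>
    rcases List.mem_cons.1 h with rfl | h
    · simp; omega
    · have := ih h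
      simp; omega

@[simp] theorem sz_append (l l' : List α) : sz (l ++ l') + 1 = sz l + sz l' := by
  induction l with
  | nil => simp; omega
  | cons a l ih => simp; omega

@[simp] theorem sz_reverse (l : List α) : sz l.reverse = sz l := by
  induction l with
  | nil => rfl
  | cons a l ih =>
    have := sz_append l.reverse [a]
    simp only [List.reverse_cons, sz_cons, sz_nil] at this ⊢
    omega

theorem sz_le_length_mul {l : List α} {N : ℕ} (h : ∀ a ∈ l, sz a ≤ N) :
    sz l ≤ l.length * (N + 1) + 1 := by
  induction l with
  | nil => simp
  | cons a l ih =>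
    have h1 := h a (by simp)
    have h2 := ih fun b hb => h b (by simp [hb])
    simp only [sz_cons, List.length_cons, add_mul]
    omega

theorem sz_le_of_sublist {l l' : List α} (h : l.Sublist l') : sz l ≤ sz l' := by
  induction h with
  | slnil => simp
  | cons a _ ih => simp; omega
  | cons_cons a _ ih => simp; omega

end sizes

/-- `f` is computed by a program at polynomial cost. -/
@[fun_prop]
def Comp {α β : Type} [Enc α] [Enc β] (f : α → β) : Prop :=
  ∃ (p : Prog) (P : ℕ[X]), ∀ a, RunsLE p (enc a) (enc (f a)) (P.eval (sz a))

/-- `g` is bounded by a polynomial in the size of the argument. -/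
def PolyBdd {α : Type} [Enc α] (g : α → ℕ) : Prop :=
  ∃ P : ℕ[X], ∀ a, g a ≤ P.eval (sz a)

/-! ### Closure properties of functions of polynomial cost -/

section closure

variable {α β γ δ : Type} [Enc α] [Enc β] [Enc γ] [Enc δ]

theorem PolyBdd.add {f g : γ → ℕ} (hf : PolyBdd f) (hg : PolyBdd g) :
    PolyBdd (fun x => f x + g x) := by
  obtain ⟨P, hP⟩ := hf
  obtain ⟨Q, hQ⟩ := hg
  exact ⟨P + Q, fun x => by rw [eval_add]; exact add_le_add (hP x) (hQ x)⟩

theorem PolyBdd.mul {f g : γ → ℕ} (hf : PolyBdd f) (hg : PolyBdd g) :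
    PolyBdd (fun x => f x * g x) := by
  obtain ⟨P, hP⟩ := hf
  obtain ⟨Q, hQ⟩ := hg
  exact ⟨P * Q, fun x => by rw [eval_mul]; exact Nat.mul_le_mul (hP x) (hQ x)⟩

theorem PolyBdd.const (c : ℕ) : PolyBdd (fun _ : γ => c) := ⟨C c, fun x => by simp⟩

theorem PolyBdd.eval {f : γ → ℕ} (P : ℕ[X]) (hf : PolyBdd f) :
    PolyBdd (fun x => P.eval (f x)) := by
  obtain ⟨Q, hQ⟩ := hf
  exact ⟨P.comp Q, fun x => by rw [eval_comp]; exact eval_mono P (hQ x)⟩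

theorem PolyBdd.size : PolyBdd (fun x : γ => sz x) := ⟨X, fun x => by simp⟩

theorem Comp.of_bdd {f : γ → α} (p : Prog) {N : γ → ℕ} (hN : PolyBdd N)
    (h : ∀ x, RunsLE p (enc x) (enc (f x)) (N x)) : Comp f :=
  let ⟨P, hP⟩ := hN; ⟨p, P, fun x => (h x).mono (hP x)⟩

theorem Comp.exists_bdd {f : γ → α} (h : Comp f) :
    ∃ (p : Prog) (N : γ → ℕ), PolyBdd N ∧ ∀ x, RunsLE p (enc x) (enc (f x)) (N x) :=
  let ⟨p, P, hP⟩ := h; ⟨p, fun x => P.eval (sz x), ⟨P, fun _ => le_rfl⟩, hP⟩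

/-- Output has to be paid for, so a cost bound is also a size bound. This is what makes polynomial
cost stable under composition. -/
theorem Comp.polyBdd {f : γ → α} (h : Comp f) : PolyBdd (fun x => sz (f x)) :=
  let ⟨_, P, hP⟩ := h; ⟨P, fun x => (hP x).size_le⟩

@[fun_prop]
theorem Comp.id : Comp (fun x : γ => x) :=
  .of_bdd .id (PolyBdd.size.add (.const 1)) fun _ => .id

@[fun_prop]
theorem Comp.comp {f : α → β} {g : γ → α} (hf : Comp f) (hg : Comp g) :
    Comp (fun x => f (g x)) := by
  obtain ⟨p, P, hp⟩ := hf
  obtain ⟨q, Q, hq⟩ := (show Comp g from hg)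
  exact .of_bdd (.seq q p) (((PolyBdd.size.eval Q).add (hg.polyBdd.eval P)).add (.const 1))
    fun x => (hq x).seq (hp (g x))

@[fun_prop]
theorem Comp.pair {f : γ → α} {g : γ → β} (hf : Comp f) (hg : Comp g) :
    Comp (fun x => (f x, g x)) := by
  obtain ⟨p, N, hN, hp⟩ := hf.exists_bdd
  obtain ⟨q, N', hN', hq⟩ := hg.exists_bdd
  exact .of_bdd (.pair p q) (((hN.add hN').add .size).add (.const 1)) fun x => (hp x).pair (hq x)

@[fun_prop]
theorem Comp.fst {f : γ → α × β} (hf : Comp f) : Comp (fun x => (f x).1) :=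
  .comp (f := Prod.fst) (.of_bdd .head (PolyBdd.size.add (.const 1)) fun _ => .head) hf

@[fun_prop]
theorem Comp.snd {f : γ → α × β} (hf : Comp f) : Comp (fun x => (f x).2) :=
  .comp (f := Prod.snd) (.of_bdd .tail (PolyBdd.size.add (.const 1)) fun _ => .tail) hf

/-- A program with constant result. -/
def constProg : Data → Prog
  | .leaf => .leaf
  | .node x y => .pair (constProg x) (constProg y)

theorem exists_runsLE_constProg (d : Data) :
    ∃ c : ℕ, ∀ x, RunsLE (constProg d) x d (c * (x.size + 1)) := by
  induction d with
  | leaf => exact ⟨1, fun x => by simpa [constProg] using RunsLE.leaf⟩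
  | node a b ha hb =>
    obtain ⟨c, hc⟩ := ha
    obtain ⟨c', hc'⟩ := hb
    exact ⟨c + c' + 1, fun x => ((hc x).pair (hc' x)).mono (by ring_nf; omega)⟩

@[fun_prop]
theorem Comp.const (a : α) : Comp (fun _ : γ => a) := by
  obtain ⟨c, hc⟩ := exists_runsLE_constProg (enc a)
  exact .of_bdd _ ((PolyBdd.const c).mul (PolyBdd.size.add (.const 1))) fun x => hc _

@[fun_prop]
theorem Comp.ite {b : γ → Bool} {f g : γ → α} (hb : Comp b) (hf : Comp f) (hg : Comp g) :
    Comp (fun x => if b x = true then f x else g x) := by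
  obtain ⟨r, K, hK, hr⟩ := hb.exists_bdd
  obtain ⟨p, N, hN, hp⟩ := hf.exists_bdd
  obtain ⟨q, N', hN', hq⟩ := hg.exists_bdd
  refine .of_bdd (.ite r p q) (((hK.add (hN.add hN')).add .size).add (.const 1)) fun x => ?_
  have h := hr x
  cases hx : b x with
  | true =>
    rw [hx] at h
    exact (h.iteTrue (by simp [enc, Data.ofBool]) (hp x)).mono (by unfold sz; omega)
  | false =>
    rw [hx] at h
    exact (RunsLE.iteFalse h (by simpa using hq x)).mono (by unfold sz; omega)

@[fun_prop]
theorem Comp.cons {f : γ → α} {g : γ → List α} (hf : Comp f) (hg : Comp g) :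
    Comp (fun x => f x :: g x) := by
  obtain ⟨p, P, h⟩ := hf.pair hg
  exact ⟨p, P, h⟩

@[fun_prop]
theorem Comp.tail {g : γ → List α} (hg : Comp g) : Comp (fun x => (g x).tail) := by
  refine .comp (f := List.tail) (.of_bdd .tail (PolyBdd.size.add (.const 1)) fun l => ?_) hg
  cases l <;> exact RunsLE.tail

-- The empty list is the only list encoded by `leaf`, so a list serves as its own test for being
-- nonempty.
@[fun_prop]
theorem Comp.isEmpty {g : γ → List α} (hg : Comp g) : Comp (fun x => (g x).isEmpty) := by
  refine .comp (f := List.isEmpty) ?_ hg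
  refine .of_bdd (.ite .id .leaf (.pair .leaf .leaf))
    (N := fun l => (sz l + 1) + (2 * (sz l + 1) + sz l + 1) + sz l + 1)
    ((((PolyBdd.size.add (.const 1)).add ((((PolyBdd.const 2).mul (PolyBdd.size.add
      (.const 1))).add .size).add (.const 1))).add .size).add (.const 1)) fun l => ?_
  cases l with
  | nil =>
    refine (RunsLE.iteFalse .id (.pair .leaf .leaf)).mono ?_
    have : (enc ([] : List α)).size = 1 := rfl
    simp [sz, this, Data.size]
  | cons a l => exact (RunsLE.iteTrue .id (by simp [enc, Data.ofList]) .leaf).mono (by simp [sz])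

@[fun_prop]
theorem Comp.headD {g : γ → List α} {d : γ → α} (hg : Comp g) (hd : Comp d) :
    Comp (fun x => (g x).headD (d x)) := by
  obtain ⟨p, N, hN, hp⟩ := hg.exists_bdd
  obtain ⟨q, N', hN', hq⟩ := hd.exists_bdd
  refine .of_bdd (.ite p (.seq p .head) q)
    (N := fun x => N x + ((N x + (sz (g x) + 1) + 1) + N' x) + sz x + 1)
    (((hN.add (((hN.add (hg.polyBdd.add (.const 1))).add (.const 1)).add hN')).add .size).add
      (.const 1)) fun x => ?_
  have h := hp x
  cases hx : g x with
  | nil =>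
    rw [hx] at h
    exact (RunsLE.iteFalse h (hq x)).mono (by unfold sz; omega)
  | cons a l =>
    rw [hx] at h
    exact (h.iteTrue (by simp [enc, Data.ofList]) (h.seq .head)).mono (by unfold sz; omega)

/-- The program that folds `f` over a list; it acts on the remaining list, the context and the
accumulator. -/
def foldProg (f : Prog) : Prog :=
  .loop .head (.pair (.seq .head .tail) (.pair (.seq .tail .head)
    (.seq (.pair (.seq .tail .head) (.pair (.seq .tail .tail) (.seq .head .head))) f)))

/-- Here `s` bounds the remaining list and `q` all intermediate accumulators, so `s + sz x + q + 2`
bounds both the loop state and the argument of the step. The factor 30 generously covers the fixed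
number of copies made in a round; the extra round is the final test. -/
theorem runsLE_foldProg {f : γ → β → α → β} {p : Prog} {P : ℕ[X]}
    (hp : ∀ z : γ × β × α, RunsLE p (enc z) (enc (f z.1 z.2.1 z.2.2)) (P.eval (sz z)))
    (x : γ) {s q : ℕ} (l : List α) (i : β) (hs : sz l ≤ s)
    (hb : ∀ l', l' <+: l → sz (l'.foldl (f x) i) ≤ q) :
    RunsLE (foldProg p) (enc (l, x, i)) (enc (([] : List α), x, l.foldl (f x) i))
      ((l.length + 1) * (P.eval (s + sz x + q + 2) + 30 * (s + sz x + q + 2))) := by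
  induction l generalizing i with
  | nil =>
    have h0 := hb [] (by simp)
    refine (RunsLE.loopDone .head).mono ?_
    have : (enc (([] : List α), x, i)).size = sz (([] : List α), x, i) := rfl
    simp at this h0 hs ⊢
    omega
  | cons a l ih =>
    have h0 : sz i ≤ q := by simpa using hb [] (by simp)
    have key := ih (f x i a) (by simp at hs; omega) fun l' hl' => by
      simpa using hb (a :: l') (by simpa using hl')
    have e : (enc (a :: l, x, i)).size = sz (a :: l, x, i) := rfl
    have hstep : RunsLE p (enc (x, i, a)) (enc (f x i a)) _ := hp (x, i, a)
    have hin : RunsLE (.pair (.seq .tail .head) (.pair (.seq .tail .tail) (.seq .head .head)))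
        (enc (a :: l, x, i)) (enc (x, i, a)) _ :=
      (RunsLE.tail.seq .head).pair ((RunsLE.tail.seq .tail).pair (RunsLE.head.seq .head))
    have hbody : RunsLE (.pair (.seq .head .tail) (.pair (.seq .tail .head)
        (.seq (.pair (.seq .tail .head) (.pair (.seq .tail .tail) (.seq .head .head))) p)))
        (enc (a :: l, x, i)) (enc (l, x, f x i a)) _ :=
      (RunsLE.head.seq .tail).pair ((RunsLE.tail.seq .head).pair (hin.seq hstep))
    refine (RunsLE.loopStep .head (by simp [enc, Data.ofList, Data.head]) hbody key).mono ?_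
    have hm : P.eval (sz (x, i, a)) ≤ P.eval (s + sz x + q + 2) := by
      apply eval_mono
      simp at hs ⊢
      omega
    have e1 : (enc (a :: l, x, i)).head.size = sz (a :: l) := rfl
    have e2 : (enc (a :: l, x, i)).tail.size = sz (x, i) := rfl
    simp only [e, e1, e2]
    have : (l.length + 1 + 1) * (P.eval (s + sz x + q + 2) + 30 * (s + sz x + q + 2)) =
      (l.length + 1) * (P.eval (s + sz x + q + 2) + 30 * (s + sz x + q + 2)) +
        (P.eval (s + sz x + q + 2) + 30 * (s + sz x + q + 2)) := by ring
    rw [List.length_cons, this]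
    generalize (l.length + 1) * (P.eval (s + sz x + q + 2) + 30 * (s + sz x + q + 2)) = B
    generalize P.eval (s + sz x + q + 2) = A at hm ⊢
    generalize P.eval (sz (x, i, a)) = A' at hm ⊢
    simp at hs ⊢
    omega

/-- Iterating a cheap step can produce exponentially large accumulators. Therefore a polynomial
bound on the accumulator after every prefix is part of the hypotheses. -/
theorem Comp.foldl {l : γ → List α} {i : γ → β} {f : γ → β → α → β} (hl : Comp l) (hi : Comp i)
    (hf : Comp (fun z : γ × β × α => f z.1 z.2.1 z.2.2)) {q : γ → ℕ} (hq : PolyBdd q)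
    (hb : ∀ x l', l' <+: l x → sz (l'.foldl (f x) (i x)) ≤ q x) :
    Comp (fun x => (l x).foldl (f x) (i x)) := by
  obtain ⟨p, P, hp⟩ := hf
  obtain ⟨r, N, hN, hr⟩ := (hl.pair (Comp.id.pair hi)).exists_bdd
  have hout : Comp (fun x : List α × γ × β => x.2.2) := .snd (.snd .id)
  obtain ⟨o, O, ho⟩ := hout
  have hsum := ((hl.polyBdd.add PolyBdd.size).add hq).add (.const 2)
  refine .of_bdd (.seq r (.seq (foldProg p) o))
    ((hN.add (((hl.polyBdd.add (.const 1)).mul ((hsum.eval P).add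
      ((PolyBdd.const 30).mul hsum))).add
      ((((PolyBdd.const 3).add .size).add hq).eval O) |>.add (.const 1))).add (.const 1))
    fun x => ?_
  have h1 := runsLE_foldProg hp x (l x) (i x) le_rfl (hb x)
  refine (hr x).seq ((h1.mono ?_).seq ((ho _).mono (eval_mono O ?_)))
  · exact Nat.mul_le_mul_right _ (Nat.add_le_add_right (length_le_sz _) 1)
  · have := hb x _ (List.prefix_refl _)
    simp
    omega

end closure

end MSR

open Polynomial

namespace MSR

open Enc

section lists

variable {α β γ δ : Type} [Enc α] [Enc β] [Enc γ] [Enc δ]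

/-! ### Polynomial-time list processing -/

@[fun_prop]
theorem Comp.not {b : γ → Bool} (hb : Comp b) : Comp (fun x => !b x) := by
  convert hb.ite (.const false) (.const true) using 2 with x
  cases b x <;> rfl

@[fun_prop]
theorem Comp.and {b c : γ → Bool} (hb : Comp b) (hc : Comp c) : Comp (fun x => b x && c x) := by
  convert hb.ite hc (.const false) using 2 with x
  cases b x <;> rfl

@[fun_prop]
theorem Comp.or {b c : γ → Bool} (hb : Comp b) (hc : Comp c) : Comp (fun x => b x || c x) := by
  convert hb.ite (.const true) hc using 2 with x
  cases b x <;> rfl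

@[fun_prop]
theorem Comp.reverse {l : γ → List α} (hl : Comp l) : Comp (fun x => (l x).reverse) := by
  have h : Comp (fun x => (l x).foldl (fun acc a => a :: acc) []) := by
    refine hl.foldl (.const []) (.cons (.snd (.snd .id)) (.fst (.snd .id)))
      (q := fun x => sz (l x)) hl.polyBdd fun x l' hl' => ?_
    have := sz_le_of_sublist hl'.sublist
    simpa using this
  convert h using 2 with x
  simp

@[fun_prop]
theorem Comp.append {l l' : γ → List α} (hl : Comp l) (hl' : Comp l') :
    Comp (fun x => l x ++ l' x) := by
  have h : Comp (fun x => (l x).reverse.foldl (fun acc a => a :: acc) (l' x)) := by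
    refine hl.reverse.foldl hl' (.cons (.snd (.snd .id)) (.fst (.snd .id)))
      (q := fun x => sz (l x).reverse + sz (l' x)) (hl.reverse.polyBdd.add hl'.polyBdd)
      fun x m hm => ?_
    have e : m.foldl (fun acc a => a :: acc) (l' x) = m.reverse ++ l' x := by simp
    have h1 := sz_append m.reverse (l' x)
    have h2 := sz_le_of_sublist hm.sublist
    rw [e]
    simp only [sz_reverse] at *
    omega
  convert h using 2 with x
  simp

theorem PolyBdd.sup_mem {l : γ → List α} {f : γ → α → β} (hl : Comp l)
    (hf : Comp (fun z : γ × α => f z.1 z.2)) :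
    ∃ q : γ → ℕ, PolyBdd q ∧ ∀ x, ∀ a ∈ l x, sz (f x a) ≤ q x := by
  obtain ⟨P, hP⟩ := hf.polyBdd
  refine ⟨_, ((PolyBdd.size.add hl.polyBdd).add (.const 1)).eval P, fun x a ha => ?_⟩
  refine (hP (x, a)).trans (eval_mono P ?_)
  have := sz_le_of_mem ha
  simp
  omega

@[fun_prop]
theorem Comp.flatMap {l : γ → List α} {f : γ → α → List β} (hl : Comp l)
    (hf : Comp (fun z : γ × α => f z.1 z.2)) : Comp (fun x => (l x).flatMap (f x)) := by
  have e : ∀ x (m : List α) (acc : List β),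
      m.foldl (fun acc a => acc ++ f x a) acc = acc ++ m.flatMap (f x) := by
    intro x m
    induction m with
    | nil => simp
    | cons a m ih => intro acc; simp [ih]
  obtain ⟨q, hq, hqm⟩ := PolyBdd.sup_mem hl hf
  have h : Comp (fun x => (l x).foldl (fun acc a => acc ++ f x a) []) := by
    refine hl.foldl (.const []) (.append (.fst (.snd .id))
      (hf.comp (g := fun z : γ × List β × α => (z.1, z.2.2)) (.pair (.fst .id) (.snd (.snd .id)))))
      (q := fun x => sz (l x) * q x + 1) ((hl.polyBdd.mul hq).add (.const 1)) fun x m hm => ?_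
    rw [e]
    have h1 : ∀ m : List α, (∀ a ∈ m, sz (f x a) ≤ q x) → sz (m.flatMap (f x)) ≤ m.length * q x + 1 := by
      intro m
      induction m with
      | nil => simp
      | cons a m ih =>
        intro hm
        have h1 := ih fun b hb => hm b (by simp [hb])
        have h2 := hm a (by simp)
        have h3 := sz_append (f x a) (m.flatMap (f x))
        simp only [List.flatMap_cons, List.length_cons, add_mul] at *
        omega
    refine (h1 m fun a ha => hqm x a (hm.subset ha)).trans ?_
    gcongr
    exact hm.length_le.trans (length_le_sz _)
  convert h using 2 with x
  simp [e]

@[fun_prop]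
theorem Comp.map {l : γ → List α} {f : γ → α → β} (hl : Comp l)
    (hf : Comp (fun z : γ × α => f z.1 z.2)) : Comp (fun x => (l x).map (f x)) := by
  convert hl.flatMap (f := fun x a => [f x a]) (hf.cons (.const [])) using 2 with x
  induction l x <;> simp [*]

@[fun_prop]
theorem Comp.filter {l : γ → List α} {p : γ → α → Bool} (hl : Comp l)
    (hp : Comp (fun z : γ × α => p z.1 z.2)) : Comp (fun x => (l x).filter (p x)) := by
  convert hl.flatMap (f := fun x a => if p x a = true then [a] else [])
    (hp.ite (.cons (.snd .id) (.const [])) (.const [])) using 2 with x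
  induction l x with
  | nil => rfl
  | cons a m ih => cases h : p x a <;> simp [h, ih]

@[fun_prop]
theorem Comp.any {l : γ → List α} {p : γ → α → Bool} (hl : Comp l)
    (hp : Comp (fun z : γ × α => p z.1 z.2)) : Comp (fun x => (l x).any (p x)) := by
  convert ((hl.filter hp).isEmpty).not using 2 with x
  induction l x with
  | nil => rfl
  | cons a m ih => cases h : p x a <;> simp [h, ih]

@[fun_prop]
theorem Comp.all {l : γ → List α} {p : γ → α → Bool} (hl : Comp l)
    (hp : Comp (fun z : γ × α => p z.1 z.2)) : Comp (fun x => (l x).all (p x)) := by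
  convert (hl.any (p := fun x a => !p x a) hp.not).not using 2 with x
  induction l x with
  | nil => rfl
  | cons a m ih => cases h : p x a <;> simp [h, ih]

@[fun_prop]
theorem Comp.flatten {l : γ → List (List α)} (hl : Comp l) : Comp (fun x => (l x).flatten) := by
  convert hl.flatMap (f := fun _ a => a) (.snd .id) using 2 with x
  simp [List.flatMap_def]

/-! ### Unary arithmetic -/

/-- A unary number and a list of that many units are the same tree, so arithmetic reduces to list
processing. -/
theorem enc_nat (n : ℕ) : enc n = enc (List.replicate n ()) := by
  simp only [enc, Data.unary, List.map_replicate]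

theorem Comp.replicate {n : γ → ℕ} (hn : Comp n) : Comp (fun x => List.replicate (n x) ()) := by
  obtain ⟨p, P, h⟩ := hn
  exact ⟨p, P, fun x => by rw [← enc_nat]; exact h x⟩

@[fun_prop]
theorem Comp.length {l : γ → List α} (hl : Comp l) : Comp (fun x => (l x).length) := by
  obtain ⟨p, P, h⟩ := hl.map (f := fun _ _ => ()) (.const ())
  refine ⟨p, P, fun x => ?_⟩
  rw [enc_nat]
  simpa using h x

@[fun_prop]
theorem Comp.add {m n : γ → ℕ} (hm : Comp m) (hn : Comp n) : Comp (fun x => m x + n x) := by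
  simpa using (hm.replicate.append hn.replicate).length

@[fun_prop]
theorem Comp.mul {m n : γ → ℕ} (hm : Comp m) (hn : Comp n) : Comp (fun x => m x * n x) := by
  have h := (hm.replicate.flatMap (f := fun x _ => List.replicate (n x) ())
    (hn.replicate.comp (.fst .id))).length
  simpa [List.length_flatMap] using h

/-- A computation repeated a given number of times. -/
theorem Comp.iterate {n : γ → ℕ} {i : γ → β} {f : γ → β → β} (hn : Comp n) (hi : Comp i)
    (hf : Comp (fun z : γ × β => f z.1 z.2)) {q : γ → ℕ} (hq : PolyBdd q)
    (hb : ∀ x m, m ≤ n x → sz ((f x)^[m] (i x)) ≤ q x) :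
    Comp (fun x => (f x)^[n x] (i x)) := by
  have e : ∀ x (l : List Unit) b, l.foldl (fun b _ => f x b) b = (f x)^[l.length] b := by
    intro x l
    induction l with
    | nil => simp
    | cons a l ih => intro b; simp [ih]
  have h : Comp (fun x => (List.replicate (n x) ()).foldl (fun b _ => f x b) (i x)) := by
    refine hn.replicate.foldl hi (hf.comp (g := fun z : γ × β × Unit => (z.1, z.2.1))
      (.pair (.fst .id) (.fst (.snd .id)))) hq fun x l hl => ?_
    rw [e]
    exact hb x _ (by simpa using hl.length_le)
  convert h using 2 with x
  simp [e]

@[fun_prop]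
theorem Comp.drop {n : γ → ℕ} {l : γ → List α} (hn : Comp n) (hl : Comp l) :
    Comp (fun x => (l x).drop (n x)) := by
  have e : ∀ n (l : List α), List.tail^[n] l = l.drop n := by
    intro n
    induction n with
    | zero => simp
    | succ n ih => intro l; simp [ih]
  have h : Comp (fun x => (List.tail)^[n x] (l x)) :=
    hn.iterate hl (f := fun _ l => l.tail) (.tail (.snd .id)) hl.polyBdd fun x m _ => by
      rw [e]
      exact sz_le_of_sublist (List.drop_sublist _ _)
  simpa [e] using h

@[fun_prop]
theorem Comp.getD {n : γ → ℕ} {l : γ → List α} {d : γ → α} (hl : Comp l) (hn : Comp n)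
    (hd : Comp d) : Comp (fun x => (l x).getD (n x) (d x)) := by
  convert (hn.drop hl).headD hd using 2 with x
  rw [List.headD_eq_head?_getD, List.head?_drop, List.getD_eq_getElem?_getD]

@[fun_prop]
theorem Comp.natLE {m n : γ → ℕ} (hm : Comp m) (hn : Comp n) :
    Comp (fun x => decide (m x ≤ n x)) := by
  convert (hn.drop hm.replicate).isEmpty using 2 with x
  rw [List.drop_replicate, Bool.eq_iff_iff]
  simp
  omega

@[fun_prop]
theorem Comp.natLT {m n : γ → ℕ} (hm : Comp m) (hn : Comp n) :
    Comp (fun x => decide (m x < n x)) := by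
  convert (hn.natLE hm).not using 2 with x
  rw [Bool.eq_iff_iff]
  simp

@[fun_prop]
theorem Comp.natEq {m n : γ → ℕ} (hm : Comp m) (hn : Comp n) :
    Comp (fun x => decide (m x = n x)) := by
  convert (hm.natLE hn).and (hn.natLE hm) using 2 with x
  rw [Bool.eq_iff_iff]
  simp
  omega

@[fun_prop]
theorem Comp.mem {l : γ → List ℕ} {v : γ → ℕ} (hl : Comp l) (hv : Comp v) :
    Comp (fun x => decide (v x ∈ l x)) := by
  convert hl.any (p := fun x a => decide (v x = a)) (.natEq (hv.comp (.fst .id)) (.snd .id))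
    using 2 with x
  rw [Bool.eq_iff_iff]
  simp

@[fun_prop]
theorem Comp.range {n : γ → ℕ} (hn : Comp n) : Comp (fun x => List.range (n x)) := by
  have e : ∀ n, (fun l : List ℕ => 0 :: l.map (· + 1))^[n] [] = List.range n := by
    intro n
    induction n with
    | zero => simp
    | succ n ih => rw [Function.iterate_succ_apply', ih, List.range_succ_eq_map]
  have hb := hn.polyBdd
  have h : Comp (fun x => (fun l : List ℕ => 0 :: l.map (· + 1))^[n x] []) := by
    refine hn.iterate (.const []) (f := fun _ l => 0 :: l.map (· + 1))
      (.cons (.const 0) (.map (f := fun _ a => a + 1) (.snd .id) (.add (.snd .id) (.const 1))))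
      (q := fun x => sz (n x) * (2 * sz (n x) + 2) + 1)
      (((hb.mul (((PolyBdd.const 2).mul hb).add (.const 2)))).add (.const 1)) fun x m hm => ?_
    rw [e]
    refine (sz_le_length_mul (N := 2 * sz (n x) + 1) fun a ha => ?_).trans ?_
    · simp at ha ⊢
      omega
    · have : m ≤ sz (n x) := by simp; omega
      simp only [List.length_range]
      gcongr
  simpa [e] using h

end lists

/-- The value of a list of binary digits, truncated at `n`. -/
def truncVal (n : ℕ) (l : List Bool) : ℕ :=
  l.reverse.foldl (fun a b => if decide (n ≤ a + a + if b = true then 1 else 0) = true then n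
    else a + a + if b = true then 1 else 0) 0

-- The binary number may be exponential in its length; capping the accumulator at `n` keeps its
-- unary form polynomial.
@[fun_prop]
theorem Comp.truncVal {γ : Type} [Enc γ] {n : γ → ℕ} {l : γ → List Bool} (hn : Comp n)
    (hl : Comp l) : Comp (fun x => truncVal (n x) (l x)) := by
  have hs : Comp fun z : γ × ℕ × Bool => z.2.1 + z.2.1 + if z.2.2 = true then 1 else 0 :=
    .add (.add (.fst (.snd .id)) (.fst (.snd .id))) (.ite (.snd (.snd .id)) (.const 1) (.const 0))
  have hn' : Comp fun z : γ × ℕ × Bool => n z.1 := hn.comp (.fst .id)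
  refine hl.reverse.foldl (f := fun x a b =>
    if decide (n x ≤ a + a + if b = true then 1 else 0) = true then n x
    else a + a + if b = true then 1 else 0) (.const 0) (.ite (.natLE hn' hs) hn' hs)
    (q := fun x => sz (n x)) hn.polyBdd fun x l' _ => ?_
  induction l' using List.reverseRecOn with
  | nil => simp
  | append_singleton l' b _ =>
    rw [List.foldl_append]
    simp only [List.foldl_cons, List.foldl_nil]
    generalize List.foldl _ _ _ = a
    split_ifs <;> simp_all <;> omega

/-- After reversal this is Horner's rule from the most significant digit. Capping in every round is
harmless, since doubling keeps a value that is at least `n` at least `n`. -/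
theorem truncVal_bits (n ℓ : ℕ) : truncVal n ℓ.bits = min ℓ n := by
  induction ℓ using Nat.binaryRec' with
  | zero => simp [truncVal]
  | bit b m h ih =>
    rw [Nat.bits_append_bit _ _ h]
    unfold truncVal at ih ⊢
    rw [List.reverse_cons, List.foldl_append, ih]
    cases b <;> simp [Nat.bit] <;> split_ifs <;> omega

end MSR

open Polynomial

namespace MSR

/-! ### The kernelization algorithm -/

/-- The input: number of vertices, adjacency matrix, `s`, `t`, the characteristic vectors of the
two separators, the binary digits of the number of jumps. -/
abbrev Input : Type :=
  ℕ × List (List Bool) × ℕ × ℕ × List Bool × List Bool × List Bool × Unit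

/-- Positions of tokens: vertex, index of the chain, index in the chain, is it the last one. -/
abbrev Pos : Type := ℕ × ℕ × ℕ × Bool

namespace Input

variable {γ : Type} [Enc γ]

/-- The number of vertices. -/
abbrev n (x : Input) : ℕ := x.1
/-- The source. -/
abbrev src (x : Input) : ℕ := x.2.2.1
/-- The target. -/
abbrev tgt (x : Input) : ℕ := x.2.2.2.1

/-- Adjacency. -/
def adj (x : Input) (u v : ℕ) : Bool := (x.2.1.getD u []).getD v false

@[fun_prop]
theorem comp_adj {x : γ → Input} {u v : γ → ℕ} (hx : Comp x) (hu : Comp u) (hv : Comp v) :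
    Comp fun z => adj (x z) (u z) (v z) := by
  unfold adj
  fun_prop

/-- The members of the first separator. -/
def setA (x : Input) : List ℕ := (List.range x.n).filter fun v => x.2.2.2.2.1.getD v false
/-- The members of the second separator. -/
def setB (x : Input) : List ℕ := (List.range x.n).filter fun v => x.2.2.2.2.2.1.getD v false

@[fun_prop]
theorem comp_setA {x : γ → Input} (hx : Comp x) : Comp fun z => setA (x z) := by
  unfold setA
  fun_prop

@[fun_prop]
theorem comp_setB {x : γ → Input} (hx : Comp x) : Comp fun z => setB (x z) := by
  unfold setB
  fun_prop

/-- One round of a search that avoids `D`. -/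
def reachStep (x : Input) (D R : List ℕ) : List ℕ :=
  (List.range x.n).filter fun v =>
    decide (v ∈ R) || (!decide (v ∈ D) && R.any fun u => adj x u v)

@[fun_prop]
theorem comp_reachStep {x : γ → Input} {D R : γ → List ℕ} (hx : Comp x) (hD : Comp D)
    (hR : Comp R) : Comp fun z => reachStep (x z) (D z) (R z) := by
  unfold reachStep
  fun_prop

/-- The vertices that are reachable from `a` on walks avoiding `D` after the start. -/
def reach (x : Input) (D : List ℕ) (a : ℕ) : List ℕ := (reachStep x D)^[x.n] [a]

@[fun_prop]
theorem comp_reach {x : γ → Input} {D : γ → List ℕ} {a : γ → ℕ} (hx : Comp x) (hD : Comp D)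
    (ha : Comp a) : Comp fun z => reach (x z) (D z) (a z) := by
  unfold reach
  have h1 : Comp fun z => [a z] := by fun_prop
  have h2 : Comp fun z => List.range (x z).n := by fun_prop
  refine Comp.iterate (n := fun z => (x z).n) (f := fun z => reachStep (x z) (D z)) (by fun_prop)
    h1 (by fun_prop) (h1.polyBdd.add h2.polyBdd) fun z m _ => ?_
  cases m with
  | zero => exact Nat.le_add_right _ _
  | succ m =>
    rw [Function.iterate_succ_apply']
    exact (sz_le_of_sublist List.filter_sublist).trans (Nat.le_add_left _ _)

/-- The component of the source after removing `S`. -/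
def side (x : Input) (S : List ℕ) : List ℕ := reach x S x.src

@[fun_prop]
theorem comp_side {x : γ → Input} {S : γ → List ℕ} (hx : Comp x) (hS : Comp S) :
    Comp fun z => side (x z) (S z) := by
  unfold side
  fun_prop

/-- The meet of the two separators. -/
def lo (x : Input) : List ℕ := (List.range x.n).filter fun w =>
  (decide (w ∈ setA x) && decide (w ∈ setB x)) ||
    ((decide (w ∈ setA x) || decide (w ∈ setB x)) &&
      (decide (w ∈ side x (setA x)) || decide (w ∈ side x (setB x))))

@[fun_prop]
theorem comp_lo {x : γ → Input} (hx : Comp x) : Comp fun z => lo (x z) := by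
  unfold lo
  fun_prop

/-- The join of the two separators. -/
def hi (x : Input) : List ℕ := (List.range x.n).filter fun w =>
  (decide (w ∈ setA x) || decide (w ∈ setB x)) &&
    !(decide (w ∈ side x (setA x)) || decide (w ∈ side x (setB x)))

@[fun_prop]
theorem comp_hi {x : γ → Input} (hx : Comp x) : Comp fun z => hi (x z) := by
  unfold hi
  fun_prop

/-- Replace `v` by `u`. -/
def swap (S : List ℕ) (v u : ℕ) : List ℕ := S.map fun a => if decide (a = v) = true then u else a

@[fun_prop]
theorem comp_swap {S : γ → List ℕ} {u v : γ → ℕ} (hS : Comp S) (hv : Comp v) (hu : Comp u) :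
    Comp fun z => swap (S z) (v z) (u z) := by
  unfold swap
  fun_prop

/-- The jump from `v` to `u` leads from `S` to a separator closer to the target. -/
def advances (x : Input) (S : List ℕ) (v u : ℕ) : Bool :=
  !decide (u ∈ S) && !decide (u = x.src) && !decide (u = x.tgt) &&
    !decide (x.tgt ∈ side x (swap S v u)) && decide (v ∈ side x (swap S v u))

@[fun_prop]
theorem comp_advances {x : γ → Input} {S : γ → List ℕ} {u v : γ → ℕ} (hx : Comp x) (hS : Comp S)
    (hv : Comp v) (hu : Comp u) : Comp fun z => advances (x z) (S z) (v z) (u z) := by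
  unfold advances
  fun_prop

/-- The jump from `v` to `u` is a shortest one towards `hi x`. -/
def advancesMin (x : Input) (S : List ℕ) (v u : ℕ) : Bool :=
  advances x S v u && (decide (u ∈ hi x) || decide (u ∈ side x (hi x))) &&
    (List.range x.n).all fun q => !(advances x S v q && decide (q ∈ side x (swap S v u)))

@[fun_prop]
theorem comp_advancesMin {x : γ → Input} {S : γ → List ℕ} {u v : γ → ℕ} (hx : Comp x)
    (hS : Comp S) (hv : Comp v) (hu : Comp u) :
    Comp fun z => advancesMin (x z) (S z) (v z) (u z) := by
  unfold advancesMin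
  fun_prop

/-- The current places of the tokens. -/
def heads (C : List (List ℕ)) : List ℕ := C.map fun c => c.headD 0

@[fun_prop]
theorem comp_heads {C : γ → List (List ℕ)} (hC : Comp C) : Comp fun z => heads (C z) := by
  unfold heads
  fun_prop

/-- The possible shortest jumps. -/
def moves (x : Input) (S : List ℕ) : List (ℕ × ℕ) :=
  S.flatMap fun v => ((List.range x.n).filter fun u => advancesMin x S v u).map fun u => (v, u)

@[fun_prop]
theorem comp_moves {x : γ → Input} {S : γ → List ℕ} (hx : Comp x) (hS : Comp S) :
    Comp fun z => moves (x z) (S z) := by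
  unfold moves
  fun_prop

/-- Perform a jump. -/
def push (C : List (List ℕ)) (p : ℕ × ℕ) : List (List ℕ) :=
  C.map fun c => if decide (c.headD 0 = p.1) = true then p.2 :: c else c

@[fun_prop]
theorem comp_push {C : γ → List (List ℕ)} {p : γ → ℕ × ℕ} (hC : Comp C) (hp : Comp p) :
    Comp fun z => push (C z) (p z) := by
  unfold push
  fun_prop

/-- Perform the first possible shortest jump. -/
def sweepStep (x : Input) (C : List (List ℕ)) : List (List ℕ) :=
  if (moves x (heads C)).isEmpty = true then C else push C ((moves x (heads C)).headD (0, 0))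

@[fun_prop]
theorem comp_sweepStep {x : γ → Input} {C : γ → List (List ℕ)} (hx : Comp x) (hC : Comp C) :
    Comp fun z => sweepStep (x z) (C z) := by
  unfold sweepStep
  fun_prop

/-- The history of the tokens moving from `lo x` towards `hi x`; the latest place of every token
comes first. -/
def sweep (x : Input) : List (List ℕ) := (sweepStep x)^[x.n + 1] ((lo x).map fun a => [a])

theorem lt_of_mem_moves {x : Input} {S : List ℕ} {p : ℕ × ℕ} (h : p ∈ moves x S) : p.2 < x.n := by
  simp only [moves, List.mem_flatMap, List.mem_map, List.mem_filter, List.mem_range] at h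
  obtain ⟨a, _, b, hb, rfl⟩ := h
  exact hb.1

theorem moves_headD_mem {x : Input} {S : List ℕ} (h : ¬ (moves x S).isEmpty = true) :
    (moves x S).headD (0, 0) ∈ moves x S := by
  cases hm : moves x S with
  | nil => simp [hm] at h
  | cons a l => simp

/-- `Comp` demands a bound for every input, including those that describe no instance. So the
histories are bounded without using any property of separators. -/
theorem sweep_bounds (x : Input) (m : ℕ) :
    ((sweepStep x)^[m] ((lo x).map fun a => [a])).length ≤ x.n ∧
      ∀ c ∈ (sweepStep x)^[m] ((lo x).map fun a => [a]), c.length ≤ m + 1 ∧ ∀ a ∈ c, a < x.n := by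
  induction m with
  | zero =>
    constructor
    · simpa [lo] using (List.length_filter_le _ (List.range x.n))
    · intro c hc
      simp only [Function.iterate_zero, id, List.mem_map] at hc
      obtain ⟨a, ha, rfl⟩ := hc
      simp only [lo, List.mem_filter, List.mem_range] at ha
      simp [ha.1]
  | succ m ih =>
    rw [Function.iterate_succ_apply']
    generalize (sweepStep x)^[m] ((lo x).map fun a => [a]) = C at ih ⊢
    unfold sweepStep
    split_ifs with h
    · exact ⟨ih.1, fun c hc => ⟨(ih.2 c hc).1.trans (by omega), (ih.2 c hc).2⟩⟩
    · have hp := lt_of_mem_moves (moves_headD_mem h)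
      unfold push
      refine ⟨by simpa using ih.1, fun c hc => ?_⟩
      obtain ⟨d, hd, rfl⟩ := List.mem_map.1 hc
      obtain ⟨h1, h2⟩ := ih.2 d hd
      split_ifs
      · refine ⟨by simpa using h1, fun a ha => ?_⟩
        rcases List.mem_cons.1 ha with rfl | ha
        · exact hp
        · exact h2 a ha
      · exact ⟨by omega, h2⟩

@[fun_prop]
theorem comp_sweep {x : γ → Input} (hx : Comp x) : Comp fun z => sweep (x z) := by
  unfold sweep
  have hn : Comp fun z => (x z).n := by fun_prop
  have hb := hn.polyBdd
  have hb2 := ((PolyBdd.const 2).mul hb).add (.const 2)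
  refine Comp.iterate (n := fun z => (x z).n + 1) (f := fun z => sweepStep (x z)) (by fun_prop)
    (by fun_prop) (by fun_prop)
    (q := fun z => sz (x z).n * ((sz (x z).n + 2) * (2 * sz (x z).n + 2) + 2) + 1)
    ((hb.mul (((hb.add (.const 2)).mul hb2).add (.const 2))).add (.const 1)) fun z m hm => ?_
  obtain ⟨h1, h2⟩ := sweep_bounds (x z) m
  generalize (sweepStep (x z))^[m] ((lo (x z)).map fun a => [a]) = C at h1 h2
  have hle : (x z).n ≤ sz (x z).n := by simp; omega
  refine (sz_le_length_mul (N := (sz (x z).n + 2) * (2 * sz (x z).n + 2) + 1)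
    fun c hc => ?_).trans ?_
  · refine (sz_le_length_mul (N := 2 * sz (x z).n + 1) fun a ha => ?_).trans ?_
    · have := (h2 c hc).2 a ha
      rw [sz_nat a]
      omega
    · have := (h2 c hc).1
      gcongr
      omega
  · gcongr
    exact h1.trans hle

/-- All places visited by the tokens. -/
def visited (x : Input) : List ℕ := (sweep x).flatten

@[fun_prop]
theorem comp_visited {x : γ → Input} (hx : Comp x) : Comp fun z => visited (x z) := by
  unfold visited
  fun_prop

/-- The chains of the tokens that move. -/
def chains (x : Input) : List (List ℕ) := (sweep x).filter fun c => decide (2 ≤ c.length)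

@[fun_prop]
theorem comp_chains {x : γ → Input} (hx : Comp x) : Comp fun z => chains (x z) := by
  unfold chains
  fun_prop

/-- The positions in a chain. -/
def posOf (c : List ℕ) (i : ℕ) : List Pos := (List.range c.length).map fun j =>
  (c.getD j 0, i, j, decide (j + 1 = c.length))

@[fun_prop]
theorem comp_posOf {c : γ → List ℕ} {i : γ → ℕ} (hc : Comp c) (hi : Comp i) :
    Comp fun z => posOf (c z) (i z) := by
  unfold posOf
  fun_prop

/-- All positions. -/
def positions (x : Input) : List Pos :=
  (List.range (chains x).length).flatMap fun i => posOf ((chains x).getD i []).reverse i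

@[fun_prop]
theorem comp_positions {x : γ → Input} (hx : Comp x) : Comp fun z => positions (x z) := by
  unfold positions
  fun_prop

/-- There is a walk between the two positions without other visited places. -/
def torso (x : Input) (p q : Pos) : Bool :=
  (reach x (visited x) p.1).any fun u => adj x u q.1

@[fun_prop]
theorem comp_torso {x : γ → Input} {p q : γ → Pos} (hx : Comp x) (hp : Comp p) (hq : Comp q) :
    Comp fun z => torso (x z) (p z) (q z) := by
  unfold torso
  fun_prop

/-- The positions belong to different chains and constrain each other. -/
def linked (x : Input) (p q : Pos) : Bool :=
  !decide (p.2.1 = q.2.1) && (torso x p q || torso x q p)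

@[fun_prop]
theorem comp_linked {x : γ → Input} {p q : γ → Pos} (hx : Comp x) (hp : Comp p) (hq : Comp q) :
    Comp fun z => linked (x z) (p z) (q z) := by
  unfold linked
  fun_prop

/-- The pair `(p, q)` is implied by the pair `(p', q')`. -/
def implied (p q p' q' : Pos) : Bool :=
  decide (p'.2.1 = p.2.1) && decide (p'.2.2.1 ≤ p.2.2.1) && decide (q'.2.1 = q.2.1) &&
    decide (q.2.2.1 ≤ q'.2.2.1)

@[fun_prop]
theorem comp_implied {p q p' q' : γ → Pos} (hp : Comp p) (hq : Comp q) (hp' : Comp p')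
    (hq' : Comp q') : Comp fun z => implied (p z) (q z) (p' z) (q' z) := by
  unfold implied
  fun_prop

/-- The pair `(p, q)` is implied by no other linked pair. -/
def undominated (x : Input) (p q : Pos) : Bool :=
  (positions x).all fun p' => (positions x).all fun q' =>
    !(implied p q p' q' && linked x p' q') ||
      (decide (p'.2.2.1 = p.2.2.1) && decide (q'.2.2.1 = q.2.2.1))

@[fun_prop]
theorem comp_undominated {x : γ → Input} {p q : γ → Pos} (hx : Comp x) (hp : Comp p)
    (hq : Comp q) : Comp fun z => undominated (x z) (p z) (q z) := by
  unfold undominated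
  fun_prop

/-- Linked pairs that are not implied in one of the two directions. -/
def essential (x : Input) (p q : Pos) : Bool :=
  linked x p q && (undominated x p q || undominated x q p)

@[fun_prop]
theorem comp_essential {x : γ → Input} {p q : γ → Pos} (hx : Comp x) (hp : Comp p)
    (hq : Comp q) : Comp fun z => essential (x z) (p z) (q z) := by
  unfold essential
  fun_prop

/-- Being the first position of a chain. -/
def isFirst (p : Pos) : Bool := decide (p.2.2.1 = 0)

/-- Being the last position of a chain. -/
def isLast (p : Pos) : Bool := p.2.2.2

@[fun_prop]
theorem comp_isFirst {p : γ → Pos} (hp : Comp p) : Comp fun z => isFirst (p z) := by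
  unfold isFirst
  fun_prop

@[fun_prop]
theorem comp_isLast {p : γ → Pos} (hp : Comp p) : Comp fun z => isLast (p z) := by
  unfold isLast
  fun_prop

/-- The positions that are kept. -/
def keep (x : Input) : List Pos := (positions x).filter fun p =>
  isFirst p || isLast p || (positions x).any fun q => essential x p q

@[fun_prop]
theorem comp_keep {x : γ → Input} (hx : Comp x) : Comp fun z => keep (x z) := by
  unfold keep
  fun_prop

/-- Consecutive kept positions. -/
def consec (x : Input) (p q : Pos) : Bool :=
  decide (p.2.1 = q.2.1) && decide (p.2.2.1 < q.2.2.1) && (keep x).all fun r =>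
    !(decide (r.2.1 = p.2.1) && decide (p.2.2.1 < r.2.2.1) && decide (r.2.2.1 < q.2.2.1))

@[fun_prop]
theorem comp_consec {x : γ → Input} {p q : γ → Pos} (hx : Comp x) (hp : Comp p)
    (hq : Comp q) : Comp fun z => consec (x z) (p z) (q z) := by
  unfold consec
  fun_prop

/-- Adjacency of kept positions. -/
def keepAdj (x : Input) (p q : Pos) : Bool := essential x p q || (consec x p q || consec x q p)

@[fun_prop]
theorem comp_keepAdj {x : γ → Input} {p q : γ → Pos} (hx : Comp x) (hp : Comp p)
    (hq : Comp q) : Comp fun z => keepAdj (x z) (p z) (q z) := by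
  unfold keepAdj
  fun_prop

/-- The characteristic vector of the first positions. -/
def firsts (x : Input) : List Bool := false :: false :: (keep x).map isFirst

/-- The characteristic vector of the last positions. -/
def lasts (x : Input) : List Bool := false :: false :: (keep x).map isLast

@[fun_prop]
theorem comp_firsts {x : γ → Input} (hx : Comp x) : Comp fun z => firsts (x z) := by
  unfold firsts
  exact .cons (.const _) (.cons (.const _) (.map (f := fun _ => isFirst) (by fun_prop)
    (by fun_prop)))

@[fun_prop]
theorem comp_lasts {x : γ → Input} (hx : Comp x) : Comp fun z => lasts (x z) := by
  unfold lasts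
  exact .cons (.const _) (.cons (.const _) (.map (f := fun _ => isLast) (by fun_prop)
    (by fun_prop)))

/-- A row of the adjacency matrix of the kernel. -/
def row (x : Input) (p : Pos) : List Bool :=
  isFirst p :: isLast p :: (keep x).map fun q => keepAdj x p q

@[fun_prop]
theorem comp_row {x : γ → Input} {p : γ → Pos} (hx : Comp x) (hp : Comp p) :
    Comp fun z => row (x z) (p z) := by
  have h : Comp fun z => (keep (x z)).map fun q => keepAdj (x z) (p z) q :=
    .map (f := fun z q => keepAdj (x z) (p z) q) (comp_keep hx)
      (comp_keepAdj (hx.comp (.fst .id)) (hp.comp (.fst .id)) (.snd .id))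
  exact .cons (comp_isFirst hp) (.cons (comp_isLast hp) h)

/-- The adjacency matrix of the kernel. -/
def kernelMatrix (x : Input) : List (List Bool) :=
  firsts x :: lasts x :: (keep x).map fun p => row x p

@[fun_prop]
theorem comp_kernelMatrix {x : γ → Input} (hx : Comp x) :
    Comp fun z => kernelMatrix (x z) := by
  have h : Comp fun z => (keep (x z)).map fun p => row (x z) p :=
    .map (f := fun z p => row (x z) p) (comp_keep hx) (comp_row (hx.comp (.fst .id)) (.snd .id))
  unfold kernelMatrix
  exact (comp_firsts hx).cons ((comp_lasts hx).cons h)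

/-- The number of true entries of the adjacency matrix. -/
def entryCount (M : List (List Bool)) : ℕ :=
  (M.flatten.filter fun b => b).length

@[fun_prop]
theorem comp_entryCount {M : γ → List (List Bool)} (hM : Comp M) :
    Comp fun z => entryCount (M z) := by
  unfold entryCount
  fun_prop

/-- The number of jumps, truncated to the interval between `1` and the number of vertices. -/
def bound (x : Input) : ℕ :=
  if decide (1 ≤ truncVal x.n x.2.2.2.2.2.2.1) = true then truncVal x.n x.2.2.2.2.2.2.1 else 1

@[fun_prop]
theorem comp_bound {x : γ → Input} (hx : Comp x) : Comp fun z => bound (x z) := by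
  unfold bound
  fun_prop

/-- The bound on the number of vertices. -/
def maxVertices (m : ℕ) : ℕ := 8 * (m * m) + 5 * m

/-- The bound on twice the number of edges. -/
def maxEntries (m : ℕ) : ℕ := 2 * (12 * (m * m) + 7 * m)

@[fun_prop]
theorem comp_maxVertices {m : γ → ℕ} (hm : Comp m) : Comp fun z => maxVertices (m z) :=
  ((Comp.const 8).mul (hm.mul hm)).add ((Comp.const 5).mul hm)

@[fun_prop]
theorem comp_maxEntries {m : γ → ℕ} (hm : Comp m) : Comp fun z => maxEntries (m z) :=
  (Comp.const 2).mul (((Comp.const 12).mul (hm.mul hm)).add ((Comp.const 7).mul hm))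

/-- The tokens have reached `hi x` and the kernel is small. -/
def accepts (x : Input) : Bool :=
  ((heads (sweep x)).all fun v => decide (v ∈ hi x)) &&
    (decide ((keep x).length + 2 ≤ maxVertices (bound x)) &&
      decide (entryCount (kernelMatrix x) ≤ maxEntries (bound x)))

@[fun_prop]
theorem comp_accepts {x : γ → Input} (hx : Comp x) : Comp fun z => accepts (x z) := by
  have h1 : Comp fun z => (heads (sweep (x z))).all fun v => decide (v ∈ hi (x z)) := by fun_prop
  have h2 : Comp fun z => decide ((keep (x z)).length + 2 ≤ maxVertices (bound (x z))) :=
    .natLE (.add (.length (by fun_prop)) (.const 2)) (by fun_prop)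
  have h3 : Comp fun z => decide (entryCount (kernelMatrix (x z)) ≤ maxEntries (bound (x z))) :=
    .natLE (by fun_prop) (by fun_prop)
  exact h1.and (h2.and h3)

/-- A path on four vertices with different separators and no jumps. -/
def noOutput : Input :=
  (4, [[false, false, true, false], [false, false, false, true], [true, false, false, true],
    [false, true, true, false]], 0, 1, [false, false, true, false], [false, false, false, true],
    [], ())

/-- The output of the algorithm. -/
def output (x : Input) : Input :=
  if accepts x = true then ((keep x).length + 2, kernelMatrix x, 0, 1, firsts x, lasts x,
    x.2.2.2.2.2.2.1, ()) else noOutput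

theorem comp_output : Comp output := by
  unfold output
  fun_prop

end Input

end MSR

namespace MSR

/-! ### The lattice of minimum separators -/

section lattice

variable {V : Type*} {G : SimpleGraph V} {s t : V}

/-- The vertices that are reachable from `a` on walks avoiding `D` after the start. -/
def reachSet (G : SimpleGraph V) (D : Set V) (a : V) : Set V :=
  {b | Relation.ReflTransGen (fun u v => G.Adj u v ∧ v ∉ D) a b}

theorem self_mem_reachSet {D : Set V} {a : V} : a ∈ reachSet G D a := .refl

theorem reachSet_step {D : Set V} {a u v : V} (hu : u ∈ reachSet G D a) (h : G.Adj u v)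
    (hv : v ∉ D) : v ∈ reachSet G D a := Relation.ReflTransGen.tail hu ⟨h, hv⟩

theorem reachSet_subset {D U : Set V} {a : V} (ha : a ∈ U)
    (h : ∀ u ∈ U, ∀ v, G.Adj u v → v ∉ D → v ∈ U) : reachSet G D a ⊆ U := by
  intro v hv
  induction hv with
  | refl => exact ha
  | tail _ h2 ih => exact h _ ih _ h2.1 h2.2

theorem reachSet_subset_reachSet {D D' : Set V} {a : V}
    (h : ∀ v ∈ reachSet G D a, v ∉ D → v ∉ D') : reachSet G D a ⊆ reachSet G D' a := by
  intro v hv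
  induction hv with
  | refl => exact self_mem_reachSet
  | tail h1 h2 ih => exact reachSet_step ih h2.1 (h _ (h1.tail h2) h2.2)

theorem notMem_of_mem_reachSet {D : Set V} {a v : V} (ha : a ∉ D) (hv : v ∈ reachSet G D a) :
    v ∉ D := by
  induction hv with
  | refl => exact ha
  | tail _ h2 _ => exact h2.2

/-- Replaces components of an induced subgraph by an inductively generated set, so that separation
is proved by exhibiting a closed region (`isSeparator_of_region`). -/
theorem isSeparator_iff {S : Finset V} :
    IsSeparator G s t S ↔ s ∉ S ∧ t ∉ S ∧ t ∉ reachSet G S s := by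
  constructor
  · rintro ⟨hs, ht, h⟩
    refine ⟨hs, ht, fun hr => h ?_⟩
    have key : ∀ v (hv : v ∉ S), v ∈ reachSet G (S : Set V) s →
        (G.induce {v | v ∉ S}).Reachable ⟨s, hs⟩ ⟨v, hv⟩ := by
      intro v hv hr
      induction hr with
      | refl => exact .refl _
      | tail h1 h2 ih =>
        have := notMem_of_mem_reachSet (by simpa using hs) h1
        exact (ih (by simpa using this)).trans (SimpleGraph.Adj.reachable (by simpa using h2.1))
    exact key t ht hr
  · rintro ⟨hs, ht, h⟩
    refine ⟨hs, ht, fun hr => h ?_⟩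
    obtain ⟨w⟩ := hr
    have key : ∀ (u v : {v | v ∉ S}) (w : (G.induce {v | v ∉ S}).Walk u v),
        u.1 ∈ reachSet G (S : Set V) s → v.1 ∈ reachSet G (S : Set V) s := by
      intro u v w
      induction w with
      | nil => exact _root_.id
      | @cons a b c h p ih =>
        intro hu
        exact ih (reachSet_step hu (by simpa using h) (by exact b.2))
    exact key _ _ w self_mem_reachSet

/-- A separator from a set of vertices whose outer neighbours belong to `S`. -/
theorem isSeparator_of_region {S : Finset V} {U : Set V} (hs : s ∉ S) (ht : t ∉ S)
    (hsU : s ∈ U) (htU : t ∉ U) (h : ∀ u ∈ U, ∀ v, G.Adj u v → v ∉ S → v ∈ U) :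
    IsSeparator G s t S :=
  isSeparator_iff.2 ⟨hs, ht, fun hr => htU (reachSet_subset hsU (by simpa using h) hr)⟩

namespace IsMinSeparator

variable {S T X Y : Finset V}

theorem src_notMem (h : IsMinSeparator G s t S) : s ∉ S := (isSeparator_iff.1 h.1).1
theorem tgt_notMem (h : IsMinSeparator G s t S) : t ∉ S := (isSeparator_iff.1 h.1).2.1
theorem tgt_notMem_side (h : IsMinSeparator G s t S) : t ∉ reachSet G S s :=
  (isSeparator_iff.1 h.1).2.2

theorem notMem_side (h : IsMinSeparator G s t S) {v : V} (hv : v ∈ S) : v ∉ reachSet G S s :=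
  fun hr => notMem_of_mem_reachSet (by simpa using h.src_notMem) hr (by simpa using hv)

theorem card_eq (hS : IsMinSeparator G s t S) (hT : IsMinSeparator G s t T) :
    S.card = T.card := le_antisymm (hS.2 _ hT.1) (hT.2 _ hS.1)

theorem of_card_le (hS : IsMinSeparator G s t S) (hT : IsSeparator G s t T)
    (h : T.card ≤ S.card) : IsMinSeparator G s t T :=
  ⟨hT, fun U hU => h.trans (hS.2 U hU)⟩

theorem eq_of_subset (hS : IsMinSeparator G s t S) (hT : IsMinSeparator G s t T) (h : S ⊆ T) :
    S = T := Finset.eq_of_subset_of_card_le h (hT.card_eq hS).le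

/-- Without a neighbour on the source side, `v` could be removed and a smaller separator would
remain. -/
theorem exists_adj (h : IsMinSeparator G s t S) {v : V} (hv : v ∈ S) :
    ∃ u ∈ reachSet G S s, G.Adj u v := by
  classical
  by_contra! hn
  have : IsSeparator G s t (S.erase v) := by
    refine isSeparator_of_region (U := reachSet G S s) (fun h' => h.src_notMem (by simp_all))
      (fun h' => h.tgt_notMem (by simp_all)) self_mem_reachSet h.tgt_notMem_side ?_
    intro u hu w huw hw
    refine reachSet_step hu huw fun hw' => hw ?_
    refine Finset.mem_erase.2 ⟨?_, by simpa using hw'⟩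
    rintro rfl
    exact hn u hu huw
  have := h.2 _ this
  have := Finset.card_erase_lt_of_mem hv
  omega

theorem mem_or_mem (hS : IsMinSeparator G s t S)
    (h : reachSet G S s ⊆ reachSet G T s) {v : V} (hv : v ∈ S) : v ∈ reachSet G T s ∨ v ∈ T := by
  obtain ⟨u, hu, huv⟩ := hS.exists_adj hv
  by_contra! hn
  exact hn.1 (reachSet_step (h hu) huv (by simpa using hn.2))

theorem eq_of_side_eq (hS : IsMinSeparator G s t S) (hT : IsMinSeparator G s t T)
    (h : reachSet G S s = reachSet G T s) : S = T := by
  refine hS.eq_of_subset hT fun v hv => ?_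
  exact (hS.mem_or_mem h.le hv).resolve_left (h ▸ hS.notMem_side hv)

end IsMinSeparator

/-- The order of minimum separators: `T` is closer to the target than `S`. -/
def SideLE (G : SimpleGraph V) (s : V) (S T : Finset V) : Prop :=
  reachSet G S s ⊆ reachSet G T s

theorem SideLE.refl (S : Finset V) : SideLE G s S S := subset_rfl

theorem SideLE.trans {S T U : Finset V} (h : SideLE G s S T) (h' : SideLE G s T U) :
    SideLE G s S U := Set.Subset.trans h h'

theorem IsMinSeparator.eq_of_le_of_le {S T : Finset V} (hS : IsMinSeparator G s t S) (hT : IsMinSeparator G s t T)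
    (h : SideLE G s S T) (h' : SideLE G s T S) : S = T :=
  hS.eq_of_side_eq hT (Set.Subset.antisymm h h')

variable [DecidableEq V]

open Classical in
/-- The join of two minimum separators. -/
noncomputable def join (G : SimpleGraph V) (s : V) (S T : Finset V) : Finset V :=
  (S ∪ T).filter fun w => w ∉ reachSet G S s ∧ w ∉ reachSet G T s

open Classical in
/-- The meet of two minimum separators. -/
noncomputable def meet (G : SimpleGraph V) (s : V) (S T : Finset V) : Finset V :=
  (S ∪ T).filter fun w => (w ∈ S ∧ w ∈ T) ∨ w ∈ reachSet G S s ∨ w ∈ reachSet G T s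

theorem mem_join {S T : Finset V} {w : V} : w ∈ join G s S T ↔
    (w ∈ S ∨ w ∈ T) ∧ w ∉ reachSet G S s ∧ w ∉ reachSet G T s := by
  simp [join]

theorem mem_meet {S T : Finset V} {w : V} : w ∈ meet G s S T ↔
    (w ∈ S ∨ w ∈ T) ∧ ((w ∈ S ∧ w ∈ T) ∨ w ∈ reachSet G S s ∨ w ∈ reachSet G T s) := by
  simp [meet]

theorem join_comm (S T : Finset V) : join G s S T = join G s T S := by
  ext w
  simp only [mem_join]
  tauto

theorem meet_comm (S T : Finset V) : meet G s S T = meet G s T S := by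
  ext w
  simp only [mem_meet]
  tauto

namespace IsMinSeparator

variable {S T X Y : Finset V}

/-- The union of the two source sides is a region bounded by the join, the intersection is one
bounded by the meet. So both separate, and a count of vertices leaves no room for either to exceed
the minimum. -/
theorem join_meet (hS : IsMinSeparator G s t S) (hT : IsMinSeparator G s t T) :
    IsMinSeparator G s t (join G s S T) ∧ IsMinSeparator G s t (meet G s S T) := by
  have hJ : IsSeparator G s t (join G s S T) := by
    refine isSeparator_of_region (U := reachSet G S s ∪ reachSet G T s) ?_ ?_
      (Or.inl self_mem_reachSet) ?_ ?_
    · simp [mem_join, hS.src_notMem, hT.src_notMem]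
    · simp [mem_join, hS.tgt_notMem, hT.tgt_notMem]
    · simp [hS.tgt_notMem_side, hT.tgt_notMem_side]
    · rintro u hu v huv hv
      rw [mem_join] at hv
      by_contra hn
      simp only [Set.mem_union, not_or] at hn
      rcases hu with hu | hu
      · exact hv ⟨Or.inl (by_contra fun h => hn.1 (reachSet_step hu huv (by simpa using h))), hn⟩
      · exact hv ⟨Or.inr (by_contra fun h => hn.2 (reachSet_step hu huv (by simpa using h))), hn⟩
  have hM : IsSeparator G s t (meet G s S T) := by
    refine isSeparator_of_region (U := reachSet G S s ∩ reachSet G T s) ?_ ?_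
      ⟨self_mem_reachSet, self_mem_reachSet⟩ ?_ ?_
    · simp [mem_meet, hS.src_notMem, hT.src_notMem]
    · simp [mem_meet, hS.tgt_notMem, hT.tgt_notMem]
    · simp [hS.tgt_notMem_side]
    · rintro u ⟨hu, hu'⟩ v huv hv
      rw [mem_meet] at hv
      have h1 : v ∈ S ∨ v ∈ reachSet G S s := by
        by_contra! h
        exact h.2 (reachSet_step hu huv (by simpa using h.1))
      have h2 : v ∈ T ∨ v ∈ reachSet G T s := by
        by_contra! h
        exact h.2 (reachSet_step hu' huv (by simpa using h.1))
      exact ⟨by tauto, by tauto⟩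
  -- Equal unions and equal intersections give that the sizes of join and meet add up to twice the
  -- minimum.
  have e1 : join G s S T ∪ meet G s S T = S ∪ T := by
    ext w
    simp only [Finset.mem_union, mem_join, mem_meet]
    tauto
  have e2 : join G s S T ∩ meet G s S T = S ∩ T := by
    ext w
    have := @notMem_side V G s t S hS w
    have := @notMem_side V G s t T hT w
    simp only [Finset.mem_inter, mem_join, mem_meet]
    tauto
  have c1 := Finset.card_union_add_card_inter (join G s S T) (meet G s S T)
  have c2 := Finset.card_union_add_card_inter S T
  rw [e1, e2] at c1
  have h1 := hS.2 _ hJ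
  have h2 := hS.2 _ hM
  have h3 := hS.card_eq hT
  exact ⟨hS.of_card_le hJ (by omega), hS.of_card_le hM (by omega)⟩

theorem join (hS : IsMinSeparator G s t S) (hT : IsMinSeparator G s t T) :
    IsMinSeparator G s t (join G s S T) := (hS.join_meet hT).1

theorem meet (hS : IsMinSeparator G s t S) (hT : IsMinSeparator G s t T) :
    IsMinSeparator G s t (meet G s S T) := (hS.join_meet hT).2

end IsMinSeparator

namespace IsMinSeparator

variable {S T X Y Z : Finset V}

theorem le_join_left : SideLE G s S (MSR.join G s S T) :=
  reachSet_subset_reachSet fun v hv _ h => (mem_join.1 (by simpa using h)).2.1 hv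

theorem le_join_right : SideLE G s T (MSR.join G s S T) :=
  join_comm (G := G) (s := s) T S ▸ le_join_left

theorem join_le (hX : SideLE G s S X) (hY : SideLE G s T X) : SideLE G s (MSR.join G s S T) X := by
  have : reachSet G (MSR.join G s S T) s ⊆ reachSet G S s ∪ reachSet G T s := by
    refine reachSet_subset (Or.inl self_mem_reachSet) fun u hu v huv hv => ?_
    by_contra hn
    simp only [Set.mem_union, not_or] at hn
    refine hv ?_
    rw [Finset.mem_coe, mem_join]
    refine ⟨?_, hn⟩
    rcases hu with hu | hu
    · exact Or.inl (by_contra fun h => hn.1 (reachSet_step hu huv (by simpa using h)))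
    · exact Or.inr (by_contra fun h => hn.2 (reachSet_step hu huv (by simpa using h)))
  exact this.trans (Set.union_subset hX hY)

theorem meet_le_left : SideLE G s (MSR.meet G s S T) S ∧ SideLE G s (MSR.meet G s S T) T := by
  have : reachSet G (MSR.meet G s S T) s ⊆ reachSet G S s ∩ reachSet G T s := by
    refine reachSet_subset ⟨self_mem_reachSet, self_mem_reachSet⟩ fun u hu v huv hv => ?_
    rw [Finset.mem_coe, mem_meet] at hv
    have h1 : v ∈ S ∨ v ∈ reachSet G S s := by
      by_contra! h
      exact h.2 (reachSet_step hu.1 huv (by simpa using h.1))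
    have h2 : v ∈ T ∨ v ∈ reachSet G T s := by
      by_contra! h
      exact h.2 (reachSet_step hu.2 huv (by simpa using h.1))
    exact ⟨by tauto, by tauto⟩
  exact ⟨this.trans Set.inter_subset_left, this.trans Set.inter_subset_right⟩

theorem le_meet (hS : IsMinSeparator G s t S) (hT : IsMinSeparator G s t T)
    (h : SideLE G s X S) (h' : SideLE G s X T) : SideLE G s X (MSR.meet G s S T) :=
  reachSet_subset_reachSet fun v hv _ hm => by
    rcases (mem_meet.1 (by simpa using hm)).1 with h1 | h1
    · exact hS.notMem_side h1 (h hv)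
    · exact hT.notMem_side h1 (h' hv)

/-- If the vertices of `S` lie in `T` or on its source side, then the join is contained in `T`,
hence equal to it by size. This makes the order checkable vertex by vertex. -/
theorem le_iff (hS : IsMinSeparator G s t S) (hT : IsMinSeparator G s t T) :
    SideLE G s S T ↔ ∀ w ∈ S, w ∈ reachSet G T s ∨ w ∈ T := by
  refine ⟨fun h w hw => hS.mem_or_mem h hw, fun h => ?_⟩
  have hsub : MSR.join G s S T ⊆ T := by
    intro w hw
    rw [mem_join] at hw
    rcases hw.1 with h1 | h1
    · exact (h w h1).resolve_left hw.2.2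
    · exact h1
  rw [← (hS.join hT).eq_of_subset hT hsub]
  exact le_join_left

theorem join_eq_right (hS : IsMinSeparator G s t S) (hT : IsMinSeparator G s t T)
    (h : SideLE G s S T) : MSR.join G s S T = T :=
  (hS.join hT).eq_of_le_of_le hT (join_le h (.refl T)) le_join_right

theorem meet_eq_left (hS : IsMinSeparator G s t S) (hT : IsMinSeparator G s t T)
    (h : SideLE G s S T) : MSR.meet G s S T = S :=
  (hS.meet hT).eq_of_le_of_le hS meet_le_left.1 (hS.le_meet hT (.refl S) h)

theorem meet_mono (hS : IsMinSeparator G s t S) (hT : IsMinSeparator G s t T)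
    (h : SideLE G s X S) : SideLE G s (MSR.meet G s X T) (MSR.meet G s S T) :=
  hS.le_meet hT (meet_le_left.1.trans h) meet_le_left.2

/-! ### Separators that differ in one vertex -/

/-- A vertex of the new join other than `u` lies in `X` or `S`, and it avoids the side of `X`
because it avoids the larger side of `Y`. -/
theorem join_step (hXY : SideLE G s X Y) {u : V} (h : Y ⊆ insert u X) (S : Finset V) :
    MSR.join G s Y S ⊆ insert u (MSR.join G s X S) := by
  intro w hw
  rw [mem_join] at hw
  by_cases hu : w = u
  · simp [hu]
  · refine Finset.mem_insert_of_mem (mem_join.2 ⟨hw.1.imp_left fun h1 => ?_, fun h2 =>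
      hw.2.1 (hXY h2), hw.2.2⟩)
    exact (Finset.mem_insert.1 (h h1)).resolve_left hu

theorem meet_step (hXY : SideLE G s X Y) {v : V} (h : X ⊆ insert v Y) (S : Finset V) :
    MSR.meet G s X S ⊆ insert v (MSR.meet G s Y S) := by
  intro w hw
  rw [mem_meet] at hw
  by_cases hv : w = v
  · simp [hv]
  · have h1 : w ∈ X → w ∈ Y := fun h1 => (Finset.mem_insert.1 (h h1)).resolve_left hv
    have h2 : w ∈ reachSet G X s → w ∈ reachSet G Y s := fun h => hXY h
    exact Finset.mem_insert_of_mem (mem_meet.2 (by tauto))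

end IsMinSeparator

/-- `Y` has at most one vertex outside of `X`. -/
def Near (X Y : Finset V) : Prop := ∃ u, Y ⊆ insert u X

theorem Near.of_tokenJump {X Y : Finset V} (h : TokenJump X Y) : Near X Y := by
  obtain ⟨v, _, u, _, rfl⟩ := h
  exact ⟨u, by intro w; simp; tauto⟩

theorem Near.exists_swap {X Y : Finset V} (h : Near X Y) (hc : X.card = Y.card) (hne : X ≠ Y) :
    ∃ v ∈ X, ∃ u, u ∉ X ∧ Y = insert u (X.erase v) := by
  obtain ⟨u, hu⟩ := h
  have huX : u ∉ X := fun h => hne (Finset.eq_of_subset_of_card_le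
    (by rwa [Finset.insert_eq_of_mem h] at hu) hc.le).symm
  have hex : ∃ v ∈ X, v ∉ Y := by
    by_contra! hn
    exact hne (Finset.eq_of_subset_of_card_le hn hc.ge)
  obtain ⟨v, hv, hvY⟩ := hex
  refine ⟨v, hv, u, huX, Finset.eq_of_subset_of_card_le (fun w hw => ?_) ?_⟩
  · rcases Finset.mem_insert.1 (hu hw) with h | h
    · simp [h]
    · exact Finset.mem_insert_of_mem (Finset.mem_erase.2 ⟨fun e => hvY (e ▸ hw), h⟩)
  · rw [Finset.card_insert_of_notMem (by simp [huX]), Finset.card_erase_of_mem hv, ← hc]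
    have := Finset.card_pos.2 ⟨v, hv⟩
    omega

theorem Near.tokenJump {X Y : Finset V} (h : Near X Y) (hc : X.card = Y.card) (hne : X ≠ Y) :
    TokenJump X Y := by
  obtain ⟨v, hv, u, hu, rfl⟩ := h.exists_swap hc hne
  exact ⟨v, hv, u, hu, by ext w; simp [Finset.mem_erase]; tauto⟩

theorem Near.symm {X Y : Finset V} (h : Near X Y) (hc : X.card = Y.card) : Near Y X := by
  by_cases hne : X = Y
  · subst hne
    exact h
  · obtain ⟨v, hv, u, hu, rfl⟩ := h.exists_swap hc hne
    refine ⟨v, fun w hw => ?_⟩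
    by_cases h : w = v <;> simp [h, hw]

namespace IsMinSeparator

variable {S T X Y Z : Finset V}

/-- If neither inclusion held, the vertex given up would lie off the side of `Y` and the vertex
gained off the side of `X`. The join would then contain `X` together with the gained vertex, one
vertex too many. -/
theorem le_or_le_of_near (hX : IsMinSeparator G s t X) (hY : IsMinSeparator G s t Y)
    (h : Near X Y) : SideLE G s X Y ∨ SideLE G s Y X := by
  by_cases hne : X = Y
  · exact Or.inl (hne ▸ .refl _)
  obtain ⟨v, hv, u, hu, rfl⟩ := h.exists_swap (hX.card_eq hY) hne
  set Y := insert u (X.erase v) with hYdef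
  by_contra! hn
  rw [hX.le_iff hY, hY.le_iff hX] at hn
  push Not at hn
  obtain ⟨⟨a, ha, ha1, ha2⟩, b, hb, hb1, hb2⟩ := hn
  have hav : a = v := by
    by_contra hav
    exact ha2 (Finset.mem_insert_of_mem (Finset.mem_erase.2 ⟨hav, ha⟩))
  have hbu : b = u := by
    by_contra hbu
    rcases Finset.mem_insert.1 hb with h | h
    · exact hbu h
    · exact hb2 (Finset.mem_of_mem_erase h)
  subst hav hbu
  have hsub : insert b X ⊆ MSR.join G s X Y := by
    intro w hw
    rw [mem_join]
    rcases Finset.mem_insert.1 hw with rfl | hw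
    · exact ⟨Or.inr hb, hb1, hY.notMem_side hb⟩
    · refine ⟨Or.inl hw, hX.notMem_side hw, ?_⟩
      by_cases hwa : w = a
      · exact hwa ▸ ha1
      · exact hY.notMem_side (Finset.mem_insert_of_mem (Finset.mem_erase.2 ⟨hwa, hw⟩))
  have h1 := Finset.card_le_card hsub
  rw [Finset.card_insert_of_notMem hu, (hX.join hY).card_eq hX] at h1
  omega

/-- Jumps survive joining with a fixed separator, at worst becoming trivial; the order of `X` and
`Y` decides in which direction `join_step` applies. -/
theorem near_join (hX : IsMinSeparator G s t X) (hY : IsMinSeparator G s t Y)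
    (hS : IsMinSeparator G s t S) (h : Near X Y) :
    Near (MSR.join G s X S) (MSR.join G s Y S) := by
  rcases hX.le_or_le_of_near hY h with hle | hle
  · obtain ⟨u, hu⟩ := h
    exact ⟨u, join_step hle hu S⟩
  · obtain ⟨u, hu⟩ := h.symm (hX.card_eq hY)
    exact Near.symm ⟨u, join_step hle hu S⟩ ((hY.join hS).card_eq (hX.join hS))

theorem near_meet (hX : IsMinSeparator G s t X) (hY : IsMinSeparator G s t Y)
    (hS : IsMinSeparator G s t S) (h : Near X Y) :
    Near (MSR.meet G s X S) (MSR.meet G s Y S) := by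
  rcases hX.le_or_le_of_near hY h with hle | hle
  · obtain ⟨u, hu⟩ := h.symm (hX.card_eq hY)
    exact Near.symm ⟨u, meet_step hle hu S⟩ ((hY.meet hS).card_eq (hX.meet hS))
  · obtain ⟨u, hu⟩ := h
    exact ⟨u, meet_step hle hu S⟩

end IsMinSeparator

end lattice

end MSR

namespace MSR

/-! ### Sequences of jumps -/

/-- `b` is reached from `a` in `n` steps of the relation `R`. -/
inductive Steps {α : Type*} (R : α → α → Prop) : ℕ → α → α → Prop
  | refl (a : α) : Steps R 0 a a
  | snoc {n : ℕ} {a b c : α} (h : Steps R n a b) (hr : R b c) : Steps R (n + 1) a c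

namespace Steps

variable {α β : Type*} {R R' : α → α → Prop} {m n : ℕ} {a b c : α}

theorem trans (h : Steps R m a b) (h' : Steps R n b c) : Steps R (m + n) a c := by
  induction h' with
  | refl => exact h
  | snoc _ hr ih => exact .snoc (ih h) hr

theorem reverse (hR : ∀ a b, R a b → R b a) (h : Steps R n a b) : Steps R n b a := by
  induction h with
  | refl => exact .refl _
  | @snoc n a b c h hr ih =>
    have := (Steps.snoc (.refl c) (hR _ _ hr)).trans ih
    rwa [show 0 + 1 + n = n + 1 by omega] at this

theorem mono (hR : ∀ a b, R a b → R' a b) (h : Steps R n a b) : Steps R' n a b := by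
  induction h with
  | refl => exact .refl _
  | snoc _ hr ih => exact .snoc ih (hR _ _ hr)

/-- Steps can be mapped, where a step may become trivial. -/
theorem exists_map {R' : β → β → Prop} (f : α → β)
    (hR : ∀ a b, R a b → f a = f b ∨ R' (f a) (f b)) (h : Steps R n a b) :
    ∃ m ≤ n, Steps R' m (f a) (f b) := by
  induction h with
  | refl => exact ⟨0, le_rfl, .refl _⟩
  | snoc _ hr ih =>
    obtain ⟨m, hm, h⟩ := ih
    rcases hR _ _ hr with e | e
    · exact ⟨m, by omega, e ▸ h⟩
    · exact ⟨m + 1, by omega, .snoc h e⟩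

theorem iff_seq : Steps R n a b ↔
    ∃ f : ℕ → α, f 0 = a ∧ f n = b ∧ ∀ i < n, R (f i) (f (i + 1)) := by
  constructor
  · intro h
    induction h with
    | refl a => exact ⟨fun _ => a, rfl, rfl, by simp⟩
    | @snoc n a b c h hr ih =>
      obtain ⟨f, h0, hn, hf⟩ := ih
      refine ⟨fun i => if i ≤ n then f i else c, by simpa using h0, by simp, fun i hi => ?_⟩
      by_cases hin : i = n
      · subst hin
        simpa [hn] using hr
      · have h1 : i ≤ n := by omega
        have h2 : i + 1 ≤ n := by omega
        simpa [h1, h2] using hf i (by omega)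
  · rintro ⟨f, rfl, rfl, h⟩
    induction n with
    | zero => exact .refl _
    | succ n ih => exact .snoc (ih fun i hi => h i (by omega)) (h n (by omega))

end Steps

/-! ### Monotone sequences between the meet and the join -/

section normalization

variable {V : Type*} [DecidableEq V] {G : SimpleGraph V} {s t : V} {A B S T X Y : Finset V}

theorem TokenJump.card_eq (h : TokenJump X Y) : X.card = Y.card := by
  obtain ⟨v, hv, u, hu, rfl⟩ := h
  have e : (X \ {v}) ∪ {u} = insert u (X.erase v) := by
    ext w
    simp [Finset.mem_erase]
    tauto
  rw [e, Finset.card_insert_of_notMem (by simp [hu]), Finset.card_erase_of_mem hv]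
  have := Finset.card_pos.2 ⟨v, hv⟩
  omega

theorem TokenJump.ne (h : TokenJump X Y) : X ≠ Y := by
  obtain ⟨v, hv, u, hu, rfl⟩ := h
  intro e
  exact hu (e ▸ by simp)

theorem TokenJump.symm (h : TokenJump X Y) : TokenJump Y X :=
  ((Near.of_tokenJump h).symm h.card_eq).tokenJump h.card_eq.symm h.ne.symm

/-- A jump between minimum separators. -/
def MinJump (G : SimpleGraph V) (s t : V) (X Y : Finset V) : Prop :=
  IsMinSeparator G s t X ∧ IsMinSeparator G s t Y ∧ TokenJump X Y

theorem reconfigurableIn_iff {r : ℕ} (hA : IsMinSeparator G s t A) :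
    ReconfigurableIn G s t A B r ↔ Steps (MinJump G s t) r A B := by
  rw [Steps.iff_seq]
  constructor
  · rintro ⟨f, h0, hr, hm, hj⟩
    exact ⟨f, h0, hr, fun i hi => ⟨hm i hi.le, hm (i + 1) hi, hj i hi⟩⟩
  · rintro ⟨f, h0, hr, h⟩
    refine ⟨f, h0, hr, fun i hi => ?_, fun i hi => (h i hi).2.2⟩
    cases i with
    | zero => exact h0 ▸ hA
    | succ i => exact (h i hi).2.1

/-- A minimum separator in an interval. -/
def InIcc (G : SimpleGraph V) (s t : V) (S T X : Finset V) : Prop :=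
  IsMinSeparator G s t X ∧ SideLE G s S X ∧ SideLE G s X T

/-- A jump between minimum separators in an interval. -/
def JumpIn (G : SimpleGraph V) (s t : V) (S T X Y : Finset V) : Prop :=
  InIcc G s t S T X ∧ InIcc G s t S T Y ∧ TokenJump X Y

theorem JumpIn.mono {S' T' : Finset V} (hS : SideLE G s S' S) (hT : SideLE G s T T')
    (h : JumpIn G s t S T X Y) : JumpIn G s t S' T' X Y :=
  ⟨⟨h.1.1, hS.trans h.1.2.1, h.1.2.2.trans hT⟩, ⟨h.2.1.1, hS.trans h.2.1.2.1,
    h.2.1.2.2.trans hT⟩, h.2.2⟩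

/-- The join of the first members of a sequence. -/
noncomputable def prefixJoin (G : SimpleGraph V) (s : V) (Y : ℕ → Finset V) : ℕ → Finset V
  | 0 => Y 0
  | i + 1 => join G s (prefixJoin G s Y i) (Y (i + 1))

/-- Prefix joins, met with the final separator, form a monotone sequence. Each nontrivial step of it
occupies a vertex not occupied before, so the number of jumps is at most the number of available
vertices minus the size of a separator. -/
theorem exists_monotone_steps {Y : ℕ → Finset V} {r : ℕ} {W : Finset V}
    (hm : ∀ i ≤ r, IsMinSeparator G s t (Y i)) (hn : ∀ i < r, Near (Y i) (Y (i + 1)))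
    (hle : SideLE G s (Y 0) (Y r)) (hW : ∀ i ≤ r, Y i ⊆ W) :
    ∃ c, c + (Y 0).card ≤ W.card ∧ Steps (JumpIn G s t (Y 0) (Y r)) c (Y 0) (Y r) := by
  set P := prefixJoin G s Y
  have hP : ∀ i ≤ r, IsMinSeparator G s t (P i) ∧ SideLE G s (Y i) (P i) ∧
      SideLE G s (Y 0) (P i) ∧ P i ⊆ W := by
    intro i
    induction i with
    | zero => exact fun h => ⟨hm 0 h, .refl _, .refl _, hW 0 h⟩
    | succ i ih =>
      intro hi
      obtain ⟨h1, h2, h3, h4⟩ := ih (by omega)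
      refine ⟨h1.join (hm _ hi), IsMinSeparator.le_join_right,
        h3.trans IsMinSeparator.le_join_left, fun w hw => ?_⟩
      rcases (mem_join.1 hw).1 with h | h
      · exact h4 h
      · exact hW _ hi h
  have hPs : ∀ i < r, SideLE G s (P i) (P (i + 1)) := fun i _ => IsMinSeparator.le_join_left
  have hPn : ∀ i < r, Near (P i) (P (i + 1)) := by
    intro i hi
    obtain ⟨h1, h2, -, -⟩ := hP i hi.le
    have := (hm i hi.le).near_join (hm (i + 1) hi) h1 (hn i hi)
    rw [(hm i hi.le).join_eq_right h1 h2, join_comm] at this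
    exact this
  -- The prefix joins may overshoot the final separator; meeting with it makes the sequence end
  -- there.
  set Z := fun i => meet G s (P i) (Y r)
  have hZ : ∀ i ≤ r, InIcc G s t (Y 0) (Y r) (Z i) ∧ Z i ⊆ W := by
    intro i hi
    obtain ⟨h1, h2, h3, h4⟩ := hP i hi
    refine ⟨⟨h1.meet (hm r le_rfl), h1.le_meet (hm r le_rfl) h3 hle,
      IsMinSeparator.meet_le_left.2⟩, fun w hw => ?_⟩
    rcases (mem_meet.1 hw).1 with h | h
    · exact h4 h
    · exact hW r le_rfl h
  have hZs : ∀ i < r, SideLE G s (Z i) (Z (i + 1)) := fun i hi =>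
    IsMinSeparator.meet_mono (hP (i + 1) hi).1 (hm r le_rfl) (hPs i hi)
  have hZmono : ∀ j ≤ r, ∀ i ≤ j, SideLE G s (Z i) (Z j) := by
    intro j
    induction j with
    | zero => intro _ i hi; rw [Nat.le_zero.1 hi]; exact .refl _
    | succ j ih =>
      intro hj i hi
      rcases Nat.lt_or_ge i (j + 1) with h | h
      · exact (ih (by omega) i (by omega)).trans (hZs j (by omega))
      · rw [show i = j + 1 by omega]
        exact .refl _
  have hZn : ∀ i < r, Near (Z i) (Z (i + 1)) := fun i hi =>
    (hP i hi.le).1.near_meet (hP (i + 1) hi).1 (hm r le_rfl) (hPn i hi)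
  have h0 : Z 0 = Y 0 := (hm 0 (Nat.zero_le _)).meet_eq_left (hm r le_rfl) hle
  have hr : Z r = Y r := by
    change meet G s (P r) (Y r) = Y r
    rw [meet_comm]
    exact (hm r le_rfl).meet_eq_left (hP r le_rfl).1 (hP r le_rfl).2.1
  have key : ∀ j ≤ r, ∃ c, c + (Y 0).card ≤ ((Finset.range (j + 1)).biUnion Z).card ∧
      Steps (JumpIn G s t (Y 0) (Y r)) c (Z 0) (Z j) := by
    intro j
    induction j with
    | zero => intro _; exact ⟨0, by simp [h0], .refl _⟩
    | succ j ih =>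
      intro hj
      obtain ⟨c, hc, hst⟩ := ih (by omega)
      have hZ1 := (hZ j (by omega)).1
      have hZ2 := (hZ (j + 1) hj).1
      have hsub : (Finset.range (j + 1)).biUnion Z ⊆ (Finset.range (j + 1 + 1)).biUnion Z :=
        Finset.biUnion_subset_biUnion_of_subset_left _ (by simp)
      by_cases he : Z j = Z (j + 1)
      · exact ⟨c, hc.trans (Finset.card_le_card hsub), he ▸ hst⟩
      · refine ⟨c + 1, ?_, .snoc hst ⟨hZ1, hZ2,
          (hZn j (by omega)).tokenJump (hZ1.1.card_eq hZ2.1) he⟩⟩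
        obtain ⟨v, hv, u, hu, huv⟩ := (hZn j (by omega)).exists_swap (hZ1.1.card_eq hZ2.1) he
        have huZ : u ∈ Z (j + 1) := by rw [huv]; simp
        -- An earlier occupied vertex lies in `Z j` or on its source side. In the first case it is
        -- not the new vertex, in the second it is on the side of `Z (j + 1)` and cannot belong to
        -- it.
        have hnew : u ∉ (Finset.range (j + 1)).biUnion Z := by
          intro hmem
          obtain ⟨i, hi, hui⟩ := Finset.mem_biUnion.1 hmem
          have hi' : i ≤ j := by simpa [Nat.lt_succ_iff] using hi
          rcases (((hZ i (by omega)).1.1.le_iff hZ1.1).1 (hZmono j (by omega) i hi')) u hui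
            with h | h
          · exact hZ2.1.notMem_side huZ (hZs j (by omega) h)
          · exact hu h
        have := Finset.card_lt_card (Finset.ssubset_iff_subset_ne.2 ⟨hsub, fun e => hnew
          (e ▸ Finset.mem_biUnion.2 ⟨j + 1, by simp, huZ⟩)⟩)
        omega
  obtain ⟨c, hc, hst⟩ := key r le_rfl
  rw [h0, hr] at hst
  refine ⟨c, hc.trans (Finset.card_le_card ?_), hst⟩
  exact Finset.biUnion_subset.2 fun i hi => (hZ i (by simpa [Nat.lt_succ_iff] using hi)).2

/-- The other half of the count: a jump adds at most one vertex to those visited. -/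
theorem card_biUnion_le_of_near {Y : ℕ → Finset V} {r : ℕ}
    (hn : ∀ i < r, Near (Y i) (Y (i + 1))) :
    ((Finset.range (r + 1)).biUnion Y).card ≤ (Y 0).card + r := by
  induction r with
  | zero => simp
  | succ r ih =>
    obtain ⟨u, hu⟩ := hn r (by omega)
    have hsub : (Finset.range (r + 1 + 1)).biUnion Y ⊆
        insert u ((Finset.range (r + 1)).biUnion Y) := by
      intro w hw
      obtain ⟨i, hi, hwi⟩ := Finset.mem_biUnion.1 hw
      by_cases h : i = r + 1
      · subst h
        rcases Finset.mem_insert.1 (hu hwi) with h | h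
        · simp [h]
        · exact Finset.mem_insert_of_mem (Finset.mem_biUnion.2 ⟨r, by simp, h⟩)
      · exact Finset.mem_insert_of_mem (Finset.mem_biUnion.2 ⟨i, by simp at hi ⊢; omega, hwi⟩)
    have h1 := (Finset.card_le_card hsub).trans (Finset.card_insert_le _ _)
    have h2 := ih fun i hi => hn i (by omega)
    omega

/-- Jumps between incomparable separators become jumps from their meet to their join. -/
theorem exists_steps_meet_join {r : ℕ} (hA : IsMinSeparator G s t A) (hB : IsMinSeparator G s t B)
    (h : Steps (MinJump G s t) r A B) : ∃ c ≤ r,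
    Steps (JumpIn G s t (meet G s A B) (join G s A B)) c (meet G s A B) (join G s A B) := by
  obtain ⟨f, h0, hr, hf⟩ := (reconfigurableIn_iff hA).2 h
  obtain ⟨hm, hj⟩ := hf
  have hn : ∀ i < r, Near (f i) (f (i + 1)) := fun i hi => .of_tokenJump (hj i hi)
  -- Meeting the sequence with `B` leads from the meet to `B`; joining its reversal with `B` leads
  -- from `B` to the join.
  set M := fun i => meet G s (f i) B
  set J := fun i => join G s (f (r - i)) B
  set WM := (Finset.range (r + 1)).biUnion M
  set WJ := (Finset.range (r + 1)).biUnion J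
  have hMr : M r = B := by
    change meet G s (f r) B = B
    rw [hr]
    exact hB.meet_eq_left hB (.refl _)
  have hJ0 : J 0 = B := by
    change join G s (f (r - 0)) B = B
    rw [Nat.sub_zero, hr]
    exact hB.join_eq_right hB (.refl _)
  have hM0 : M 0 = meet G s A B := by rw [← h0]
  have hJr : J r = join G s A B := by simp [J, h0]
  have hle1 : SideLE G s (meet G s A B) B := IsMinSeparator.meet_le_left.2
  have hle2 : SideLE G s B (join G s A B) := IsMinSeparator.le_join_right
  obtain ⟨c1, hc1, hst1⟩ := exists_monotone_steps (Y := M) (r := r) (W := WM) (G := G) (s := s)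
    (t := t) (fun i hi => (hm i hi).meet hB)
    (fun i hi => (hm i hi.le).near_meet (hm (i + 1) hi) hB (hn i hi))
    (by rw [hMr, hM0]; exact hle1)
    (fun i hi => Finset.subset_biUnion_of_mem M (by simp; omega))
  obtain ⟨c2, hc2, hst2⟩ := exists_monotone_steps (Y := J) (r := r) (W := WJ) (G := G) (s := s)
    (t := t) (fun i _ => (hm _ (by omega)).join hB)
    (fun i hi => by
      have h1 := hm (r - i) (by omega)
      have h2 := hm (r - (i + 1)) (by omega)
      refine h1.near_join h2 hB (Near.symm ?_ (h2.card_eq h1))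
      have := hn (r - (i + 1)) (by omega)
      rwa [show r - (i + 1) + 1 = r - i by omega] at this)
    (by rw [hJr, hJ0]; exact hle2)
    (fun i hi => Finset.subset_biUnion_of_mem J (by simp; omega))
  rw [hMr, hM0] at hst1
  rw [hJr, hJ0] at hst2
  refine ⟨c1 + c2, ?_, (hst1.mono fun _ _ => .mono (.refl _) hle2).trans
    (hst2.mono fun _ _ => .mono hle1 (.refl _))⟩
  -- All vertices used were visited by the original sequence, and those used by both halves lie in
  -- `B`. With separators of size `k`, the two halves together use at most `(k + r) + k` vertices,
  -- counted separately, while `c1 + c2 + 2 * k` is a lower bound.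
  have hU : WM ∪ WJ ⊆ (Finset.range (r + 1)).biUnion f := by
    have hBf : B ⊆ (Finset.range (r + 1)).biUnion f :=
      hr ▸ Finset.subset_biUnion_of_mem f (by simp)
    have hff : ∀ i ≤ r, f i ⊆ (Finset.range (r + 1)).biUnion f := fun i hi =>
      Finset.subset_biUnion_of_mem f (by simp; omega)
    refine Finset.union_subset (Finset.biUnion_subset.2 fun i hi w hw => ?_)
      (Finset.biUnion_subset.2 fun i hi w hw => ?_)
    · exact (mem_meet.1 hw).1.elim (fun h => hff i (by simp at hi; omega) h) fun h => hBf h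
    · exact (mem_join.1 hw).1.elim (fun h => hff (r - i) (by omega) h) fun h => hBf h
  have hI : WM ∩ WJ ⊆ B := by
    intro w hw
    obtain ⟨h1, h2⟩ := Finset.mem_inter.1 hw
    obtain ⟨i, hi, h1⟩ := Finset.mem_biUnion.1 h1
    obtain ⟨j, hj, h2⟩ := Finset.mem_biUnion.1 h2
    have hmi := (hm i (by simp at hi; omega)).meet hB
    exact ((hmi.le_iff hB).1 IsMinSeparator.meet_le_left.2 w h1).resolve_left (mem_join.1 h2).2.2
  have e := Finset.card_union_add_card_inter WM WJ
  have h1 := Finset.card_le_card hU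
  have h2 := Finset.card_le_card hI
  have h3 := card_biUnion_le_of_near hn
  have h4 := (hA.meet hB).card_eq hB
  have h5 := hA.card_eq hB
  rw [h0] at h3
  rw [hM0] at hc1
  rw [hJ0] at hc2
  omega

/-- Jumps from the meet to the join become jumps between the given separators. -/
theorem exists_steps_of_meet_join {c : ℕ} (hA : IsMinSeparator G s t A)
    (hB : IsMinSeparator G s t B)
    (h : Steps (JumpIn G s t (meet G s A B) (join G s A B)) c (meet G s A B) (join G s A B)) :
    ∃ r ≤ c, Steps (MinJump G s t) r A B := by
  have hL := hA.meet hB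
  have hH := hA.join hB
  have hLA : SideLE G s (meet G s A B) A := IsMinSeparator.meet_le_left.1
  have hLB : SideLE G s (meet G s A B) B := IsMinSeparator.meet_le_left.2
  have hAH : SideLE G s A (join G s A B) := IsMinSeparator.le_join_left
  have hBH : SideLE G s B (join G s A B) := IsMinSeparator.le_join_right
  obtain ⟨f, h0, hc, hf⟩ := Steps.iff_seq.1 h
  have hm : ∀ i ≤ c, InIcc G s t (meet G s A B) (join G s A B) (f i) := by
    intro i hi
    cases i with
    | zero => rw [h0]; exact ⟨hL, .refl _, hLA.trans hAH⟩
    | succ i => exact (hf i hi).2.1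
  have hn : ∀ i < c, Near (f i) (f (i + 1)) := fun i hi => .of_tokenJump (hf i hi).2.2
  -- Meeting the given sequence with a separator `S` of the interval leads from the bottom to `S`.
  -- This is applied to `A` and to `B`, and the first sequence is reversed.
  have main : ∀ S, IsMinSeparator G s t S → SideLE G s (meet G s A B) S →
      SideLE G s S (join G s A B) → ∃ r, r + (meet G s A B).card ≤
        ((Finset.range (c + 1)).biUnion fun i => meet G s (f i) S).card ∧
        Steps (MinJump G s t) r (meet G s A B) S := by
    intro S hS h1 h2
    have e0 : meet G s (f 0) S = meet G s A B := by rw [h0, hL.meet_eq_left hS h1]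
    have ec : meet G s (f c) S = S := by rw [hc, meet_comm, hS.meet_eq_left hH h2]
    obtain ⟨r, hr, hst⟩ := exists_monotone_steps (Y := fun i => meet G s (f i) S) (r := c)
      (W := (Finset.range (c + 1)).biUnion fun i => meet G s (f i) S) (G := G) (s := s)
      (t := t) (fun i hi => (hm i hi).1.meet hS)
      (fun i hi => (hm i hi.le).1.near_meet (hm (i + 1) hi).1 hS (hn i hi))
      (by simpa only [e0, ec] using h1)
      (fun i hi => Finset.subset_biUnion_of_mem (fun i => meet G s (f i) S) (by simp; omega))
    simp only [e0, ec] at hr hst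
    exact ⟨r, hr, hst.mono fun _ _ h => ⟨h.1.1, h.2.1.1, h.2.2⟩⟩
  obtain ⟨r1, hr1, hst1⟩ := main A hA hLA hAH
  obtain ⟨r2, hr2, hst2⟩ := main B hB hLB hBH
  refine ⟨r1 + r2, ?_, (hst1.reverse fun _ _ h => ⟨h.2.1, h.1, h.2.2.symm⟩).trans hst2⟩
  set WA := (Finset.range (c + 1)).biUnion fun i => meet G s (f i) A
  set WB := (Finset.range (c + 1)).biUnion fun i => meet G s (f i) B
  have hff : ∀ i ≤ c, f i ⊆ (Finset.range (c + 1)).biUnion f := fun i hi =>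
    Finset.subset_biUnion_of_mem f (by simp; omega)
  have hAB : ∀ w, w ∈ A ∨ w ∈ B → w ∈ (Finset.range (c + 1)).biUnion f := by
    intro w hw
    by_cases hwm : w ∈ meet G s A B
    · exact hff 0 (by omega) (h0 ▸ hwm)
    · refine hff c le_rfl (hc ▸ mem_join.2 ⟨hw, ?_⟩)
      rw [mem_meet] at hwm
      tauto
  have hU : WA ∪ WB ⊆ (Finset.range (c + 1)).biUnion f := by
    refine Finset.union_subset (Finset.biUnion_subset.2 fun i hi w hw => ?_)
      (Finset.biUnion_subset.2 fun i hi w hw => ?_)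
    · exact (mem_meet.1 hw).1.elim (fun h => hff i (by simp at hi; omega) h)
        fun h => hAB w (Or.inl h)
    · exact (mem_meet.1 hw).1.elim (fun h => hff i (by simp at hi; omega) h)
        fun h => hAB w (Or.inr h)
  -- A vertex used on both ways lies in the meet of a separator below `A` and one below `B`; both
  -- are above the bottom, so this meet is the bottom itself.
  have hI : WA ∩ WB ⊆ meet G s A B := by
    intro w hw
    obtain ⟨h1, h2⟩ := Finset.mem_inter.1 hw
    obtain ⟨i, hi, h1⟩ := Finset.mem_biUnion.1 h1
    obtain ⟨j, hj, h2⟩ := Finset.mem_biUnion.1 h2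
    have hi := hm i (by simp at hi; omega)
    have hj := hm j (by simp at hj; omega)
    have hX := hi.1.meet hA
    have hY := hj.1.meet hB
    have hle : SideLE G s (meet G s (meet G s (f i) A) (meet G s (f j) B)) (meet G s A B) :=
      hA.le_meet hB (IsMinSeparator.meet_le_left.1.trans IsMinSeparator.meet_le_left.2)
        (IsMinSeparator.meet_le_left.2.trans IsMinSeparator.meet_le_left.2)
    have hge : SideLE G s (meet G s A B) (meet G s (meet G s (f i) A) (meet G s (f j) B)) :=
      hX.le_meet hY (hi.1.le_meet hA hi.2.1 hLA) (hj.1.le_meet hB hj.2.1 hLB)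
    rw [← (hX.meet hY).eq_of_le_of_le hL hle hge]
    exact mem_meet.2 ⟨Or.inl h1, Or.inl ⟨h1, h2⟩⟩
  have e := Finset.card_union_add_card_inter WA WB
  have h1 := Finset.card_le_card hU
  have h2 := Finset.card_le_card hI
  have h3 := card_biUnion_le_of_near hn
  rw [h0] at h3
  omega

/-- The number of jumps in an interval can be bounded by the number of vertices visited. -/
theorem exists_steps_le_card {c : ℕ} {W : Finset V}
    (hW : ∀ X, InIcc G s t S T X → X ⊆ W) (hle : SideLE G s S T)
    (hS : IsMinSeparator G s t S) (h : Steps (JumpIn G s t S T) c S T) :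
    ∃ c' ≤ c, c' ≤ W.card ∧ Steps (JumpIn G s t S T) c' S T := by
  obtain ⟨f, h0, hc, hf⟩ := Steps.iff_seq.1 h
  have hm : ∀ i ≤ c, InIcc G s t S T (f i) := by
    intro i hi
    cases i with
    | zero => rw [h0]; exact ⟨hS, .refl _, hle⟩
    | succ i => exact (hf i hi).2.1
  have hn : ∀ i < c, Near (f i) (f (i + 1)) := fun i hi => .of_tokenJump (hf i hi).2.2
  obtain ⟨c', hc', hst⟩ := exists_monotone_steps (W := (Finset.range (c + 1)).biUnion f)
    (fun i hi => (hm i hi).1) hn (by rwa [h0, hc])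
    (fun i hi => Finset.subset_biUnion_of_mem f (by simp; omega))
  have h1 := card_biUnion_le_of_near hn
  have h2 : ((Finset.range (c + 1)).biUnion f).card ≤ W.card := Finset.card_le_card
    (Finset.biUnion_subset.2 fun i hi => hW _ (hm i (by simp at hi; omega)))
  rw [h0, hc] at hst
  exact ⟨c', by omega, by omega, hst⟩

end normalization

end MSR

namespace MSR

open Input

/-! ### The history of the tokens -/

section sweep

variable {G : SimpleGraph ℕ} {s t : ℕ} {L H : Finset ℕ} {C : List (List ℕ)}

/-- A possible history of tokens that move by shortest jumps from `L` towards `H`. -/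
structure SweepInv (G : SimpleGraph ℕ) (s t : ℕ) (L H : Finset ℕ) (C : List (List ℕ)) : Prop where
  ne_nil : ∀ c ∈ C, c ≠ []
  nodup : C.flatten.Nodup
  inIcc : InIcc G s t L H (heads C).toFinset
  tail_mem : ∀ c ∈ C, ∀ v ∈ c.tail, v ∈ reachSet G (heads C).toFinset s
  exists_mem : ∀ v ∈ C.flatten, ∃ Y, InIcc G s t L (heads C).toFinset Y ∧ v ∈ Y
  subset : ∀ T, InIcc G s t L (heads C).toFinset T → ∀ v ∈ T, v ∈ C.flatten
  -- The latest place comes first: `l₂` is the past of the token seen from `T`, `l₁` its future, and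
  -- `x` the only vertex shared with `T`.
  split : ∀ T, InIcc G s t L (heads C).toFinset T → ∀ c ∈ C, ∃ l₁ x l₂, c = l₁ ++ x :: l₂ ∧
    x ∈ T ∧ (∀ y ∈ l₂, y ∈ reachSet G T s) ∧ ∀ y ∈ l₁, y ∉ T ∧ y ∉ reachSet G T s

theorem sweepInv_init (hL : IsMinSeparator G s t L) (hLH : SideLE G s L H) {l : List ℕ}
    (hl : l.Nodup) (hlL : l.toFinset = L) : SweepInv G s t L H (l.map fun a => [a]) := by
  have hh : (heads (l.map fun a => [a])).toFinset = L := by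
    rw [← hlL]
    congr 1
    rw [heads, List.map_map]
    exact List.map_id l
  have hf : (l.map fun a => [a]).flatten = l := by
    clear hlL hl hh
    induction l <;> simp_all
  have hmem : ∀ v, v ∈ l ↔ v ∈ L := fun v => by rw [← hlL, List.mem_toFinset]
  have heq : ∀ T, InIcc G s t L L T → T = L := fun T hT =>
    hT.1.eq_of_le_of_le hL hT.2.2 hT.2.1
  refine ⟨by simp, by rwa [hf], ?_, ?_, ?_, ?_, ?_⟩
  · rw [hh]
    exact ⟨hL, .refl _, hLH⟩
  · intro c hc v hv
    obtain ⟨a, -, rfl⟩ := List.mem_map.1 hc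
    simp at hv
  · intro v hv
    rw [hh]
    rw [hf, hmem] at hv
    exact ⟨L, ⟨hL, .refl _, .refl _⟩, hv⟩
  · intro T hT v hv
    rw [hh] at hT
    rw [heq T hT] at hv
    rwa [hf, hmem]
  · intro T hT c hc
    rw [hh] at hT
    obtain ⟨a, ha, rfl⟩ := List.mem_map.1 hc
    exact ⟨[], a, [], rfl, by rwa [heq T hT, ← hmem], by simp, by simp⟩

theorem toFinset_swap {S : List ℕ} {u v : ℕ} (hv : v ∈ S) :
    (swap S v u).toFinset = insert u (S.toFinset.erase v) := by
  ext w
  simp only [swap, List.mem_toFinset, List.mem_map, Finset.mem_insert, Finset.mem_erase,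
    decide_eq_true_eq]
  constructor
  · rintro ⟨a, ha, rfl⟩
    split_ifs with h
    · simp
    · exact Or.inr ⟨h, ha⟩
  · rintro (rfl | ⟨h1, h2⟩)
    · exact ⟨v, hv, by simp⟩
    · exact ⟨w, h2, by simp [h1]⟩

theorem heads_push {u v : ℕ} (hC : ∀ c ∈ C, c ≠ []) :
    heads (push C (v, u)) = swap (heads C) v u := by
  simp only [heads, push, swap, List.map_map]
  refine List.map_congr_left fun c hc => ?_
  obtain ⟨a, l, rfl⟩ := List.exists_cons_of_ne_nil (hC c hc)
  by_cases h : a = v <;> simp [h]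

theorem headD_mem {c : List ℕ} (hc : c ≠ []) : c.headD 0 ∈ c := by
  obtain ⟨a, l, rfl⟩ := List.exists_cons_of_ne_nil hc
  simp

namespace SweepInv

theorem eq_of_mem (h : SweepInv G s t L H C) {c d : List ℕ} (hc : c ∈ C) (hd : d ∈ C) {v : ℕ}
    (hvc : v ∈ c) (hvd : v ∈ d) : c = d := by
  by_contra hne
  obtain ⟨i, hi, rfl⟩ := List.getElem_of_mem hc
  obtain ⟨j, hj, rfl⟩ := List.getElem_of_mem hd
  have hp := List.pairwise_iff_getElem.1 (List.nodup_flatten.1 h.nodup).2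
  rcases lt_trichotomy i j with hij | rfl | hij
  · exact hp i j hi hj hij hvc hvd
  · exact hne rfl
  · exact hp j i hj hi hij hvd hvc

theorem mem_heads_or (h : SweepInv G s t L H C) {v : ℕ} (hv : v ∈ C.flatten) :
    v ∈ (heads C).toFinset ∨ v ∈ reachSet G (heads C).toFinset s := by
  obtain ⟨c, hc, hvc⟩ := List.mem_flatten.1 hv
  obtain ⟨a, l, rfl⟩ := List.exists_cons_of_ne_nil (h.ne_nil c hc)
  rcases List.mem_cons.1 hvc with rfl | hvc
  · left
    rw [List.mem_toFinset, heads, List.mem_map]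
    exact ⟨_, hc, rfl⟩
  · exact Or.inr (h.tail_mem _ hc v hvc)

/-- A shortest jump keeps the invariant. -/
theorem push (h : SweepInv G s t L H C) {u v : ℕ} (hv : v ∈ heads C)
    (hu : u ∉ (heads C).toFinset)
    (hsep : IsSeparator G s t (insert u ((heads C).toFinset.erase v)))
    (hside : v ∈ reachSet G (insert u ((heads C).toFinset.erase v) : Finset ℕ) s)
    (hle : SideLE G s (insert u ((heads C).toFinset.erase v)) H)
    (hmin : ∀ q, q ∉ (heads C).toFinset → q ≠ s → q ≠ t →
      IsSeparator G s t (insert q ((heads C).toFinset.erase v)) →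
      v ∈ reachSet G (insert q ((heads C).toFinset.erase v) : Finset ℕ) s →
      q ∉ reachSet G (insert u ((heads C).toFinset.erase v) : Finset ℕ) s) :
    SweepInv G s t L H (Input.push C (v, u)) := by
  obtain ⟨hne, hnd, hI, htail, hex, hsub, hspl⟩ := id h
  have heq := @eq_of_mem _ _ _ _ _ _ h
  have hmh := @mem_heads_or _ _ _ _ _ _ h
  have hheads : (heads (Input.push C (v, u))).toFinset =
      insert u ((heads C).toFinset.erase v) := by
    rw [heads_push hne, toFinset_swap hv]
  have hv' : v ∈ (heads C).toFinset := List.mem_toFinset.2 hv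
  set S := (heads C).toFinset
  set S' := insert u (S.erase v) with hS'
  have hSmin := hI.1
  have huv : u ≠ v := fun e => hu (e ▸ hv')
  have hS'min : IsMinSeparator G s t S' := hSmin.of_card_le hsep (by
    rw [hS', Finset.card_insert_of_notMem (by simp [hu]), Finset.card_erase_of_mem hv']
    have := Finset.card_pos.2 ⟨v, hv'⟩
    omega)
  have huS' : u ∈ S' := by simp [hS']
  have hSS' : SideLE G s S S' := (hSmin.le_iff hS'min).2 fun w hw => by
    by_cases e : w = v
    · exact Or.inl (e ▸ hside)
    · exact Or.inr (Finset.mem_insert_of_mem (Finset.mem_erase.2 ⟨e, hw⟩))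
  have huL : u ∉ reachSet G S s := fun hr => hS'min.notMem_side huS' (hSS' hr)
  have huC : u ∉ C.flatten := fun hm => (hmh hm).elim hu huL
  -- Since the jump is a shortest one, there is no minimum separator strictly between `S` and `S'`.
  have hfin : ∀ Q, IsMinSeparator G s t Q → SideLE G s S Q → SideLE G s Q S' → Q = S ∨ Q = S' := by
    intro Q hQ h1 h2
    have hsubQ : S.erase v ⊆ Q := by
      intro w hw
      have hw' := Finset.mem_erase.1 hw
      refine ((hSmin.le_iff hQ).1 h1 w hw'.2).resolve_left fun hr => ?_
      exact hS'min.notMem_side (Finset.mem_insert_of_mem hw) (h2 hr)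
    by_cases hvQ : v ∈ Q
    · left
      refine (hSmin.eq_of_subset hQ fun w hw => ?_).symm
      by_cases e : w = v
      · exact e ▸ hvQ
      · exact hsubQ (Finset.mem_erase.2 ⟨e, hw⟩)
    · right
      obtain ⟨q, hq, hqS⟩ : ∃ q ∈ Q, q ∉ S.erase v := by
        by_contra! hn
        have := Finset.card_le_card (show Q ⊆ S.erase v from hn)
        have h3 := Finset.card_erase_lt_of_mem hv'
        rw [hQ.card_eq hSmin] at this
        omega
      have hqv : q ≠ v := fun e => hvQ (e ▸ hq)
      have hQeq : Q = insert q (S.erase v) := by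
        refine (Finset.eq_of_subset_of_card_le (Finset.insert_subset hq hsubQ) ?_).symm
        rw [Finset.card_insert_of_notMem hqS, Finset.card_erase_of_mem hv', hQ.card_eq hSmin]
        omega
      have hqS' : q ∉ S := fun hm => hqS (Finset.mem_erase.2 ⟨hqv, hm⟩)
      have hvQ' : v ∈ reachSet G Q s := ((hSmin.le_iff hQ).1 h1 v hv').resolve_right hvQ
      have := hmin q hqS' (fun e => hQ.src_notMem (e ▸ hq)) (fun e => hQ.tgt_notMem (e ▸ hq))
        (hQeq ▸ hQ.1) (hQeq ▸ hvQ')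
      have hq' := ((hQ.le_iff hS'min).1 h2 q hq).resolve_left this
      rcases Finset.mem_insert.1 hq' with e | e
      · rw [hQeq, e]
      · exact absurd (Finset.mem_of_mem_erase e) hqS'
  have hflat : ∀ w, w ∈ C.flatten → w ∈ (Input.push C (v, u)).flatten := by
    intro w hw
    obtain ⟨c, hc, hwc⟩ := List.mem_flatten.1 hw
    refine List.mem_flatten.2 ⟨_, List.mem_map.2 ⟨c, hc, rfl⟩, ?_⟩
    split_ifs
    · exact List.mem_cons_of_mem _ hwc
    · exact hwc
  have huflat : u ∈ (Input.push C (v, u)).flatten := by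
    obtain ⟨c, hc, hcv⟩ := List.mem_map.1 hv
    refine List.mem_flatten.2 ⟨_, List.mem_map.2 ⟨c, hc, rfl⟩, ?_⟩
    rw [if_pos (decide_eq_true hcv)]
    exact List.mem_cons_self
  -- a separator below `S'` is below `S` or arises from such a one by the jump
  have hcase : ∀ T, InIcc G s t L S' T → ∃ T₀, InIcc G s t L S T₀ ∧ SideLE G s T₀ T ∧
      (∀ Y, IsMinSeparator G s t Y → SideLE G s Y S → SideLE G s Y T → SideLE G s Y T₀) ∧
      (T = T₀ ∨ v ∈ T₀ ∧ T = insert u (T₀.erase v)) := by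
    intro T hT
    have hT₀ : IsMinSeparator G s t (meet G s S T) := hSmin.meet hT.1
    refine ⟨meet G s S T, ⟨hT₀, hSmin.le_meet hT.1 hI.2.1 hT.2.1, IsMinSeparator.meet_le_left.1⟩,
      IsMinSeparator.meet_le_left.2, fun Y hY h1 h2 => hSmin.le_meet hT.1 h1 h2, ?_⟩
    by_cases hTT : T = meet G s S T
    · exact Or.inl hTT
    right
    have hstep := IsMinSeparator.meet_step (v := v) hSS' (fun w hw => by
      by_cases e : w = v
      · simp [e]
      · exact Finset.mem_insert_of_mem (Finset.mem_insert_of_mem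
          (Finset.mem_erase.2 ⟨e, hw⟩))) T
    rw [meet_comm S' T, hT.1.meet_eq_left hS'min hT.2.2] at hstep
    -- The join of `S` and `T` lies between `S` and `S'`. It is not `S`, since then `T` would be its
    -- own meet with `S`; so it is `S'`, whose new vertex must come from `T`.
    have huT : u ∈ T := by
      have hJ := hfin _ (hSmin.join hT.1) IsMinSeparator.le_join_left
        (IsMinSeparator.join_le hSS' hT.2.2)
      have hJS : join G s S T ≠ S := by
        intro e
        have : SideLE G s T S := e ▸ IsMinSeparator.le_join_right
        rw [meet_comm, hT.1.meet_eq_left hSmin this] at hTT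
        exact hTT rfl
      have := hJ.resolve_left hJS ▸ huS'
      exact (mem_join.1 this).1.resolve_left hu
    have huT₀ : u ∉ meet G s S T := fun hm =>
      ((hT₀.le_iff hSmin).1 IsMinSeparator.meet_le_left.1 u hm).elim huL hu
    have hnear : Near (meet G s S T) T := Near.symm ⟨v, hstep⟩ (hT.1.card_eq hT₀)
    obtain ⟨a, ha, b, hb, hab⟩ := hnear.exists_swap (hT₀.card_eq hT.1) (Ne.symm hTT)
    have hbu : u = b := by
      rw [hab] at huT
      rcases Finset.mem_insert.1 huT with e | e
      · exact e
      · exact absurd (Finset.mem_of_mem_erase e) huT₀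
    have hav : a = v := by
      rcases Finset.mem_insert.1 (hstep ha) with e | e
      · exact e
      · rw [hab] at e
        rcases Finset.mem_insert.1 e with e | e
        · exact absurd (e ▸ ha) hb
        · simp at e
    subst hbu hav
    exact ⟨ha, hab⟩
  refine ⟨?_, ?_, ?_, ?_, ?_, ?_, ?_⟩
  · intro c hc
    obtain ⟨d, hd, rfl⟩ := List.mem_map.1 hc
    split_ifs
    · simp
    · exact hne d hd
  · rw [List.nodup_flatten] at hnd ⊢
    constructor
    · intro c hc
      obtain ⟨d, hd, rfl⟩ := List.mem_map.1 hc
      split_ifs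
      · exact List.nodup_cons.2 ⟨fun hm => huC (List.mem_flatten.2 ⟨d, hd, hm⟩), hnd.1 d hd⟩
      · exact hnd.1 d hd
    · refine List.pairwise_map.2 (hnd.2.imp_of_mem fun {c d} hc hd hcd => ?_)
      have huc : u ∉ c := fun hm => huC (List.mem_flatten.2 ⟨c, hc, hm⟩)
      have hud : u ∉ d := fun hm => huC (List.mem_flatten.2 ⟨d, hd, hm⟩)
      split_ifs with h1 h2 h2
      · simp only [decide_eq_true_eq] at h1 h2
        exact absurd (h2 ▸ headD_mem (hne d hd)) (hcd (h1 ▸ headD_mem (hne c hc)))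
      · exact List.disjoint_cons_left.2 ⟨hud, hcd⟩
      · exact List.disjoint_cons_right.2 ⟨huc, hcd⟩
      · exact hcd
  · rw [hheads]
    exact ⟨hS'min, hI.2.1.trans hSS', hle⟩
  · rw [hheads]
    intro c hc w hw
    obtain ⟨d, hd, rfl⟩ := List.mem_map.1 hc
    split_ifs at hw with h1
    · simp only [decide_eq_true_eq] at h1
      obtain ⟨a, l, rfl⟩ := List.exists_cons_of_ne_nil (hne d hd)
      rcases List.mem_cons.1 hw with rfl | hw
      · simp only [List.headD_cons] at h1
        exact h1 ▸ hside
      · exact hSS' (htail _ hd w hw)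
    · exact hSS' (htail d hd w hw)
  · rw [hheads]
    intro w hw
    by_cases hwu : w = u
    · exact ⟨S', ⟨hS'min, hI.2.1.trans hSS', .refl _⟩, hwu ▸ huS'⟩
    · have hwC : w ∈ C.flatten := by
        obtain ⟨c, hc, hwc⟩ := List.mem_flatten.1 hw
        obtain ⟨d, hd, rfl⟩ := List.mem_map.1 hc
        refine List.mem_flatten.2 ⟨d, hd, ?_⟩
        split_ifs at hwc
        · exact (List.mem_cons.1 hwc).resolve_left hwu
        · exact hwc
      obtain ⟨Y, hY, hwY⟩ := hex w hwC
      exact ⟨Y, ⟨hY.1, hY.2.1, hY.2.2.trans hSS'⟩, hwY⟩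
  · rw [hheads]
    intro T hT w hw
    obtain ⟨T₀, hT₀, -, -, rfl | ⟨-, rfl⟩⟩ := hcase T hT
    · exact hflat w (hsub _ hT₀ w hw)
    · rcases Finset.mem_insert.1 hw with rfl | hw
      · exact huflat
      · exact hflat w (hsub _ hT₀ w (Finset.mem_of_mem_erase hw))
  · rw [hheads]
    intro T hT c hc
    obtain ⟨d, hd, rfl⟩ := List.mem_map.1 hc
    obtain ⟨T₀, hT₀, hle₀, hglb, hT'⟩ := hcase T hT
    obtain ⟨l₁, x, l₂, hdl, hx, hl₂, hl₁⟩ := hspl T₀ hT₀ d hd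
    rcases hT' with rfl | ⟨hvT₀, hTeq⟩
    · split_ifs
      · refine ⟨u :: l₁, x, l₂, by simp [hdl], hx, hl₂, ?_⟩
        intro y hy
        rcases List.mem_cons.1 hy with rfl | hy
        · exact ⟨fun hm => huC (hsub _ hT₀ y hm), fun hm => huL (hT₀.2.2 hm)⟩
        · exact hl₁ y hy
      · exact ⟨l₁, x, l₂, hdl, hx, hl₂, hl₁⟩
    · have hvT : v ∉ T := by simp [hTeq, huv.symm]
      split_ifs with h1
      · simp only [decide_eq_true_eq] at h1
        have hl₁' : l₁ = [] := by
          cases l₁ with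
          | nil => rfl
          | cons a l =>
            rw [hdl] at h1
            simp only [List.cons_append, List.headD_cons] at h1
            exact absurd (h1 ▸ hvT₀) (hl₁ a (by simp)).1
        subst hl₁'
        have hxv : x = v := by simpa [hdl] using h1
        subst hxv
        refine ⟨[], u, x :: l₂, by simp [hdl], by simp [hTeq], ?_, by simp⟩
        intro y hy
        rcases List.mem_cons.1 hy with rfl | hy
        · exact ((hT₀.1.le_iff hT.1).1 hle₀ y hx).resolve_right hvT
        · exact hle₀ (hl₂ y hy)
      · simp only [decide_eq_true_eq] at h1
        have hxd : x ∈ d := by simp [hdl]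
        have hxv : x ≠ v := by
          rintro rfl
          obtain ⟨c, hc, hcv⟩ := List.mem_map.1 hv
          exact h1 (heq hd hc hxd (hcv ▸ headD_mem (hne c hc)) ▸ hcv)
        refine ⟨l₁, x, l₂, hdl, ?_, fun y hy => hle₀ (hl₂ y hy), fun y hy => ?_⟩
        · rw [hTeq]
          exact Finset.mem_insert_of_mem (Finset.mem_erase.2 ⟨hxv, hx⟩)
        · have hyC : y ∈ C.flatten := List.mem_flatten.2 ⟨d, hd, by simp [hdl, hy]⟩
          obtain ⟨hy1, hy2⟩ := hl₁ y hy
          refine ⟨fun hm => ?_, fun hr => ?_⟩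
          · rw [hTeq] at hm
            rcases Finset.mem_insert.1 hm with e | e
            · exact huC (e ▸ hyC)
            · exact hy1 (Finset.mem_of_mem_erase e)
          -- Take a separator `Y` below `S` through `y`. If `y` were on the side of `T`, it would
          -- lie in the meet of `Y` and `T`, which is below `T₀`; but `y` is beyond `T₀`.
          · obtain ⟨Y, hY, hyY⟩ := hex y hyC
            have hM := hY.1.meet hT.1
            have hle' := hglb _ hM (IsMinSeparator.meet_le_left.1.trans hY.2.2)
              IsMinSeparator.meet_le_left.2
            have hyM : y ∈ meet G s Y T := mem_meet.2 ⟨Or.inl hyY, Or.inr (Or.inr hr)⟩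
            exact ((hM.le_iff hT₀.1).1 hle' y hyM).elim hy2 hy1

end SweepInv

end sweep

end MSR

namespace MSR

open Input

/-! ### Existence of shortest advances -/

section advance

variable {G : SimpleGraph ℕ} {s t : ℕ} {L H S : Finset ℕ}

/-- Jumps from `L` to `H` allow every separator between them to advance towards `H`. -/
theorem exists_advance {c : ℕ} (hst : Steps (JumpIn G s t L H) c L H)
    (hL : IsMinSeparator G s t L) (hH : IsMinSeparator G s t H)
    (hS : InIcc G s t L H S) (hne : S ≠ H) : ∃ v ∈ S, ∃ u, u ∉ S ∧
      IsMinSeparator G s t (insert u (S.erase v)) ∧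
      v ∈ reachSet G (insert u (S.erase v) : Finset ℕ) s ∧
      SideLE G s (insert u (S.erase v)) H := by
  obtain ⟨f, h0, hc, hf⟩ := Steps.iff_seq.1 hst
  obtain ⟨hSm, hLS, hSH⟩ := hS
  -- Joining `S` with the sequence starts at `S` and ends at `H`. The first time the join leaves `S`
  -- is a single jump.
  have hex : ∃ j, j < c ∧ join G s S (f j) = S ∧ join G s S (f (j + 1)) ≠ S := by
    by_contra! hn
    have key : ∀ j ≤ c, join G s S (f j) = S := by
      intro j
      induction j with
      | zero =>
        intro _
        rw [h0, join_comm]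
        exact hL.join_eq_right hSm hLS
      | succ j ih => exact fun hj => hn j hj (ih (by omega))
    have h1 := key c le_rfl
    rw [hc, hSm.join_eq_right hH hSH] at h1
    exact hne h1.symm
  obtain ⟨j, hj, hj1, hj2⟩ := hex
  have hfj := (hf j hj).1
  have hfj' := (hf j hj).2.1
  have hJ := hSm.join hfj'.1
  have hnear : Near S (join G s S (f (j + 1))) := by
    have := hfj.1.near_join hfj'.1 hSm (.of_tokenJump (hf j hj).2.2)
    rwa [join_comm, hj1, join_comm] at this
  obtain ⟨v, hv, u, hu, he⟩ := hnear.exists_swap (hSm.card_eq hJ) hj2.symm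
  have hvu : v ≠ u := fun e => hu (e ▸ hv)
  refine ⟨v, hv, u, hu, he ▸ hJ, ?_, he ▸ IsMinSeparator.join_le hSH hfj'.2.2⟩
  rw [← he]
  refine ((hSm.le_iff hJ).1 IsMinSeparator.le_join_left v hv).resolve_right ?_
  rw [he]
  simp [hvu]

/-- Among the advances of a token there is a shortest one. -/
theorem exists_min_advance {N v u : ℕ} (hN : ∀ a b, G.Adj a b → b < N)
    (hS : IsMinSeparator G s t S) (hv : v ∈ S) (hu : u ∉ S)
    (hsep : IsMinSeparator G s t (insert u (S.erase v)))
    (hside : v ∈ reachSet G (insert u (S.erase v) : Finset ℕ) s)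
    (hle : SideLE G s (insert u (S.erase v)) H) : ∃ u, u < N ∧ u ∉ S ∧
      IsMinSeparator G s t (insert u (S.erase v)) ∧
      v ∈ reachSet G (insert u (S.erase v) : Finset ℕ) s ∧
      SideLE G s (insert u (S.erase v)) H ∧
      ∀ q, q ∉ S → q ≠ s → q ≠ t → IsSeparator G s t (insert q (S.erase v)) →
        v ∈ reachSet G (insert q (S.erase v) : Finset ℕ) s →
        q ∉ reachSet G (insert u (S.erase v) : Finset ℕ) s := by
  classical
  -- Descent on the size of the source side: a shorter advance to `q` has a smaller side, which no
  -- longer contains `q`.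
  induction hk : ((Finset.range N).filter fun w =>
    w ∈ reachSet G (insert u (S.erase v) : Finset ℕ) s).card using Nat.strong_induction_on
    generalizing u with
  | _ k ih =>
  by_cases hmin : ∀ q, q ∉ S → q ≠ s → q ≠ t → IsSeparator G s t (insert q (S.erase v)) →
        v ∈ reachSet G (insert q (S.erase v) : Finset ℕ) s →
        q ∉ reachSet G (insert u (S.erase v) : Finset ℕ) s
  · obtain ⟨a, -, hau⟩ := hsep.exists_adj (Finset.mem_insert_self u _)
    exact ⟨u, hN a u hau, hu, hsep, hside, hle, hmin⟩
  push Not at hmin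
  obtain ⟨q, hq, hqs, hqt, hqsep, hqside, hqu⟩ := hmin
  have hqm : IsMinSeparator G s t (insert q (S.erase v)) := hS.of_card_le hqsep (by
    rw [Finset.card_insert_of_notMem (by simp [hq]), Finset.card_erase_of_mem hv]
    have := Finset.card_pos.2 ⟨v, hv⟩
    omega)
  have hqle : SideLE G s (insert q (S.erase v)) (insert u (S.erase v)) := by
    refine (hqm.le_iff hsep).2 fun w hw => ?_
    rcases Finset.mem_insert.1 hw with rfl | hw
    · exact Or.inl hqu
    · exact Or.inr (Finset.mem_insert_of_mem hw)
  obtain ⟨a, -, haq⟩ := hqm.exists_adj (Finset.mem_insert_self q _)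
  refine ih _ ?_ hq hqm hqside (hqle.trans hle) rfl
  rw [← hk]
  refine Finset.card_lt_card (Finset.ssubset_iff_subset_ne.2 ⟨fun w hw => ?_, fun e => ?_⟩)
  · rw [Finset.mem_filter] at hw ⊢
    exact ⟨hw.1, hqle hw.2⟩
  · have : q ∈ (Finset.range N).filter fun w =>
        w ∈ reachSet G (insert u (S.erase v) : Finset ℕ) s := by
      simpa using ⟨hN a q haq, by simpa using hqu⟩
    rw [← e, Finset.mem_filter] at this
    exact hqm.notMem_side (Finset.mem_insert_self q _) this.2

end advance

/-! ### States of chains -/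

/-- The positions of a list of chains. -/
def posList (ch : List (List ℕ)) : List Pos :=
  (List.range ch.length).flatMap fun i => posOf (ch.getD i []).reverse i

/-- Chains list the latest place first, hence the reversal: rank 0 is the place where the token
starts. -/
theorem mem_posList {ch : List (List ℕ)} {p : Pos} : p ∈ posList ch ↔
    ∃ c, ch[p.2.1]? = some c ∧ c.reverse[p.2.2.1]? = some p.1 ∧
      p.2.2.2 = decide (p.2.2.1 + 1 = c.length) := by
  obtain ⟨v, i, j, b⟩ := p
  simp only [posList, posOf, List.mem_flatMap, List.mem_map, List.mem_range, Prod.mk.injEq]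
  constructor
  · rintro ⟨i', hi, j', hj, rfl, rfl, rfl, rfl⟩
    refine ⟨ch[i'], by simp [hi], ?_, ?_⟩
    · have e : ch.getD i' [] = ch[i'] := by simp [List.getD_eq_getElem?_getD, hi]
      rw [e] at hj ⊢
      rw [List.getD_eq_getElem _ _ hj, List.getElem?_eq_getElem hj]
    · simp [List.getD_eq_getElem?_getD, hi]
  · rintro ⟨c, hc, hv, hb⟩
    obtain ⟨hi, rfl⟩ := List.getElem?_eq_some_iff.1 hc
    obtain ⟨hj, rfl⟩ := List.getElem?_eq_some_iff.1 hv
    have e : ch.getD i [] = ch[i] := by simp [List.getD_eq_getElem?_getD, hi]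
    refine ⟨i, hi, j, ?_, ?_, rfl, rfl, ?_⟩
    · rwa [e]
    · rw [e, List.getD_eq_getElem _ _ hj]
    · rw [e, List.length_reverse, hb]

/-- The token of column `i` is at a position of rank `x i`. -/
def Valid (Q : List Pos) (m : ℕ) (x : ℕ → ℕ) : Prop :=
  -- The value 0 outside of the columns makes two states with the same ranks equal as functions.
  (∀ i < m, ∃ p ∈ Q, p.2.1 = i ∧ p.2.2.1 = x i) ∧ ∀ i, m ≤ i → x i = 0

/-- A state respects the constraints `E`. -/
def ClosedUnder (Q : List Pos) (E : Pos → Pos → Prop) (x : ℕ → ℕ) : Prop :=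
  -- A passed position is on the source side of the separator, so a neighbour `q` may not be beyond
  -- it.
  ∀ p ∈ Q, ∀ q ∈ Q, E p q → p.2.2.1 < x p.2.1 → q.2.2.1 ≤ x q.2.1

/-- A valid state that respects the constraints. -/
def IsState (Q : List Pos) (m : ℕ) (E : Pos → Pos → Prop) (x : ℕ → ℕ) : Prop :=
  Valid Q m x ∧ ClosedUnder Q E x

/-- Two states that differ in one column. -/
def StateStep (Q : List Pos) (m : ℕ) (E : Pos → Pos → Prop) (x y : ℕ → ℕ) : Prop :=
  IsState Q m E x ∧ IsState Q m E y ∧ ∃ i, x i ≠ y i ∧ ∀ j, j ≠ i → x j = y j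

/-- The set of vertices occupied in a state. -/
def sepOf (vx : Pos → ℕ) (D : Finset ℕ) (Q : List Pos) (x : ℕ → ℕ) : Finset ℕ :=
  D ∪ ((Q.filter fun p => p.2.2.1 = x p.2.1).map vx).toFinset

theorem mem_sepOf {vx : Pos → ℕ} {D : Finset ℕ} {Q : List Pos} {x : ℕ → ℕ} {w : ℕ} :
    w ∈ sepOf vx D Q x ↔ w ∈ D ∨ ∃ p ∈ Q, vx p = w ∧ p.2.2.1 = x p.2.1 := by
  simp only [sepOf, Finset.mem_union, List.mem_toFinset, List.mem_map, List.mem_filter,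
    decide_eq_true_eq]
  refine or_congr_right ⟨?_, ?_⟩
  · rintro ⟨p, ⟨h1, h2⟩, h3⟩
    exact ⟨p, h1, h3, h2⟩
  · rintro ⟨p, h1, h3, h2⟩
    exact ⟨p, ⟨h1, h2⟩, h3⟩

/-- Positions in columns, represented by vertices. -/
structure Grid (vx : Pos → ℕ) (D : Finset ℕ) (Q : List Pos) (m : ℕ) : Prop where
  inj : ∀ p ∈ Q, ∀ q ∈ Q, vx p = vx q → p = q
  ext : ∀ p ∈ Q, ∀ q ∈ Q, p.2.1 = q.2.1 → p.2.2.1 = q.2.2.1 → p = q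
  col_lt : ∀ p ∈ Q, p.2.1 < m
  notMem : ∀ p ∈ Q, vx p ∉ D

namespace Grid

variable {vx : Pos → ℕ} {D : Finset ℕ} {Q : List Pos} {m : ℕ} {x y : ℕ → ℕ}

theorem mem_sepOf_iff (h : Grid vx D Q m) {p : Pos} (hp : p ∈ Q) :
    vx p ∈ sepOf vx D Q x ↔ p.2.2.1 = x p.2.1 := by
  rw [mem_sepOf]
  constructor
  · rintro (h1 | ⟨q, hq, hqp, h1⟩)
    · exact absurd h1 (h.notMem p hp)
    · rwa [h.inj q hq p hp hqp] at h1
  · exact fun h1 => Or.inr ⟨p, hp, rfl, h1⟩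

theorem card_sepOf (h : Grid vx D Q m) (hx : Valid Q m x) :
    (sepOf vx D Q x).card = D.card + m := by
  choose! g hg using hx.1
  have he : sepOf vx D Q x = D ∪ (Finset.range m).image fun i => vx (g i) := by
    ext w
    rw [mem_sepOf, Finset.mem_union, Finset.mem_image]
    refine or_congr_right ⟨?_, ?_⟩
    · rintro ⟨p, hp, rfl, h1⟩
      have hlt := h.col_lt p hp
      obtain ⟨h2, h3, h4⟩ := hg _ hlt
      exact ⟨p.2.1, by simpa using hlt, by rw [h.ext _ h2 p hp h3 (h4.trans h1.symm)]⟩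
    · rintro ⟨i, hi, rfl⟩
      obtain ⟨h2, h3, h4⟩ := hg i (by simpa using hi)
      exact ⟨g i, h2, rfl, by rw [h4, h3]⟩
  rw [he, Finset.card_union_of_disjoint, Finset.card_image_of_injOn, Finset.card_range]
  · intro i hi j hj hij
    obtain ⟨h2, h3, h4⟩ := hg i (by simpa using hi)
    obtain ⟨h2', h3', h4'⟩ := hg j (by simpa using hj)
    have := h.inj _ h2 _ h2' hij
    rw [← h3, this, h3']
  · rw [Finset.disjoint_left]
    rintro w hw hw'
    obtain ⟨i, hi, rfl⟩ := Finset.mem_image.1 hw'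
    exact h.notMem _ (hg i (by simpa using hi)).1 hw

theorem eq_of_sepOf_eq (h : Grid vx D Q m) (hx : Valid Q m x) (hy : Valid Q m y)
    (he : sepOf vx D Q x = sepOf vx D Q y) : x = y := by
  funext i
  rcases Nat.lt_or_ge i m with hi | hi
  · obtain ⟨p, hp, rfl, h1⟩ := hx.1 i hi
    have := (h.mem_sepOf_iff hp).2 h1
    rw [he, h.mem_sepOf_iff hp] at this
    omega
  · rw [hx.2 i hi, hy.2 i hi]

/-- Two changed columns would contribute two new vertices, while a jump brings only one. -/
theorem tokenJump_iff (h : Grid vx D Q m) (hx : Valid Q m x) (hy : Valid Q m y) :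
    TokenJump (sepOf vx D Q x) (sepOf vx D Q y) ↔ ∃ i, x i ≠ y i ∧ ∀ j, j ≠ i → x j = y j := by
  constructor
  · intro hj
    have hne : x ≠ y := fun e => hj.ne (by rw [e])
    obtain ⟨i, hi⟩ := Function.ne_iff.1 hne
    refine ⟨i, hi, fun j hji => ?_⟩
    by_contra hxj
    obtain ⟨u, hu⟩ := Near.of_tokenJump hj
    have key : ∀ i, x i ≠ y i → ∃ p ∈ Q, p.2.1 = i ∧ vx p = u := by
      intro i hi
      have him : i < m := by
        by_contra hge
        exact hi (by rw [hx.2 i (by omega), hy.2 i (by omega)])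
      obtain ⟨p, hp, rfl, h1⟩ := hy.1 i him
      refine ⟨p, hp, rfl, (Finset.mem_insert.1 (hu ((h.mem_sepOf_iff hp).2 h1))).resolve_right ?_⟩
      rw [h.mem_sepOf_iff hp]
      omega
    obtain ⟨p, hp, hpi, hpu⟩ := key i hi
    obtain ⟨q, hq, hqj, hqu⟩ := key j hxj
    rw [h.inj p hp q hq (hpu.trans hqu.symm)] at hpi
    exact hji (hqj.symm.trans hpi)
  · rintro ⟨i, hi, hij⟩
    have hne : sepOf vx D Q x ≠ sepOf vx D Q y := fun e => hi (by rw [h.eq_of_sepOf_eq hx hy e])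
    have him : i < m := by
      by_contra hge
      exact hi (by rw [hx.2 i (by omega), hy.2 i (by omega)])
    obtain ⟨p, hp, hpi, h1⟩ := hy.1 i him
    refine Near.tokenJump ⟨vx p, fun w hw => ?_⟩ (by rw [h.card_sepOf hx, h.card_sepOf hy]) hne
    rw [Finset.mem_insert, mem_sepOf]
    rcases mem_sepOf.1 hw with hw | ⟨q, hq, rfl, h2⟩
    · exact Or.inr (Or.inl hw)
    · by_cases hqi : q.2.1 = i
      · left
        rw [h.ext q hq p hp (hqi.trans hpi.symm) (by rw [h2, h1, hqi])]
      · exact Or.inr (Or.inr ⟨q, hq, rfl, by rw [h2, hij _ hqi]⟩)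

/-- Jumps of tokens are steps of states. -/
theorem steps_iff (h : Grid vx D Q m) {E : Pos → Pos → Prop} {M : Finset ℕ → Prop}
    (hM : ∀ T, M T ↔ ∃ x, IsState Q m E x ∧ T = sepOf vx D Q x) {c : ℕ}
    (hx : IsState Q m E x) (hy : IsState Q m E y) :
    Steps (fun X Y => M X ∧ M Y ∧ TokenJump X Y) c (sepOf vx D Q x) (sepOf vx D Q y) ↔
      Steps (StateStep Q m E) c x y := by
  constructor
  · suffices ∀ X Y, Steps (fun X Y => M X ∧ M Y ∧ TokenJump X Y) c X Y → ∀ x y,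
        IsState Q m E x → IsState Q m E y → X = sepOf vx D Q x → Y = sepOf vx D Q y →
        Steps (StateStep Q m E) c x y from fun hst => this _ _ hst x y hx hy rfl rfl
    intro X Y hst
    induction hst with
    | refl X =>
      intro x y hx hy e1 e2
      rw [h.eq_of_sepOf_eq hx.1 hy.1 (e1.symm.trans e2)]
      exact .refl _
    | snoc _ hr ih =>
      intro x y hx hy e1 e2
      obtain ⟨h1, -, h3⟩ := hr
      obtain ⟨z, hz, rfl⟩ := (hM _).1 h1
      subst e2
      exact .snoc (ih x z hx hz e1 rfl) ⟨hz, hy, (h.tokenJump_iff hz.1 hy.1).1 h3⟩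
  · intro hst
    clear hx hy
    induction hst with
    | refl => exact .refl _
    | snoc _ hr ih =>
      obtain ⟨h1, h2, h3⟩ := hr
      exact .snoc ih ⟨(hM _).2 ⟨_, h1, rfl⟩, (hM _).2 ⟨_, h2, rfl⟩,
        (h.tokenJump_iff h1.1 h2.1).2 h3⟩

end Grid

end MSR

namespace MSR

open Input

/-! ### Minimum separators of an interval as closed rank vectors -/

section layout

variable {G : SimpleGraph ℕ} {s t : ℕ} {L H D T : Finset ℕ} {Q : List Pos} {m : ℕ}

/-- The vertices represented by positions or fixed. -/
def occupied (D : Finset ℕ) (Q : List Pos) : Set ℕ := {w | w ∈ D ∨ ∃ p ∈ Q, p.1 = w}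

/-- Positions of different columns that are joined by a walk without other occupied vertices. -/
def Linked (G : SimpleGraph ℕ) (U : Set ℕ) (p q : Pos) : Prop :=
  -- `reachSet` does not test its starting vertex, so a walk may leave from an occupied position.
  p.2.1 ≠ q.2.1 ∧ ((∃ w ∈ reachSet G U p.1, G.Adj w q.1) ∨ ∃ w ∈ reachSet G U q.1, G.Adj w p.1)

/-- Positions that describe the minimum separators between `L` and `H`. -/
structure Layout (G : SimpleGraph ℕ) (s t : ℕ) (L H D : Finset ℕ) (Q : List Pos) (m : ℕ) :
    Prop extends Grid Prod.fst D Q m where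
  bot : IsMinSeparator G s t L
  top : IsMinSeparator G s t H
  le : SideLE G s L H
  exists_mem : ∀ p ∈ Q, ∃ Y, InIcc G s t L H Y ∧ p.1 ∈ Y
  state : ∀ T, InIcc G s t L H T → ∃ x, Valid Q m x ∧ T = sepOf Prod.fst D Q x ∧
    ∀ p ∈ Q, p.1 ∈ reachSet G T s ↔ p.2.2.1 < x p.2.1

namespace Layout

theorem subset_bot (h : Layout G s t L H D Q m) : D ⊆ L := by
  obtain ⟨x, -, rfl, -⟩ := h.state L ⟨h.bot, .refl _, h.le⟩
  exact Finset.subset_union_left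

theorem subset_occupied (h : Layout G s t L H D Q m) (hT : InIcc G s t L H T) : (T : Set ℕ) ⊆ occupied D Q := by
  obtain ⟨x, -, rfl, -⟩ := h.state T hT
  intro w hw
  exact (mem_sepOf (x := x).1 (by simpa using hw)).imp_right fun ⟨p, hp, e, _⟩ => ⟨p, hp, e⟩

theorem exists_mem_of_occupied (h : Layout G s t L H D Q m) {w : ℕ} (hw : w ∈ occupied D Q) :
    ∃ Y, InIcc G s t L H Y ∧ w ∈ Y := by
  rcases hw with hw | ⟨p, hp, rfl⟩
  · exact ⟨L, ⟨h.bot, .refl _, h.le⟩, h.subset_bot hw⟩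
  · exact h.exists_mem p hp

theorem notMem_side (h : Layout G s t L H D Q m) {w : ℕ} (hw : w ∈ occupied D Q) : w ∉ reachSet G L s := by
  obtain ⟨Y, hY, hwY⟩ := h.exists_mem_of_occupied hw
  exact fun hr => hY.1.notMem_side hwY (hY.2.1 hr)

theorem mem_side_or_mem (h : Layout G s t L H D Q m) {w : ℕ} (hw : w ∈ occupied D Q) : w ∈ reachSet G H s ∨ w ∈ H := by
  obtain ⟨Y, hY, hwY⟩ := h.exists_mem_of_occupied hw
  exact (hY.1.le_iff h.top).1 hY.2.2 w hwY

/-- Walks outside of the occupied vertices stay on one side of a separator. -/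
theorem reachSet_subset_side (h : Layout G s t L H D Q m) (hT : InIcc G s t L H T) {a : ℕ} (ha : a ∈ reachSet G T s) :
    reachSet G (occupied D Q) a ⊆ reachSet G T s :=
  reachSet_subset ha fun _ hu _ huv hv => reachSet_step hu huv fun hvT =>
    hv (h.subset_occupied hT hvT)

/-- A walk outside the occupied vertices is traced backwards. Separators of the interval consist of
occupied vertices, so only its start can lie in `T`. -/
theorem mem_of_mem_reachSet (h : Layout G s t L H D Q m) (hT : InIcc G s t L H T) {a w : ℕ}
    (hw : w ∈ reachSet G (occupied D Q) a) (hwT : w ∈ reachSet G T s) :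
    a ∈ reachSet G T s ∨ a ∈ T := by
  induction hw with
  | refl => exact Or.inl hwT
  | @tail b c h1 h2 ih =>
    by_cases hb : b ∈ T
    · rcases Relation.ReflTransGen.cases_tail h1 with e | ⟨d, -, h3⟩
      · exact Or.inr (e ▸ hb)
      · exact absurd (h.subset_occupied hT (by simpa using hb)) h3.2
    · exact ih (reachSet_step hwT h2.1.symm (by simpa using hb))

/-- A walk from `p` on the source side without inner occupied vertices cannot cross `T` before `q`,
so `q` is on that side or in `T`. -/
theorem closedUnder (h : Layout G s t L H D Q m) {x : ℕ → ℕ} (hT : InIcc G s t L H T) (hTx : T = sepOf Prod.fst D Q x)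
    (hx : ∀ p ∈ Q, p.1 ∈ reachSet G T s ↔ p.2.2.1 < x p.2.1) :
    ClosedUnder Q (Linked G (occupied D Q)) x := by
  intro p hp q hq hpq hlt
  have hle : q.1 ∈ reachSet G T s ∨ q.1 ∈ T → q.2.2.1 ≤ x q.2.1 := by
    rintro (h1 | h1)
    · exact ((hx q hq).1 h1).le
    · rw [hTx, h.mem_sepOf_iff hq] at h1
      exact h1.le
  have hpT := (hx p hp).2 hlt
  refine hle ?_
  rcases hpq.2 with ⟨w, hw, hwq⟩ | ⟨w, hw, hwp⟩
  · by_contra! hn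
    exact hn.1 (reachSet_step (h.reachSet_subset_side hT hpT hw) hwq (by simpa using hn.2))
  · by_cases hwT : w ∈ T
    · rcases Relation.ReflTransGen.cases_tail hw with e | ⟨d, -, h3⟩
      · exact Or.inr (e ▸ hwT)
      · exact absurd (h.subset_occupied hT (by simpa using hwT)) h3.2
    · exact h.mem_of_mem_reachSet hT hw (reachSet_step hpT hwp.symm (by simpa using hwT))

/-- The region reachable from the source and from all passed positions without entering occupied
vertices is enclosed by `T`: an occupied vertex next to it is either in `T` or itself a passed
position. -/
theorem inIcc_sepOf (h : Layout G s t L H D Q m) {x : ℕ → ℕ} (hx : IsState Q m (Linked G (occupied D Q)) x) :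
    InIcc G s t L H (sepOf Prod.fst D Q x) := by
  set T := sepOf Prod.fst D Q x with hTdef
  have hTV : (T : Set ℕ) ⊆ occupied D Q := by
    intro w hw
    exact (mem_sepOf (x := x).1 (by simpa using hw)).imp_right fun ⟨p, hp, e, _⟩ => ⟨p, hp, e⟩
  have hLV := h.subset_occupied ⟨h.bot, .refl _, h.le⟩
  -- For each single column there is a genuine minimum separator with the prescribed rank there;
  -- ranks in other columns may differ.
  have hat : ∀ p ∈ Q, ∃ Y y, InIcc G s t L H Y ∧ Y = sepOf Prod.fst D Q y ∧
      y p.2.1 = x p.2.1 ∧ ∀ q ∈ Q, q.1 ∈ reachSet G Y s ↔ q.2.2.1 < y q.2.1 := by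
    intro p hp
    obtain ⟨z, hz, hz1, hz2⟩ := hx.1.1 _ (h.col_lt p hp)
    obtain ⟨Y, hY, hzY⟩ := h.exists_mem z hz
    obtain ⟨y, hy, hYy, hyr⟩ := h.state Y hY
    refine ⟨Y, y, hY, hYy, ?_, hyr⟩
    rw [hYy, h.mem_sepOf_iff hz] at hzY
    rw [← hz1, ← hzY, hz2, hz1]
  have hbefore : ∀ p ∈ Q, p.2.2.1 < x p.2.1 → p.1 ∈ reachSet G H s := by
    intro p hp hlt
    obtain ⟨Y, y, hY, -, hyx, hyr⟩ := hat p hp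
    exact hY.2.2 ((hyr p hp).2 (hyx ▸ hlt))
  have hst : ∀ w ∈ T, w ≠ s ∧ w ≠ t := by
    intro w hw
    obtain ⟨Y, hY, hwY⟩ := h.exists_mem_of_occupied (hTV (by simpa using hw))
    exact ⟨fun e => hY.1.src_notMem (e ▸ hwY), fun e => hY.1.tgt_notMem (e ▸ hwY)⟩
  have hsep : IsSeparator G s t T := by
    refine isSeparator_of_region (U := {w | ∃ u, (u = s ∨ ∃ p ∈ Q, p.1 = u ∧ p.2.2.1 < x p.2.1) ∧
      w ∈ reachSet G (occupied D Q) u}) (fun hs => (hst s hs).1 rfl) (fun ht => (hst t ht).2 rfl)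
      ⟨s, Or.inl rfl, self_mem_reachSet⟩ ?_ ?_
    · rintro ⟨u, hu, htu⟩
      refine h.top.tgt_notMem_side (h.reachSet_subset_side ⟨h.top, h.le, .refl _⟩ ?_ htu)
      rcases hu with rfl | ⟨p, hp, rfl, hlt⟩
      · exact self_mem_reachSet
      · exact hbefore p hp hlt
    · rintro w ⟨u, hu, hw⟩ v hwv hvT
      by_cases hvV : v ∈ occupied D Q
      · rcases hvV with hvD | ⟨q, hq, rfl⟩
        · exact absurd (mem_sepOf.2 (Or.inl hvD)) hvT
        refine ⟨q.1, Or.inr ⟨q, hq, rfl, ?_⟩, self_mem_reachSet⟩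
        have hne : q.2.2.1 ≠ x q.2.1 := fun e => hvT ((h.mem_sepOf_iff hq).2 e)
        refine lt_of_le_of_ne ?_ hne
        rcases hu with rfl | ⟨p, hp, rfl, hlt⟩
        -- Leaving the region around the source one meets `L`, and the ranks of `L` are at most
        -- those of any state.
        · have hwL := h.reachSet_subset_side ⟨h.bot, .refl _, h.le⟩ self_mem_reachSet hw
          have hqL : q.1 ∈ L := by
            by_contra hn
            exact h.notMem_side (Or.inr ⟨q, hq, rfl⟩) (reachSet_step hwL hwv (by simpa using hn))
          obtain ⟨y, -, hLy, hyr⟩ := h.state L ⟨h.bot, .refl _, h.le⟩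
          obtain ⟨z, hz, hz1, hz2⟩ := hx.1.1 _ (h.col_lt q hq)
          rw [hLy, h.mem_sepOf_iff hq] at hqL
          have := mt (hyr z hz).2 (h.notMem_side (Or.inr ⟨z, hz, rfl⟩))
          rw [hz1] at this
          omega
        -- Within a column the claim follows from a separator of the interval with the same rank
        -- there; between columns it is a constraint.
        · by_cases hcol : p.2.1 = q.2.1
          · obtain ⟨Y, y, hY, hYy, hyx, hyr⟩ := hat q hq
            have hpY : p.1 ∈ reachSet G Y s := (hyr p hp).2 (by rw [hcol, hyx, ← hcol]; exact hlt)
            have hwY := h.reachSet_subset_side hY hpY hw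
            by_cases hqY : q.1 ∈ Y
            · rw [hYy, h.mem_sepOf_iff hq] at hqY
              omega
            · have := (hyr q hq).1 (reachSet_step hwY hwv (by simpa using hqY))
              omega
          · exact hx.2 p hp q hq ⟨hcol, Or.inl ⟨w, hw, hwv⟩⟩ hlt
      · exact ⟨u, hu, reachSet_step hw hwv hvV⟩
  have hmin : IsMinSeparator G s t T := by
    refine h.bot.of_card_le hsep ?_
    obtain ⟨y, hy, hLy, -⟩ := h.state L ⟨h.bot, .refl _, h.le⟩
    rw [hLy, h.card_sepOf hy, h.card_sepOf hx.1]
  refine ⟨hmin, reachSet_subset_reachSet fun v hv _ hvT => h.notMem_side (hTV hvT) hv,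
    (hmin.le_iff h.top).2 fun w hw => h.mem_side_or_mem (hTV (by simpa using hw))⟩

theorem inIcc_iff (h : Layout G s t L H D Q m) : InIcc G s t L H T ↔
    ∃ x, IsState Q m (Linked G (occupied D Q)) x ∧ T = sepOf Prod.fst D Q x := by
  constructor
  · intro hT
    obtain ⟨x, hx, hTx, hxr⟩ := h.state T hT
    exact ⟨x, ⟨hx, h.closedUnder hT hTx hxr⟩, hTx⟩
  · rintro ⟨x, hx, rfl⟩
    exact h.inIcc_sepOf hx

end Layout

end layout

end MSR

namespace MSR

open Input

/-! ### Positions in chains -/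

section posList

variable {ch : List (List ℕ)}

theorem exists_first {i : ℕ} (hi : i < ch.length) (hne : ∀ c ∈ ch, 2 ≤ c.length) :
    ∃ q ∈ posList ch, q.2.1 = i ∧ q.2.2.1 = 0 := by
  have h0 : 0 < ch[i].reverse.length := by
    have := hne _ (List.getElem_mem hi)
    rw [List.length_reverse]
    omega
  exact ⟨(ch[i].reverse[0], i, 0, decide (0 + 1 = ch[i].length)),
    mem_posList.2 ⟨_, List.getElem?_eq_getElem hi, List.getElem?_eq_getElem _, rfl⟩, rfl, rfl⟩

/-- At least two places per chain make the last rank positive, which is why every column costs a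
jump. -/
theorem exists_last {i : ℕ} (hi : i < ch.length) (hne : ∀ c ∈ ch, 2 ≤ c.length) :
    ∃ q ∈ posList ch, q.2.1 = i ∧ q.2.2.2 = true ∧ 0 < q.2.2.1 := by
  have h0 := hne _ (List.getElem_mem hi)
  have h1 : ch[i].length - 1 < ch[i].reverse.length := by
    rw [List.length_reverse]
    omega
  exact ⟨(ch[i].reverse[ch[i].length - 1], i, ch[i].length - 1, true),
    mem_posList.2 ⟨_, List.getElem?_eq_getElem hi, List.getElem?_eq_getElem _, by
      symm
      rw [decide_eq_true_eq]
      show ch[i].length - 1 + 1 = _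
      omega⟩, rfl, rfl, by simp only; omega⟩

theorem le_of_isLast {p q : Pos} (hp : p ∈ posList ch) (hq : q ∈ posList ch)
    (hpq : p.2.1 = q.2.1) (hl : q.2.2.2 = true) : p.2.2.1 ≤ q.2.2.1 := by
  obtain ⟨c, hc, hv, -⟩ := mem_posList.1 hp
  obtain ⟨d, hd, hw, hb⟩ := mem_posList.1 hq
  rw [hpq, hd] at hc
  cases hc
  obtain ⟨hlt, -⟩ := List.getElem?_eq_some_iff.1 hv
  rw [hl, eq_comm, decide_eq_true_eq] at hb
  rw [List.length_reverse] at hlt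
  omega

theorem isLast_of_le {p q : Pos} (hp : p ∈ posList ch) (hq : q ∈ posList ch)
    (hpq : p.2.1 = q.2.1) (hl : q.2.2.2 = true) (hle : q.2.2.1 ≤ p.2.2.1) : p.2.2.2 = true := by
  have he := le_antisymm (le_of_isLast hp hq hpq hl) hle
  obtain ⟨c, hc, -, hb⟩ := mem_posList.1 hp
  obtain ⟨d, hd, -, hb'⟩ := mem_posList.1 hq
  rw [hpq, hd] at hc
  cases hc
  rw [hb, he, ← hb', hl]

theorem posList_ext {p q : Pos} (hp : p ∈ posList ch) (hq : q ∈ posList ch)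
    (hpq : p.2.1 = q.2.1) (hr : p.2.2.1 = q.2.2.1) : p = q := by
  obtain ⟨c, hc, hv, hb⟩ := mem_posList.1 hp
  obtain ⟨d, hd, hw, hb'⟩ := mem_posList.1 hq
  rw [hpq, hd] at hc
  cases hc
  rw [hr, hw] at hv
  exact Prod.ext (Option.some.inj hv).symm (Prod.ext hpq (Prod.ext hr (by rw [hb, hb', hr])))

theorem posList_inj (hnd : ch.flatten.Nodup) {p q : Pos} (hp : p ∈ posList ch)
    (hq : q ∈ posList ch) (hpq : p.1 = q.1) : p = q := by
  obtain ⟨c, hc, hv, hb⟩ := mem_posList.1 hp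
  obtain ⟨d, hd, hw, hb'⟩ := mem_posList.1 hq
  obtain ⟨hi, rfl⟩ := List.getElem?_eq_some_iff.1 hc
  obtain ⟨hj, rfl⟩ := List.getElem?_eq_some_iff.1 hd
  obtain ⟨hn1, hn2⟩ := List.nodup_flatten.1 hnd
  have hpw := List.pairwise_iff_getElem.1 hn2
  have m1 : p.1 ∈ ch[p.2.1] := List.mem_reverse.1 (List.mem_of_getElem? hv)
  have m2 : p.1 ∈ ch[q.2.1] := hpq ▸ List.mem_reverse.1 (List.mem_of_getElem? hw)
  have hcol : p.2.1 = q.2.1 := by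
    rcases lt_trichotomy p.2.1 q.2.1 with hij | e | hij
    · exact absurd m2 (hpw _ _ hi hj hij m1)
    · exact e
    · exact absurd m1 (hpw _ _ hj hi hij m2)
  refine posList_ext hp hq hcol ?_
  have hnd' : ch[q.2.1].reverse.Nodup := List.nodup_reverse.2 (hn1 _ (List.getElem_mem hj))
  simp only [hcol] at hv
  rw [hpq] at hv
  obtain ⟨h1, e1⟩ := List.getElem?_eq_some_iff.1 hv
  obtain ⟨h2, e2⟩ := List.getElem?_eq_some_iff.1 hw
  exact (List.Nodup.getElem_inj_iff hnd').1 (e1.trans e2.symm)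

theorem posList_nodup : (posList ch).Nodup := by
  unfold posList
  rw [List.nodup_flatMap]
  constructor
  · intro i _
    unfold posOf
    exact (List.nodup_range).map fun a b hab => by simpa using (Prod.ext_iff.1 (Prod.ext_iff.1
      (Prod.ext_iff.1 hab).2).2).1
  · refine List.nodup_range.imp fun {i j} hij => ?_
    intro p hp hq
    unfold posOf at hp hq
    obtain ⟨a, -, rfl⟩ := List.mem_map.1 hp
    obtain ⟨b, -, hb⟩ := List.mem_map.1 hq
    exact hij (Prod.ext_iff.1 (Prod.ext_iff.1 hb).2).1.symm

end posList

/-- The chains of tokens that move. -/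
def moving (C : List (List ℕ)) : List (List ℕ) := C.filter fun c => decide (2 ≤ c.length)

/-- The places of tokens that do not move. -/
def fixed (C : List (List ℕ)) : Finset ℕ :=
  (C.filter fun c => decide (c.length < 2)).flatten.toFinset

theorem mem_moving {C : List (List ℕ)} {c : List ℕ} :
    c ∈ moving C ↔ c ∈ C ∧ 2 ≤ c.length := by
  simp [moving]

theorem mem_fixed {C : List (List ℕ)} {w : ℕ} :
    w ∈ fixed C ↔ ∃ c ∈ C, c.length < 2 ∧ w ∈ c := by
  simp [fixed, and_assoc]

theorem exists_pos_of_mem {ch : List (List ℕ)} {c : List ℕ} {w : ℕ} (hc : c ∈ ch) (hw : w ∈ c) :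
    ∃ p ∈ posList ch, p.1 = w ∧ ch[p.2.1]? = some c := by
  obtain ⟨i, hi⟩ := List.getElem?_of_mem hc
  obtain ⟨j, hj⟩ := List.getElem?_of_mem (List.mem_reverse.2 hw)
  exact ⟨(w, i, j, decide (j + 1 = c.length)), mem_posList.2 ⟨c, hi, hj, rfl⟩, rfl, hi⟩

theorem mem_of_mem_posList {ch : List (List ℕ)} {p : Pos} (hp : p ∈ posList ch) :
    ∃ c ∈ ch, ch[p.2.1]? = some c ∧ p.1 ∈ c ∧ c.reverse[p.2.2.1]? = some p.1 := by
  obtain ⟨c, hc, hv, -⟩ := mem_posList.1 hp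
  exact ⟨c, List.mem_of_getElem? hc, hc, List.mem_reverse.1 (List.mem_of_getElem? hv), hv⟩

theorem mem_occupied_iff {C : List (List ℕ)} {w : ℕ} :
    w ∈ occupied (fixed C) (posList (moving C)) ↔ w ∈ C.flatten := by
  constructor
  · rintro (hw | ⟨p, hp, rfl⟩)
    · obtain ⟨c, hc, -, hwc⟩ := mem_fixed.1 hw
      exact List.mem_flatten.2 ⟨c, hc, hwc⟩
    · obtain ⟨c, hc, -, hpc, -⟩ := mem_of_mem_posList hp
      exact List.mem_flatten.2 ⟨c, (mem_moving.1 hc).1, hpc⟩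
  · intro hw
    obtain ⟨c, hc, hwc⟩ := List.mem_flatten.1 hw
    by_cases h2 : 2 ≤ c.length
    · obtain ⟨p, hp, e, -⟩ := exists_pos_of_mem (mem_moving.2 ⟨hc, h2⟩) hwc
      exact Or.inr ⟨p, hp, e⟩
    · exact Or.inl (mem_fixed.2 ⟨c, hc, by omega, hwc⟩)

namespace SweepInv

variable {G : SimpleGraph ℕ} {s t : ℕ} {L H : Finset ℕ} {C : List (List ℕ)}

theorem exists_rank (h : SweepInv G s t L H C) {T : Finset ℕ}
    (hT : InIcc G s t L (heads C).toFinset T) {c : List ℕ} (hc : c ∈ C) :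
    ∃ r < c.length, ∀ j v, c.reverse[j]? = some v →
      (v ∈ T ↔ j = r) ∧ (v ∈ reachSet G T s ↔ j < r) := by
  obtain ⟨l₁, x, l₂, rfl, hx, hl₂, hl₁⟩ := h.split T hT c hc
  -- In the reversed chain the past `l₂` comes first, so its length is the index of the occupied
  -- place.
  refine ⟨l₂.length, by simp; omega, fun j v hv => ?_⟩
  have hrev : (l₁ ++ x :: l₂).reverse = l₂.reverse ++ x :: l₁.reverse := by simp
  rw [hrev] at hv
  rcases lt_trichotomy j l₂.length with hj | rfl | hj
  · rw [List.getElem?_append_left (by simpa using hj)] at hv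
    have := hl₂ v (List.mem_reverse.1 (List.mem_of_getElem? hv))
    exact ⟨⟨fun hm => absurd this (hT.1.notMem_side hm), fun e => by omega⟩,
      ⟨fun _ => hj, fun _ => this⟩⟩
  · rw [List.getElem?_append_right (by simp)] at hv
    simp only [List.length_reverse, Nat.sub_self, List.getElem?_cons_zero, Option.some.injEq] at hv
    subst hv
    exact ⟨⟨fun _ => rfl, fun _ => hx⟩, ⟨fun hr => absurd hr (hT.1.notMem_side hx),
      fun hlt => absurd hlt (lt_irrefl _)⟩⟩
  · rw [List.getElem?_append_right (by simpa using hj.le), List.length_reverse,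
      show j - l₂.length = (j - l₂.length - 1) + 1 by omega, List.getElem?_cons_succ] at hv
    obtain ⟨h1, h2⟩ := hl₁ v (List.mem_reverse.1 (List.mem_of_getElem? hv))
    exact ⟨⟨fun hm => absurd hm h1, fun e => by omega⟩, ⟨fun hr => absurd hr h2,
      fun hlt => by omega⟩⟩

/-- A complete history of the tokens gives a layout. -/
theorem layout (h : SweepInv G s t L H C) (hCH : (heads C).toFinset = H)
    (hL : IsMinSeparator G s t L) :
    Layout G s t L H (fixed C) (posList (moving C)) (moving C).length := by
  have hH : IsMinSeparator G s t H := hCH ▸ h.inIcc.1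
  have hle : SideLE G s L H := hCH ▸ h.inIcc.2.1
  have hnd : (moving C).flatten.Nodup :=
    h.nodup.sublist (List.Sublist.flatten (List.filter_sublist))
  refine ⟨⟨fun p hp q hq e => posList_inj hnd hp hq e, fun p hp q hq => posList_ext hp hq, ?_, ?_⟩,
    hL, hH, hle, ?_, ?_⟩
  · intro p hp
    obtain ⟨c, -, hc, -⟩ := mem_of_mem_posList hp
    exact (List.getElem?_eq_some_iff.1 hc).1
  · intro p hp hpD
    obtain ⟨c, hc, -, hpc, -⟩ := mem_of_mem_posList hp
    obtain ⟨d, hd, hd2, hpd⟩ := mem_fixed.1 hpD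
    rw [mem_moving] at hc
    rw [h.eq_of_mem hc.1 hd hpc hpd] at hc
    omega
  · intro p hp
    have := mem_occupied_iff.1 (Or.inr ⟨p, hp, rfl⟩ : p.1 ∈ occupied (fixed C) _)
    exact hCH ▸ h.exists_mem _ this
  · intro T hT
    have hT' : InIcc G s t L (heads C).toFinset T := hCH.symm ▸ hT
    choose! r hr1 hr2 using fun c hc => h.exists_rank hT' (c := c) hc
    have hcol : ∀ p ∈ posList (moving C), ∃ c ∈ C,
        (if p.2.1 < (moving C).length then r ((moving C).getD p.2.1 []) else 0) = r c ∧
        c.reverse[p.2.2.1]? = some p.1 := by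
      intro p hp
      obtain ⟨c, hc, hi, -, hv⟩ := mem_of_mem_posList hp
      obtain ⟨hlt, e⟩ := List.getElem?_eq_some_iff.1 hi
      refine ⟨c, (mem_moving.1 hc).1, ?_, hv⟩
      rw [if_pos hlt, List.getD_eq_getElem _ _ hlt, e]
    refine ⟨fun i => if i < (moving C).length then r ((moving C).getD i []) else 0, ⟨?_, ?_⟩,
      ?_, ?_⟩
    · intro i hi
      have hc : (moving C)[i] ∈ C := (mem_moving.1 (List.getElem_mem hi)).1
      have hlt : r (moving C)[i] < (moving C)[i].reverse.length := by
        rw [List.length_reverse]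
        exact hr1 _ hc
      refine ⟨((moving C)[i].reverse[r (moving C)[i]], i, r (moving C)[i],
        decide (r (moving C)[i] + 1 = (moving C)[i].length)), mem_posList.2 ⟨_,
          List.getElem?_eq_getElem hi, List.getElem?_eq_getElem _, rfl⟩, rfl, ?_⟩
      simp only [if_pos hi]
      rw [List.getD_eq_getElem _ _ hi]
    · intro i hi
      exact if_neg (by omega)
    · ext w
      rw [mem_sepOf]
      constructor
      · intro hw
        have hwC := h.subset T hT' w hw
        rcases mem_occupied_iff.2 hwC with hD | ⟨p, hp, rfl⟩
        · exact Or.inl hD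
        · obtain ⟨c, hc, e, hv⟩ := hcol p hp
          exact Or.inr ⟨p, hp, rfl, by rw [e]; exact ((hr2 c hc _ _ hv).1.1 hw)⟩
      · rintro (hD | ⟨p, hp, rfl, hpr⟩)
        · obtain ⟨c, hc, hc2, hwc⟩ := mem_fixed.1 hD
          obtain ⟨j, hj⟩ := List.getElem?_of_mem (List.mem_reverse.2 hwc)
          have h1 := hr1 c hc
          obtain ⟨h2, -⟩ := List.getElem?_eq_some_iff.1 hj
          rw [List.length_reverse] at h2
          -- The chain has fewer than two places, so both ranks are 0.
          exact (hr2 c hc _ _ hj).1.2 (by omega)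
        · obtain ⟨c, hc, e, hv⟩ := hcol p hp
          exact (hr2 c hc _ _ hv).1.2 (by rw [hpr, e])
    · intro p hp
      obtain ⟨c, hc, e, hv⟩ := hcol p hp
      exact (hr2 c hc _ _ hv).2.trans (by rw [← e])

end SweepInv

/-! ### The states of the bottom and the top -/

section ends

variable {G : SimpleGraph ℕ} {s t : ℕ} {L H D : Finset ℕ} {ch : List (List ℕ)}

namespace Layout

/-- No occupied vertex lies on the source side of `L`, so no first position has been passed. -/
theorem isState_bot (h : Layout G s t L H D (posList ch) ch.length)
    (hne : ∀ c ∈ ch, 2 ≤ c.length) :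
    IsState (posList ch) ch.length (Linked G (occupied D (posList ch))) (fun _ => 0) ∧
      L = sepOf Prod.fst D (posList ch) fun _ => 0 := by
  obtain ⟨x, hx, hLx⟩ := h.inIcc_iff.1 ⟨h.bot, .refl _, h.le⟩
  obtain ⟨y, hy, hLy, hyr⟩ := h.state L ⟨h.bot, .refl _, h.le⟩
  have hxy : x = y := h.eq_of_sepOf_eq hx.1 hy (hLx.symm.trans hLy)
  suffices x = fun _ => 0 from this ▸ ⟨hx, hLx⟩
  funext i
  rcases Nat.lt_or_ge i ch.length with hi | hi
  · obtain ⟨q, hq, rfl, hq0⟩ := exists_first hi hne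
    have := mt (hyr q hq).2 (h.notMem_side (Or.inr ⟨q, hq, rfl⟩))
    rw [hxy]
    omega
  · exact hx.1.2 i hi

/-- Every position lies in `H` or on its source side, so in each column the rank of `H` is the
largest one. -/
theorem exists_state_top (h : Layout G s t L H D (posList ch) ch.length)
    (hne : ∀ c ∈ ch, 2 ≤ c.length) :
    ∃ y, IsState (posList ch) ch.length (Linked G (occupied D (posList ch))) y ∧
      H = sepOf Prod.fst D (posList ch) y ∧
      ∀ p ∈ posList ch, p.2.2.1 = y p.2.1 ↔ p.2.2.2 = true := by
  obtain ⟨x, hx, hHx⟩ := h.inIcc_iff.1 ⟨h.top, h.le, .refl _⟩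
  obtain ⟨y, hy, hHy, hyr⟩ := h.state H ⟨h.top, h.le, .refl _⟩
  have hxy : x = y := h.eq_of_sepOf_eq hx.1 hy (hHx.symm.trans hHy)
  subst hxy
  have hle : ∀ p ∈ posList ch, p.2.2.1 ≤ x p.2.1 := by
    intro p hp
    rcases h.mem_side_or_mem (Or.inr ⟨p, hp, rfl⟩) with h1 | h1
    · exact ((hyr p hp).1 h1).le
    · rw [hHx, h.mem_sepOf_iff hp] at h1
      exact h1.le
  refine ⟨x, hx, hHx, fun p hp => ⟨fun e => ?_, fun hl => ?_⟩⟩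
  · obtain ⟨q, hq, hqp, hql, -⟩ := exists_last (h.col_lt p hp) hne
    have := hle q hq
    rw [hqp, ← e] at this
    exact isLast_of_le hp hq hqp.symm hql this
  · obtain ⟨q, hq, hqp, hqx⟩ := hy.1 _ (h.col_lt p hp)
    have := le_of_isLast hq hp hqp hl
    have := hle p hp
    omega

end Layout

end ends

end MSR

namespace MSR

open Input

/-! ### Removal of implied constraints -/

section trimming

variable {E : Pos → Pos → Prop} {Q : List Pos} {m c : ℕ} {x y : ℕ → ℕ}

/-- No other constraint between the same columns implies the constraint of `p` and `q`. -/
def Undominated (Q : List Pos) (E : Pos → Pos → Prop) (p q : Pos) : Prop :=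
  ∀ p' ∈ Q, ∀ q' ∈ Q, p'.2.1 = p.2.1 → p'.2.2.1 ≤ p.2.2.1 → q'.2.1 = q.2.1 →
    q.2.2.1 ≤ q'.2.2.1 → E p' q' → p'.2.2.1 = p.2.2.1 ∧ q'.2.2.1 = q.2.2.1

/-- The constraints that are not implied in one of the two directions. -/
def Essential (Q : List Pos) (E : Pos → Pos → Prop) (p q : Pos) : Prop :=
  E p q ∧ (Undominated Q E p q ∨ Undominated Q E q p)

theorem Essential.symm (hE : ∀ p q, E p q → E q p) {p q : Pos} (h : Essential Q E p q) :
    Essential Q E q p := ⟨hE _ _ h.1, h.2.symm⟩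

/-- Moving `p` back or `q` forward strengthens a constraint, and it strictly lowers the rank of `p`
plus the distance of the rank of `q` from a common bound `N`. -/
theorem exists_undominated {p q : Pos} (hp : p ∈ Q) (hq : q ∈ Q) (h : E p q) :
    ∃ p' ∈ Q, ∃ q' ∈ Q, p'.2.1 = p.2.1 ∧ p'.2.2.1 ≤ p.2.2.1 ∧ q'.2.1 = q.2.1 ∧
      q.2.2.1 ≤ q'.2.2.1 ∧ E p' q' ∧ Undominated Q E p' q' := by
  obtain ⟨N, hN⟩ : ∃ N, ∀ a ∈ Q, a.2.2.1 ≤ N :=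
    ⟨(Q.toFinset.sup fun a => a.2.2.1), fun a ha =>
      Finset.le_sup (f := fun a : Pos => a.2.2.1) (List.mem_toFinset.2 ha)⟩
  induction hk : p.2.2.1 + (N - q.2.2.1) using Nat.strong_induction_on generalizing p q with
  | _ k ih =>
  by_cases hu : Undominated Q E p q
  · exact ⟨p, hp, q, hq, rfl, le_rfl, rfl, le_rfl, h, hu⟩
  unfold Undominated at hu
  push Not at hu
  obtain ⟨p', hp', q', hq', h1, h2, h3, h4, h5, h6⟩ := hu
  have hNq := hN q' hq'
  obtain ⟨a, ha, b, hb, g1, g2, g3, g4, g5⟩ := ih (p'.2.2.1 + (N - q'.2.2.1)) (by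
    by_cases e : p'.2.2.1 = p.2.2.1
    · have := h6 e
      omega
    · omega) hp' hq' h5 rfl
  exact ⟨a, ha, b, hb, g1.trans h1, g2.trans h2, g3.trans h3, h4.trans g4, g5⟩

/-- Passing `p` means passing the earlier `p'` of an undominated constraint, which forces the other
token to `q'` and thereby at least to `q`. -/
theorem closedUnder_essential_iff : ClosedUnder Q (Essential Q E) x ↔ ClosedUnder Q E x := by
  constructor
  · intro h p hp q hq hpq hlt
    obtain ⟨p', hp', q', hq', h1, h2, h3, h4, h5, h6⟩ := exists_undominated hp hq hpq
    have := h p' hp' q' hq' ⟨h5, Or.inl h6⟩ (by rw [h1]; omega)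
    rw [h3] at this
    exact h4.trans this
  · exact fun h p hp q hq hpq => h p hp q hq hpq.1

theorem isState_essential_iff : IsState Q m (Essential Q E) x ↔ IsState Q m E x :=
  and_congr_right fun _ => closedUnder_essential_iff

theorem stateStep_essential_iff : StateStep Q m (Essential Q E) x y ↔ StateStep Q m E x y := by
  simp only [StateStep, isState_essential_iff]

end trimming

/-! ### Removal of positions without constraints -/

section rounding

variable {F : Pos → Pos → Prop} {Q K : List Pos} {m c : ℕ} {x y : ℕ → ℕ}

/-- Every token moves on to the next position in `K`. -/
noncomputable def roundUp (K : List Pos) (x : ℕ → ℕ) (i : ℕ) : ℕ :=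
  sInf {r | x i ≤ r ∧ ∃ p ∈ K, p.2.1 = i ∧ p.2.2.1 = r}

theorem roundUp_le {p : Pos} (hp : p ∈ K) (h : x p.2.1 ≤ p.2.2.1) :
    roundUp K x p.2.1 ≤ p.2.2.1 := Nat.sInf_le ⟨h, p, hp, rfl, rfl⟩

theorem roundUp_mem {p : Pos} (hp : p ∈ K) (h : x p.2.1 ≤ p.2.2.1) :
    x p.2.1 ≤ roundUp K x p.2.1 ∧ ∃ q ∈ K, q.2.1 = p.2.1 ∧ q.2.2.1 = roundUp K x p.2.1 :=
  Nat.sInf_mem (s := {r | x p.2.1 ≤ r ∧ ∃ q ∈ K, q.2.1 = p.2.1 ∧ q.2.2.1 = r})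
    ⟨_, h, p, hp, rfl, rfl⟩

theorem roundUp_eq_self (hx : Valid K m x) (hK : ∀ p ∈ K, p.2.1 < m) : roundUp K x = x := by
  funext i
  rcases Nat.lt_or_ge i m with hi | hi
  · obtain ⟨p, hp, rfl, h⟩ := hx.1 i hi
    exact le_antisymm (h ▸ roundUp_le hp h.ge) (roundUp_mem hp h.ge).1
  · rw [hx.2 i hi, roundUp]
    -- Outside of the columns the infimum is over the empty set, and its value 0 is the one required
    -- by `Valid`.
    have : {r | x i ≤ r ∧ ∃ p ∈ K, p.2.1 = i ∧ p.2.2.1 = r} = ∅ := by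
      ext r
      simp only [Set.mem_ofPred_eq, Set.mem_empty_iff_false, iff_false]
      rintro ⟨-, p, hp, rfl, -⟩
      have := hK p hp
      omega
    rw [this, Nat.sInf_empty]

/-- The positions `K` include the last positions of all columns. -/
theorem isState_roundUp (hKQ : ∀ p ∈ K, p ∈ Q) (hK : ∀ p ∈ K, p.2.1 < m)
    (hlast : ∀ p ∈ Q, ∃ q ∈ K, q.2.1 = p.2.1 ∧ p.2.2.1 ≤ q.2.2.1) (hx : IsState Q m F x) :
    IsState K m F (roundUp K x) := by
  have hex : ∀ i < m, ∃ q ∈ K, q.2.1 = i ∧ x i ≤ q.2.2.1 := by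
    intro i hi
    obtain ⟨p, hp, rfl, h⟩ := hx.1.1 i hi
    obtain ⟨q, hq, h1, h2⟩ := hlast p hp
    exact ⟨q, hq, h1, h ▸ h2⟩
  refine ⟨⟨fun i hi => ?_, fun i hi => ?_⟩, fun p hp q hq hpq hlt => ?_⟩
  · obtain ⟨q, hq, rfl, h⟩ := hex i hi
    exact (roundUp_mem hq h).2
  · rw [roundUp]
    have : {r | x i ≤ r ∧ ∃ p ∈ K, p.2.1 = i ∧ p.2.2.1 = r} = ∅ := by
      ext r
      simp only [Set.mem_ofPred_eq, Set.mem_empty_iff_false, iff_false]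
      rintro ⟨-, p, hp, rfl, -⟩
      have := hK p hp
      omega
    rw [this, Nat.sInf_empty]
  -- A kept position passed by the rounded token was passed before rounding, since otherwise
  -- rounding would have stopped there.
  · have h1 : p.2.2.1 < x p.2.1 := by
      by_contra hge
      have := roundUp_le hp (not_lt.1 hge)
      omega
    have h2 := hx.2 p (hKQ p hp) q (hKQ q hq) hpq h1
    obtain ⟨z, hz, hzq, h⟩ := hex _ (hK q hq)
    rw [← hzq] at h h2 ⊢
    exact h2.trans (roundUp_mem hz h).1

theorem IsState.of_subset (hKQ : ∀ p ∈ K, p ∈ Q)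
    (hF : ∀ p ∈ Q, ∀ q ∈ Q, F p q → p ∈ K ∧ q ∈ K) (hx : IsState K m F x) : IsState Q m F x := by
  refine ⟨⟨fun i hi => ?_, hx.1.2⟩, fun p hp q hq hpq => ?_⟩
  · obtain ⟨p, hp, h⟩ := hx.1.1 i hi
    exact ⟨p, hKQ p hp, h⟩
  · obtain ⟨h1, h2⟩ := hF p hp q hq hpq
    exact hx.2 p h1 q h2 hpq

/-- Only the positions in `K` are relevant. -/
theorem exists_steps_iff (hKQ : ∀ p ∈ K, p ∈ Q) (hK : ∀ p ∈ K, p.2.1 < m)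
    (hlast : ∀ p ∈ Q, ∃ q ∈ K, q.2.1 = p.2.1 ∧ p.2.2.1 ≤ q.2.2.1)
    (hF : ∀ p ∈ Q, ∀ q ∈ Q, F p q → p ∈ K ∧ q ∈ K) (hx : Valid K m x) (hy : Valid K m y) :
    (∃ r ≤ c, Steps (StateStep Q m F) r x y) ↔ ∃ r ≤ c, Steps (StateStep K m F) r x y := by
  constructor
  · rintro ⟨r, hr, h⟩
    -- Rounding acts on each column separately, so a step becomes a step in the same column or
    -- disappears.
    obtain ⟨k, hk, h'⟩ := h.exists_map (R' := StateStep K m F) (roundUp K) fun a b hab => by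
      by_cases he : roundUp K a = roundUp K b
      · exact Or.inl he
      obtain ⟨h1, h2, i, -, hi⟩ := hab
      refine Or.inr ⟨isState_roundUp hKQ hK hlast h1, isState_roundUp hKQ hK hlast h2, i, ?_, ?_⟩
      · intro hne
        refine he (funext fun j => ?_)
        by_cases hj : j = i
        · rw [hj, hne]
        · rw [roundUp, roundUp, hi j hj]
      · intro j hj
        rw [roundUp, roundUp, hi j hj]
    rw [roundUp_eq_self hx hK, roundUp_eq_self hy hK] at h'
    exact ⟨k, hk.trans hr, h'⟩
  · rintro ⟨r, hr, h⟩
    exact ⟨r, hr, h.mono fun a b ⟨h1, h2, h3⟩ => ⟨h1.of_subset hKQ hF, h2.of_subset hKQ hF, h3⟩⟩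

end rounding

/-! ### Quadratic bounds on essential positions and pairs -/

section counting

variable {E : Pos → Pos → Prop} {Q : List Pos} {m c : ℕ} {x y : ℕ → ℕ}

/-- Every column that changes needs a step. -/
theorem card_ne_le_of_steps (h : Steps (StateStep Q m E) c x y) :
    ((Finset.range m).filter fun i => x i ≠ y i).card ≤ c := by
  induction h with
  | refl => simp
  | @snoc n a b d h hr ih =>
    obtain ⟨-, -, i, -, hi⟩ := hr
    have hsub : ((Finset.range m).filter fun j => a j ≠ d j) ⊆
        insert i ((Finset.range m).filter fun j => a j ≠ b j) := by
      intro j hj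
      rw [Finset.mem_filter] at hj
      by_cases hji : j = i
      · simp [hji]
      · refine Finset.mem_insert_of_mem (Finset.mem_filter.2 ⟨hj.1, ?_⟩)
        rw [hi j hji]
        exact hj.2
    exact (Finset.card_le_card hsub).trans ((Finset.card_insert_le _ _).trans (by omega))

open Classical in
/-- The endpoints of essential constraints of a position. -/
noncomputable def essentialAt (Q : List Pos) (E : Pos → Pos → Prop) (p : Pos) : Finset Pos :=
  Q.toFinset.filter fun q => Essential Q E p q

theorem mem_essentialAt {p q : Pos} : q ∈ essentialAt Q E p ↔ q ∈ Q ∧ Essential Q E p q := by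
  simp [essentialAt]

/-- Fix another column and one of the two directions in which the pair is undominated. Of two
partners of `p` there, one would dominate the other. This leaves two partners for each of the `m -
1` other columns. -/
theorem card_essentialAt_le (hext : ∀ p ∈ Q, ∀ q ∈ Q, p.2.1 = q.2.1 → p.2.2.1 = q.2.2.1 → p = q)
    (hlt : ∀ p ∈ Q, p.2.1 < m) (hE : ∀ p q, E p q → E q p) (hcol : ∀ p q, E p q → p.2.1 ≠ q.2.1)
    {p : Pos} (hp : p ∈ Q) : (essentialAt Q E p).card ≤ 2 * (m - 1) := by
  classical
  have hc : (((Finset.range m).erase p.2.1) ×ˢ (Finset.univ : Finset Bool)).card = 2 * (m - 1) := by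
    rw [Finset.card_product, Finset.card_erase_of_mem (by simpa using hlt p hp)]
    simp [mul_comm]
  rw [← hc]
  refine Finset.card_le_card_of_injOn (fun q => (q.2.1, decide (Undominated Q E p q))) ?_ ?_
  · intro q hq
    obtain ⟨hq, hpq⟩ := mem_essentialAt.1 (by simpa using hq)
    exact Finset.mem_coe.2 (Finset.mem_product.2 ⟨Finset.mem_erase.2 ⟨(hcol _ _ hpq.1).symm,
      Finset.mem_range.2 (hlt q hq)⟩, Finset.mem_univ _⟩)
  · intro q hq q' hq' he
    obtain ⟨hq, hpq⟩ := mem_essentialAt.1 (by simpa using hq)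
    obtain ⟨hq', hpq'⟩ := mem_essentialAt.1 (by simpa using hq')
    obtain ⟨h1, h2⟩ := Prod.ext_iff.1 he
    simp only [decide_eq_decide] at h1 h2
    refine hext q hq q' hq' h1 ?_
    by_cases hu : Undominated Q E p q
    · have hu' := h2.1 hu
      rcases le_total q.2.2.1 q'.2.2.1 with hle | hle
      · exact (hu p hp q' hq' rfl le_rfl h1.symm hle hpq'.1).2.symm
      · exact (hu' p hp q hq rfl le_rfl h1 hle hpq.1).2
    · have hv := hpq.2.resolve_left hu
      have hv' := hpq'.2.resolve_left fun h => hu (h2.2 h)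
      rcases le_total q.2.2.1 q'.2.2.1 with hle | hle
      · exact (hv' q hq p hp h1 hle rfl le_rfl (hE _ _ hpq.1)).1
      · exact (hv q' hq' p hp h1.symm hle rfl le_rfl (hE _ _ hpq'.1)).1.symm

/-- Few positions meet all essential constraints. -/
theorem exists_cover (hext : ∀ p ∈ Q, ∀ q ∈ Q, p.2.1 = q.2.1 → p.2.2.1 = q.2.2.1 → p = q)
    (hlt : ∀ p ∈ Q, p.2.1 < m) (hE : ∀ p q, E p q → E q p) (hcol : ∀ p q, E p q → p.2.1 ≠ q.2.1)
    (h : Steps (StateStep Q m E) c x y) (hx0 : ∀ i, x i = 0)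
    (hyt : ∀ p ∈ Q, p.2.2.1 ≤ y p.2.1) :
    ∃ X : Finset Pos, (∀ p ∈ X, p ∈ Q) ∧ X.card ≤ m + c ∧
      (∀ p ∈ Q, p.2.2.1 = x p.2.1 → p ∈ X) ∧ (∀ p ∈ Q, p.2.2.1 = y p.2.1 → p ∈ X) ∧
      ∀ p ∈ Q, ∀ q ∈ Q, E p q → p ∈ X ∨ q ∈ X := by
  obtain ⟨f, h0, hc, hf⟩ := Steps.iff_seq.1 h
  -- The cover consists of all positions occupied at some time: `m` at the start and at most one
  -- more for each step.
  set Z : ℕ → Finset Pos := fun j => Q.toFinset.filter fun p => p.2.2.1 = f j p.2.1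
  have hZ : ∀ j p, p ∈ Z j ↔ p ∈ Q ∧ p.2.2.1 = f j p.2.1 := fun j p => by simp [Z]
  have hn : ∀ j < c, Near (Z j) (Z (j + 1)) := by
    intro j hj
    obtain ⟨h1, h2, i, hi, hij⟩ := hf j hj
    have him : i < m := by
      by_contra hge
      exact hi (by rw [h1.1.2 i (by omega), h2.1.2 i (by omega)])
    obtain ⟨u, hu, hui, hur⟩ := h2.1.1 i him
    refine ⟨u, fun p hp => ?_⟩
    rw [hZ] at hp
    by_cases hpi : p.2.1 = i
    · rw [hext p hp.1 u hu (hpi.trans hui.symm) (by rw [hp.2, hur, hpi])]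
      exact Finset.mem_insert_self _ _
    · exact Finset.mem_insert_of_mem ((hZ _ _).2 ⟨hp.1, by rw [hp.2, hij _ hpi]⟩)
  have hmem : ∀ j ≤ c, ∀ p ∈ Q, p.2.2.1 = f j p.2.1 → p ∈ (Finset.range (c + 1)).biUnion Z :=
    fun j hj p hp e => Finset.mem_biUnion.2 ⟨j, by simp; omega, (hZ _ _).2 ⟨hp, e⟩⟩
  refine ⟨(Finset.range (c + 1)).biUnion Z, ?_, ?_, ?_, ?_, ?_⟩
  · intro p hp
    obtain ⟨j, -, hj⟩ := Finset.mem_biUnion.1 hp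
    exact ((hZ _ _).1 hj).1
  · have h1 := card_biUnion_le_of_near hn
    have h2 : (Z 0).card ≤ (Finset.range m).card := by
      refine Finset.card_le_card_of_injOn (fun p => p.2.1) ?_ ?_
      · intro p hp
        have := (hZ _ _).1 (by simpa using hp)
        simpa using hlt p this.1
      · intro p hp q hq e
        obtain ⟨hp1, hp2⟩ := (hZ _ _).1 (by simpa using hp)
        obtain ⟨hq1, hq2⟩ := (hZ _ _).1 (by simpa using hq)
        simp only at e
        exact hext p hp1 q hq1 e (by rw [hp2, hq2, e])
    rw [Finset.card_range] at h2
    omega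
  · intro p hp e
    exact hmem 0 (Nat.zero_le _) p hp (by rw [h0, e])
  · intro p hp e
    exact hmem c le_rfl p hp (by rw [hc, e])
  · intro p hp q hq hpq
    by_contra! hn
    obtain ⟨hpX, hqX⟩ := hn
    have hpj : ∀ j ≤ c, p.2.2.1 ≠ f j p.2.1 := fun j hj e => hpX (hmem j hj p hp e)
    -- A column whose token starts below `p`, ends above it and never occupies it must leap over `p`
    -- in a single step.
    have hstep : ∃ j < c, f j p.2.1 < p.2.2.1 ∧ p.2.2.1 < f (j + 1) p.2.1 := by
      by_contra! hno
      have key : ∀ j ≤ c, f j p.2.1 < p.2.2.1 := by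
        intro j
        induction j with
        | zero =>
          intro hj
          have := hpj 0 hj
          rw [h0, hx0] at this ⊢
          omega
        | succ j ih =>
          intro hj
          have h1 := hno j (by omega) (ih (by omega))
          have := hpj (j + 1) hj
          omega
      have h1 := key c le_rfl
      have h2 := hyt p hp
      rw [hc] at h1
      omega
    obtain ⟨j, hj, hj1, hj2⟩ := hstep
    obtain ⟨h1, h2, i, hi, hij⟩ := hf j hj
    have hpi : p.2.1 = i := by
      by_contra hne
      have := hij _ hne
      omega
    have hqi := hij q.2.1 fun e => hcol _ _ hpq (hpi.trans e.symm)
    -- After the leap the constraint puts the other token at or beyond `q`; before it, the symmetric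
    -- constraint keeps it from passing `q`. That token did not move, so it occupies `q`.
    have a1 := h2.2 p hp q hq hpq hj2
    have a2 : ¬ q.2.2.1 < f j q.2.1 := fun hq' => by
      have := h1.2 q hq p hp (hE _ _ hpq) hq'
      omega
    exact hqX (hmem j hj.le q hq (by omega))

/-- Few positions and few pairs of positions are essential. -/
theorem essential_bounds
    (hext : ∀ p ∈ Q, ∀ q ∈ Q, p.2.1 = q.2.1 → p.2.2.1 = q.2.2.1 → p = q)
    (hlt : ∀ p ∈ Q, p.2.1 < m) (hE : ∀ p q, E p q → E q p) (hcol : ∀ p q, E p q → p.2.1 ≠ q.2.1)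
    (h : Steps (StateStep Q m E) c x y) (hx0 : ∀ i, x i = 0)
    (hyt : ∀ p ∈ Q, p.2.2.1 ≤ y p.2.1) :
    (∀ K : Finset Pos, (∀ p ∈ K, p ∈ Q ∧ (p.2.2.1 = x p.2.1 ∨ p.2.2.1 = y p.2.1 ∨
      ∃ q ∈ Q, Essential Q E p q)) → K.card ≤ (m + c) * (2 * (m - 1) + 1)) ∧
    ∀ K : Finset (Pos × Pos), (∀ a ∈ K, a.1 ∈ Q ∧ a.2 ∈ Q ∧ Essential Q E a.1 a.2) →
      K.card ≤ 2 * ((m + c) * (2 * (m - 1))) := by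
  obtain ⟨X, hXQ, hXc, hXx, hXy, hXE⟩ := exists_cover hext hlt hE hcol h hx0 hyt
  have hbi : (X.biUnion (essentialAt Q E)).card ≤ (m + c) * (2 * (m - 1)) :=
    (Finset.card_biUnion_le_card_mul _ _ _ fun p hp =>
      card_essentialAt_le hext hlt hE hcol (hXQ p hp)).trans (Nat.mul_le_mul_right _ hXc)
  constructor
  · intro K hK
    -- An essential constraint has an end in `X`, so a position outside `X` is an essential partner
    -- of one in `X`.
    have hsub : K ⊆ X ∪ X.biUnion (essentialAt Q E) := by
      intro p hp
      obtain ⟨hpQ, h1 | h1 | ⟨q, hq, hpq⟩⟩ := hK p hp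
      · exact Finset.mem_union_left _ (hXx p hpQ h1)
      · exact Finset.mem_union_left _ (hXy p hpQ h1)
      · rcases hXE p hpQ q hq hpq.1 with h1 | h1
        · exact Finset.mem_union_left _ h1
        · exact Finset.mem_union_right _ (Finset.mem_biUnion.2 ⟨q, h1,
            mem_essentialAt.2 ⟨hpQ, hpq.symm hE⟩⟩)
    refine ((Finset.card_le_card hsub).trans (Finset.card_union_le _ _)).trans ?_
    rw [mul_add, mul_one]
    omega
  · intro K hK
    set P := X.sigma (essentialAt Q E)
    have hP : P.card ≤ (m + c) * (2 * (m - 1)) := by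
      rw [Finset.card_sigma]
      refine (Finset.sum_le_card_nsmul _ _ _ fun p hp =>
        card_essentialAt_le hext hlt hE hcol (hXQ p hp)).trans ?_
      rw [smul_eq_mul]
      exact Nat.mul_le_mul_right _ hXc
    -- The pairs are ordered and either component may be the one in `X`, hence the factor 2.
    have hsub : K ⊆ P.image (fun a => (a.1, a.2)) ∪ P.image fun a => (a.2, a.1) := by
      intro a ha
      obtain ⟨h1, h2, h3⟩ := hK a ha
      rcases hXE _ h1 _ h2 h3.1 with h4 | h4
      · exact Finset.mem_union_left _ (Finset.mem_image.2 ⟨⟨a.1, a.2⟩,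
          Finset.mem_sigma.2 ⟨h4, mem_essentialAt.2 ⟨h2, h3⟩⟩, rfl⟩)
      · exact Finset.mem_union_right _ (Finset.mem_image.2 ⟨⟨a.2, a.1⟩,
          Finset.mem_sigma.2 ⟨h4, mem_essentialAt.2 ⟨h1, h3.symm hE⟩⟩, rfl⟩)
    have h1 := (Finset.card_le_card hsub).trans (Finset.card_union_le _ _)
    have h2 := P.card_image_le (f := fun a => ((a.1, a.2) : Pos × Pos))
    have h3 := P.card_image_le (f := fun a => ((a.2, a.1) : Pos × Pos))
    omega

end counting

end MSR

namespace MSR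

open Input

/-! ### Graphs made of columns and their minimum separators -/

section kernel

variable {Γ : SimpleGraph ℕ} {vx : Pos → ℕ} {K : List Pos} {m : ℕ} {F : Pos → Pos → Prop}

/-- Consecutive positions of a column. -/
def Consec (K : List Pos) (p q : Pos) : Prop :=
  p.2.1 = q.2.1 ∧ p.2.2.1 < q.2.2.1 ∧
    ∀ r ∈ K, r.2.1 = p.2.1 → p.2.2.1 < r.2.2.1 → ¬ r.2.2.1 < q.2.2.1

/-- A graph of columns from `0` to `1` with further edges `F` between the columns. -/
structure ColumnGraph (Γ : SimpleGraph ℕ) (vx : Pos → ℕ) (K : List Pos) (m : ℕ)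
    (F : Pos → Pos → Prop) : Prop extends Grid vx ∅ K m where
  two_le : ∀ p ∈ K, 2 ≤ vx p
  eq_of_adj : ∀ u v, Γ.Adj u v → u = 0 ∨ u = 1 ∨ ∃ p ∈ K, vx p = u
  not_adj : ¬ Γ.Adj 0 1
  adj_zero : ∀ p ∈ K, Γ.Adj 0 (vx p) ↔ p.2.2.1 = 0
  adj_one : ∀ p ∈ K, Γ.Adj (vx p) 1 ↔ p.2.2.2 = true
  adj_iff : ∀ p ∈ K, ∀ q ∈ K, Γ.Adj (vx p) (vx q) ↔ F p q ∨ Consec K p q ∨ Consec K q p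
  exists_first : ∀ i < m, ∃ p ∈ K, p.2.1 = i ∧ p.2.2.1 = 0
  exists_last : ∀ i < m, ∃ p ∈ K, p.2.1 = i ∧ p.2.2.2 = true
  le_last : ∀ p ∈ K, ∀ q ∈ K, p.2.1 = q.2.1 → q.2.2.2 = true → p.2.2.1 ≤ q.2.2.1

namespace ColumnGraph

theorem exists_pred (h : ColumnGraph Γ vx K m F) {p : Pos} (hp : p ∈ K) (h0 : p.2.2.1 ≠ 0) :
    ∃ q ∈ K, Consec K q p := by
  obtain ⟨a, ha, hap, ha0⟩ := h.exists_first _ (h.col_lt p hp)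
  obtain ⟨q, hq, hmax⟩ := Finset.exists_max_image
    (K.toFinset.filter fun q => q.2.1 = p.2.1 ∧ q.2.2.1 < p.2.2.1) (fun q => q.2.2.1)
    ⟨a, by simpa using ⟨ha, hap, by omega⟩⟩
  simp only [Finset.mem_filter, List.mem_toFinset] at hq hmax
  refine ⟨q, hq.1, hq.2.1, hq.2.2, fun r hr hrq hlt hlt' => ?_⟩
  have := hmax r ⟨hr, hrq.trans hq.2.1, hlt'⟩
  omega

theorem exists_succ (h : ColumnGraph Γ vx K m F) {p : Pos} (hp : p ∈ K) (hl : p.2.2.2 ≠ true) :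
    ∃ q ∈ K, Consec K p q := by
  obtain ⟨a, ha, hap, hal⟩ := h.exists_last _ (h.col_lt p hp)
  have hle := h.le_last p hp a ha hap.symm hal
  have hne : p.2.2.1 ≠ a.2.2.1 := fun e => hl (h.ext p hp a ha hap.symm e ▸ hal)
  obtain ⟨q, hq, hmin⟩ := Finset.exists_min_image
    (K.toFinset.filter fun q => q.2.1 = p.2.1 ∧ p.2.2.1 < q.2.2.1) (fun q => q.2.2.1)
    ⟨a, by simpa using ⟨ha, hap, by omega⟩⟩
  simp only [Finset.mem_filter, List.mem_toFinset] at hq hmin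
  refine ⟨q, hq.1, hq.2.1.symm, hq.2.2, fun r hr hrp hlt hlt' => ?_⟩
  have := hmin r ⟨hr, hrp, hlt⟩
  omega

/-- A column is reachable up to the first vertex that is removed. -/
theorem mem_reachSet_of_lt (h : ColumnGraph Γ vx K m F) {S : Set ℕ} {i k : ℕ}
    (hS : ∀ p ∈ K, p.2.1 = i → p.2.2.1 < k → vx p ∉ S) {p : Pos} (hp : p ∈ K) (hpi : p.2.1 = i)
    (hpk : p.2.2.1 < k) : vx p ∈ reachSet Γ S 0 := by
  induction hr : p.2.2.1 using Nat.strong_induction_on generalizing p with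
  | _ r ih =>
  by_cases h0 : p.2.2.1 = 0
  · exact reachSet_step self_mem_reachSet ((h.adj_zero p hp).2 h0) (hS p hp hpi hpk)
  · obtain ⟨q, hq, hqp⟩ := h.exists_pred hp h0
    have hlt := hqp.2.1
    exact reachSet_step (ih q.2.2.1 (hr ▸ hlt) hq (hqp.1.trans hpi) (by omega) rfl)
      ((h.adj_iff q hq p hp).2 (Or.inr (Or.inl hqp))) (hS p hp hpi hpk)

/-- From the positions behind the last vertex that is removed one reaches the target. -/
theorem one_mem_reachSet (h : ColumnGraph Γ vx K m F) {S : Set ℕ} {i k : ℕ} (h1 : 1 ∉ S)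
    (hS : ∀ p ∈ K, p.2.1 = i → k < p.2.2.1 → vx p ∉ S) {p : Pos} (hp : p ∈ K) (hpi : p.2.1 = i)
    (hpk : k ≤ p.2.2.1) (hpr : vx p ∈ reachSet Γ S 0) : 1 ∈ reachSet Γ S 0 := by
  obtain ⟨a, ha, hap, hal⟩ := h.exists_last _ (h.col_lt p hp)
  induction hr : a.2.2.1 - p.2.2.1 using Nat.strong_induction_on generalizing p with
  | _ r ih =>
  by_cases hl : p.2.2.2 = true
  · exact reachSet_step hpr ((h.adj_one p hp).2 hl) h1
  · obtain ⟨q, hq, hpq⟩ := h.exists_succ hp hl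
    have hlt := hpq.2.1
    have hqi : q.2.1 = i := hpq.1.symm.trans hpi
    have hle := h.le_last q hq a ha (hpq.1.symm.trans hap.symm) hal
    exact ih (a.2.2.1 - q.2.2.1) (by omega) hq hqi (by omega) (reachSet_step hpr
      ((h.adj_iff p hp q hq).2 (Or.inr (Or.inl hpq))) (hS q hq hqi (by omega)))
      (hap.trans hpq.1) rfl

/-- Separators meet all columns. -/
theorem exists_mem_of_isSeparator (h : ColumnGraph Γ vx K m F) {S : Finset ℕ}
    (hS : IsSeparator Γ 0 1 S) {i : ℕ} (hi : i < m) : ∃ p ∈ K, p.2.1 = i ∧ vx p ∈ S := by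
  by_contra! hn
  obtain ⟨-, h1, h2⟩ := isSeparator_iff.1 hS
  obtain ⟨a, ha, hai, hal⟩ := h.exists_last i hi
  have := h.mem_reachSet_of_lt (S := S) (i := i) (k := a.2.2.1 + 1)
    (fun p hp hpi _ => by simpa using hn p hp hpi) ha hai (by omega)
  exact h2 (reachSet_step this ((h.adj_one a ha).2 hal) (by simpa using h1))

/-- The columns are `m` disjoint paths from source to target, the easy direction of Menger's
theorem. -/
theorem le_card_of_isSeparator (h : ColumnGraph Γ vx K m F) {S : Finset ℕ}
    (hS : IsSeparator Γ 0 1 S) : m ≤ S.card := by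
  choose! g hg using fun i (hi : i < m) => h.exists_mem_of_isSeparator hS hi
  rw [← Finset.card_range m]
  refine Finset.card_le_card_of_injOn (fun i => vx (g i)) (fun i hi => ?_) fun i hi j hj e => ?_
  · exact (hg i (by simpa using hi)).2.2
  · obtain ⟨h1, h2, -⟩ := hg i (by simpa using hi)
    obtain ⟨h3, h4, -⟩ := hg j (by simpa using hj)
    rw [← h2, h.inj _ h1 _ h3 e, h4]

/-- The source and the passed positions form a region; closedness is what keeps the edges between
columns from leaving it, and the size `m` is optimal. -/
theorem isMinSeparator_sepOf (h : ColumnGraph Γ vx K m F) {y : ℕ → ℕ} (hy : IsState K m F y) :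
    IsMinSeparator Γ 0 1 (sepOf vx ∅ K y) := by
  have hge : ∀ w ∈ sepOf vx ∅ K y, 2 ≤ w := by
    intro w hw
    rcases mem_sepOf.1 hw with hw | ⟨p, hp, rfl, -⟩
    · simp at hw
    · exact h.two_le p hp
  refine ⟨isSeparator_of_region (U := {w | w = 0 ∨ ∃ p ∈ K, vx p = w ∧ p.2.2.1 < y p.2.1})
    (fun hm => by simpa using hge 0 hm) (fun hm => by simpa using hge 1 hm) (Or.inl rfl) ?_ ?_,
    fun T hT => by simpa [h.card_sepOf hy.1] using h.le_card_of_isSeparator hT⟩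
  · rintro (h1 | ⟨p, hp, h1, -⟩)
    · simp at h1
    · have := h.two_le p hp
      omega
  · rintro u hu v huv hv
    rcases h.eq_of_adj v u huv.symm with rfl | rfl | ⟨q, hq, rfl⟩
    · exact Or.inl rfl
    · rcases hu with rfl | ⟨p, hp, rfl, hlt⟩
      · exact absurd huv h.not_adj
      · have hl := (h.adj_one p hp).1 huv
        obtain ⟨z, hz, hzp, hzy⟩ := hy.1.1 _ (h.col_lt p hp)
        have := h.le_last z hz p hp hzp hl
        omega
    · refine Or.inr ⟨q, hq, rfl, lt_of_le_of_ne ?_ fun e => hv ((h.mem_sepOf_iff hq).2 e)⟩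
      rcases hu with rfl | ⟨p, hp, rfl, hlt⟩
      · rw [(h.adj_zero q hq).1 huv]
        exact Nat.zero_le _
      · rcases (h.adj_iff p hp q hq).1 huv with hF | hc | hc
        · exact hy.2 p hp q hq hF hlt
        · obtain ⟨z, hz, hzp, hzy⟩ := hy.1.1 _ (h.col_lt p hp)
          have := hc.2.2 z hz hzp (by omega)
          rw [← hc.1]
          omega
        · have := hc.2.1
          rw [hc.1]
          omega

theorem isState_zero (h : ColumnGraph Γ vx K m F) : IsState K m F fun _ => 0 :=
  ⟨⟨h.exists_first, fun _ _ => rfl⟩, fun _ _ _ _ _ hlt => absurd hlt (Nat.not_lt_zero _)⟩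

/-- A minimum separator has size `m`, hence exactly one vertex in each column. A violated constraint
would open a path that follows one column, crosses the edge of the constraint and continues behind
the token of the other column. -/
theorem isMinSeparator_iff (h : ColumnGraph Γ vx K m F) {T : Finset ℕ} :
    IsMinSeparator Γ 0 1 T ↔ ∃ y, IsState K m F y ∧ T = sepOf vx ∅ K y := by
  constructor
  · intro hT
    have hc : T.card = m := by
      rw [hT.card_eq (h.isMinSeparator_sepOf h.isState_zero), h.card_sepOf h.isState_zero.1]
      simp
    choose! g hg using fun i (hi : i < m) => h.exists_mem_of_isSeparator hT.1 hi
    set y : ℕ → ℕ := fun i => if i < m then (g i).2.2.1 else 0 with hydef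
    have hy : Valid K m y := by
      refine ⟨fun i hi => ⟨g i, (hg i hi).1, (hg i hi).2.1, ?_⟩, fun i hi => ?_⟩
      · simp [hydef, hi]
      · simp only [hydef, if_neg (not_lt.2 hi)]
    have hTy : sepOf vx ∅ K y = T := by
      refine Finset.eq_of_subset_of_card_le (fun w hw => ?_) ?_
      · rcases mem_sepOf.1 hw with hw | ⟨p, hp, rfl, hpy⟩
        · simp at hw
        · have hlt := h.col_lt p hp
          obtain ⟨h1, h2, h3⟩ := hg _ hlt
          simp only [hydef, if_pos hlt] at hpy
          rwa [h.ext p hp _ h1 h2.symm hpy]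
      · rw [h.card_sepOf hy, hc]
        simp
    refine ⟨y, ⟨hy, fun p hp q hq hF hlt => ?_⟩, hTy.symm⟩
    by_contra hgt
    have hS : ∀ a ∈ K, a.2.2.1 ≠ y a.2.1 → vx a ∉ (T : Set ℕ) := by
      intro a ha hne hm
      rw [Finset.mem_coe, ← hTy, h.mem_sepOf_iff ha] at hm
      exact hne hm
    have hpr := h.mem_reachSet_of_lt (S := T) (i := p.2.1) (k := y p.2.1)
      (fun a ha hai hlt => hS a ha (by rw [hai]; omega)) hp rfl hlt
    have hqr := reachSet_step hpr ((h.adj_iff p hp q hq).2 (Or.inl hF)) (hS q hq (by omega))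
    exact hT.tgt_notMem_side (h.one_mem_reachSet (S := T) (i := q.2.1) (k := y q.2.1)
      (by simpa using hT.tgt_notMem) (fun a ha hai hlt => hS a ha (by rw [hai]; omega)) hq rfl
      (by omega) hqr)
  · rintro ⟨y, hy, rfl⟩
    exact h.isMinSeparator_sepOf hy

theorem minJump_steps_iff (h : ColumnGraph Γ vx K m F) {c : ℕ} {x y : ℕ → ℕ} (hx : IsState K m F x)
    (hy : IsState K m F y) :
    Steps (MinJump Γ 0 1) c (sepOf vx ∅ K x) (sepOf vx ∅ K y) ↔ Steps (StateStep K m F) c x y :=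
  h.steps_iff (fun _ => h.isMinSeparator_iff) hx hy

end ColumnGraph

end kernel

end MSR

/-! ### Correctness of the computed separators, searches and histories -/

namespace MSR

open Input

/-- The input describes a graph with source, target and two minimum separators. -/
structure Represents (x : Input) (G : SimpleGraph ℕ) (A B : Finset ℕ) : Prop where
  adj_iff : ∀ u v, adj x u v = true ↔ G.Adj u v
  adj_lt : ∀ u v, G.Adj u v → v < x.n
  src_lt : x.src < x.n
  mem_setA : ∀ v, v ∈ setA x ↔ v ∈ A
  mem_setB : ∀ v, v ∈ setB x ↔ v ∈ B
  minA : IsMinSeparator G x.src x.tgt A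
  minB : IsMinSeparator G x.src x.tgt B

namespace Represents

variable {x : Input} {G : SimpleGraph ℕ} {A B : Finset ℕ}

theorem mem_reachStep (h : Represents x G A B) {D R : List ℕ} {v : ℕ} :
    v ∈ reachStep x D R ↔ v < x.n ∧ (v ∈ R ∨ (v ∉ D ∧ ∃ u ∈ R, G.Adj u v)) := by
  simp [reachStep, h.adj_iff]

theorem lt_of_mem_reachSet (h : Represents x G A B) {D : Set ℕ} {a v : ℕ} (ha : a < x.n)
    (hv : v ∈ reachSet G D a) : v < x.n :=
  reachSet_subset (U := {v | v < x.n}) ha (fun u _ v huv _ => h.adj_lt u v huv) hv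

theorem mem_reach (h : Represents x G A B) {D : List ℕ} {a v : ℕ} (ha : a < x.n) :
    v ∈ reach x D a ↔ v ∈ reachSet G {w | w ∈ D} a := by
  set R : ℕ → List ℕ := fun k => (reachStep x D)^[k] [a] with hR
  have hsucc : ∀ k, R (k + 1) = reachStep x D (R k) := fun k => by
    rw [hR]
    exact Function.iterate_succ_apply' _ _ _
  have hsub : ∀ k, ∀ v ∈ R k, v ∈ reachSet G {w | w ∈ D} a := by
    intro k
    induction k with
    | zero =>
      intro v hv
      rw [show v = a by simpa [hR] using hv]
      exact self_mem_reachSet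
    | succ k ih =>
      intro v hv
      rw [hsucc, h.mem_reachStep] at hv
      rcases hv.2 with h1 | ⟨h1, u, hu, huv⟩
      · exact ih v h1
      · exact reachSet_step (ih u hu) huv h1
  have hlt : ∀ k, ∀ v ∈ R k, v < x.n := fun k v hv => h.lt_of_mem_reachSet ha (hsub k v hv)
  have hmono : ∀ k, ∀ v ∈ R k, v ∈ R (k + 1) := fun k v hv => by
    rw [hsucc, h.mem_reachStep]
    exact ⟨hlt k v hv, Or.inl hv⟩
  -- Each round adds a vertex unless the search is already stable, so `x.n` rounds suffice.
  have hgrow : ∀ k, (∀ v ∈ R (k + 1), v ∈ R k) ∨ k + 1 ≤ (R k).toFinset.card := by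
    intro k
    induction k with
    | zero => exact Or.inr (by simp [hR])
    | succ k ih =>
      by_cases hst : ∀ v ∈ R (k + 1), v ∈ R k
      · left
        intro v hv
        rw [hsucc, h.mem_reachStep] at hv
        rcases hv.2 with h1 | ⟨h1, u, hu, huv⟩
        · exact h1
        · rw [hsucc, h.mem_reachStep]
          exact ⟨hv.1, Or.inr ⟨h1, u, hst u hu, huv⟩⟩
      · right
        have h1 := ih.resolve_left hst
        push Not at hst
        obtain ⟨v, hv, hv'⟩ := hst
        have : (R k).toFinset.card < (R (k + 1)).toFinset.card :=
          Finset.card_lt_card (Finset.ssubset_iff_subset_ne.2 ⟨fun w hw => by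
            simpa using hmono k w (by simpa using hw), fun e => hv' (by
              rw [← List.mem_toFinset, e, List.mem_toFinset]
              exact hv)⟩)
        omega
  have hclosed : ∀ v ∈ R (x.n + 1), v ∈ R x.n := by
    refine (hgrow x.n).resolve_right fun hc => ?_
    have := Finset.card_le_card (show (R x.n).toFinset ⊆ Finset.range x.n from fun w hw => by
      simpa using hlt x.n w (by simpa using hw))
    rw [Finset.card_range] at this
    omega
  have haR : a ∈ R x.n := by
    have : ∀ k, a ∈ R k := fun k => by
      induction k with
      | zero => simp [hR]
      | succ k ih => exact hmono k a ih
    exact this _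
  refine ⟨hsub x.n v, fun hv => reachSet_subset (U := {w | w ∈ R x.n}) haR
    (fun u hu w huw hw => hclosed w ?_) hv⟩
  rw [hsucc, h.mem_reachStep]
  exact ⟨h.adj_lt u w huw, Or.inr ⟨hw, u, hu, huw⟩⟩

theorem mem_side (h : Represents x G A B) {S : List ℕ} {T : Finset ℕ} (hST : S.toFinset = T)
    {v : ℕ} : v ∈ side x S ↔ v ∈ reachSet G T x.src := by
  rw [side, h.mem_reach h.src_lt]
  have : {w | w ∈ S} = (T : Set ℕ) := by
    ext w
    rw [← hST]
    simp
  rw [this]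

theorem toFinset_setA (h : Represents x G A B) : (setA x).toFinset = A := by
  ext v
  rw [List.mem_toFinset, h.mem_setA]

theorem toFinset_setB (h : Represents x G A B) : (setB x).toFinset = B := by
  ext v
  rw [List.mem_toFinset, h.mem_setB]

theorem lt_of_mem (h : Represents x G A B) {S : Finset ℕ} (hS : IsMinSeparator G x.src x.tgt S)
    {v : ℕ} (hv : v ∈ S) : v < x.n := by
  obtain ⟨u, -, huv⟩ := hS.exists_adj hv
  exact h.adj_lt u v huv

theorem toFinset_lo (h : Represents x G A B) : (lo x).toFinset = meet G x.src A B := by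
  ext w
  simp only [lo, List.mem_toFinset, List.mem_filter, List.mem_range, h.mem_setA, h.mem_setB,
    h.mem_side h.toFinset_setA, h.mem_side h.toFinset_setB, Bool.or_eq_true, Bool.and_eq_true,
    decide_eq_true_eq, mem_meet]
  constructor
  · rintro ⟨-, h1⟩
    tauto
  · intro h1
    exact ⟨h1.1.elim (h.lt_of_mem h.minA) (h.lt_of_mem h.minB), by tauto⟩

theorem toFinset_hi (h : Represents x G A B) : (hi x).toFinset = join G x.src A B := by
  ext w
  simp only [hi, List.mem_toFinset, List.mem_filter, List.mem_range, h.mem_setA, h.mem_setB,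
    h.mem_side h.toFinset_setA, h.mem_side h.toFinset_setB, Bool.or_eq_true, Bool.and_eq_true,
    Bool.not_eq_true', Bool.or_eq_false_iff, decide_eq_true_eq, decide_eq_false_iff_not, mem_join]
  constructor
  · rintro ⟨-, h1⟩
    exact h1
  · intro h1
    exact ⟨h1.1.elim (h.lt_of_mem h.minA) (h.lt_of_mem h.minB), h1⟩

theorem advances_iff (h : Represents x G A B) {S : List ℕ} {u v : ℕ}
    (hS : IsMinSeparator G x.src x.tgt S.toFinset) (hv : v ∈ S) :
    advances x S v u = true ↔ u ∉ S.toFinset ∧ u ≠ x.src ∧ u ≠ x.tgt ∧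
      IsSeparator G x.src x.tgt (insert u (S.toFinset.erase v)) ∧
      v ∈ reachSet G (insert u (S.toFinset.erase v) : Finset ℕ) x.src := by
  simp only [advances, Bool.and_eq_true, Bool.not_eq_true', decide_eq_true_eq,
    decide_eq_false_iff_not, h.mem_side (toFinset_swap hv), List.mem_toFinset, isSeparator_iff,
    Finset.mem_insert, Finset.mem_erase, not_or]
  have h1 := hS.src_notMem
  have h2 := hS.tgt_notMem
  rw [List.mem_toFinset] at h1 h2
  constructor
  · rintro ⟨⟨⟨⟨a, b⟩, c⟩, d⟩, e⟩
    exact ⟨a, b, c, ⟨⟨Ne.symm b, fun hm => h1 hm.2⟩, ⟨Ne.symm c, fun hm => h2 hm.2⟩, d⟩, e⟩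
  · rintro ⟨a, b, c, ⟨-, -, d⟩, e⟩
    exact ⟨⟨⟨⟨a, b⟩, c⟩, d⟩, e⟩

/-- A swap preserves the size, so separating already means being minimum. For the comparison with
the join only the new vertex has to be tested, by the criterion `le_iff`. -/
theorem mem_moves_iff (h : Represents x G A B) {S : List ℕ} {u v : ℕ}
    (hS : IsMinSeparator G x.src x.tgt S.toFinset)
    (hle : SideLE G x.src S.toFinset (join G x.src A B)) :
    (v, u) ∈ moves x S ↔ v ∈ S ∧ u ∉ S.toFinset ∧
      IsMinSeparator G x.src x.tgt (insert u (S.toFinset.erase v)) ∧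
      v ∈ reachSet G (insert u (S.toFinset.erase v) : Finset ℕ) x.src ∧
      SideLE G x.src (insert u (S.toFinset.erase v)) (join G x.src A B) ∧
      ∀ q, q ∉ S.toFinset → q ≠ x.src → q ≠ x.tgt →
        IsSeparator G x.src x.tgt (insert q (S.toFinset.erase v)) →
        v ∈ reachSet G (insert q (S.toFinset.erase v) : Finset ℕ) x.src →
        q ∉ reachSet G (insert u (S.toFinset.erase v) : Finset ℕ) x.src := by
  have hJ := h.minA.join h.minB
  have e : (v, u) ∈ moves x S ↔ v ∈ S ∧ u < x.n ∧ advancesMin x S v u = true := by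
    simp [moves]
  rw [e]
  refine and_congr_right fun hv => ?_
  have hvF := List.mem_toFinset.2 hv
  simp only [advancesMin, Bool.and_eq_true, Bool.or_eq_true, decide_eq_true_eq,
    List.all_eq_true, List.mem_range, Bool.not_eq_true', Bool.and_eq_false_iff,
    decide_eq_false_iff_not, h.mem_side h.toFinset_hi, h.mem_side (toFinset_swap hv),
    h.advances_iff hS hv]
  rw [← List.mem_toFinset, h.toFinset_hi]
  constructor
  · rintro ⟨-, ⟨⟨h1, h2, h3, h4, h5⟩, h6⟩, h7⟩
    have hm : IsMinSeparator G x.src x.tgt (insert u (S.toFinset.erase v)) := hS.of_card_le h4 (by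
      rw [Finset.card_insert_of_notMem (by simpa using fun _ => by simpa using h1),
        Finset.card_erase_of_mem hvF]
      have := Finset.card_pos.2 ⟨v, hvF⟩
      omega)
    refine ⟨h1, hm, h5, (hm.le_iff hJ).2 fun w hw => ?_, fun q g1 g2 g3 g4 g5 g6 => ?_⟩
    · rcases Finset.mem_insert.1 hw with rfl | hw
      · exact h6.symm
      · exact (hS.le_iff hJ).1 hle w (Finset.mem_of_mem_erase hw)
    · rcases h7 q (h.lt_of_mem_reachSet h.src_lt g6) with h8 | h8
      · rw [Bool.eq_false_iff, Ne, h.advances_iff hS hv] at h8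
        exact h8 ⟨g1, g2, g3, g4, g5⟩
      · exact h8 g6
  · rintro ⟨h1, hm, h5, h6, h7⟩
    have hu := Finset.mem_insert_self u (S.toFinset.erase v)
    refine ⟨h.lt_of_mem hm hu, ⟨⟨h1, fun e => hm.src_notMem (e ▸ hu), fun e =>
      hm.tgt_notMem (e ▸ hu), hm.1, h5⟩, ((hm.le_iff hJ).1 h6 u hu).symm⟩, fun q _ => ?_⟩
    by_cases hq : advances x S v q = true
    · obtain ⟨g1, g2, g3, g4, g5⟩ := (h.advances_iff hS hv).1 hq
      exact Or.inr (h7 q g1 g2 g3 g4 g5)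
    · exact Or.inl (by simpa using hq)

/-- The histories computed by the algorithm. -/
theorem sweepInv_iterate (h : Represents x G A B) (k : ℕ) :
    SweepInv G x.src x.tgt (meet G x.src A B) (join G x.src A B)
      ((sweepStep x)^[k] ((lo x).map fun a => [a])) := by
  induction k with
  | zero =>
    exact sweepInv_init (h.minA.meet h.minB) (IsMinSeparator.meet_le_left.1.trans
      IsMinSeparator.le_join_left) (List.nodup_range.filter _) h.toFinset_lo
  | succ k ih =>
    rw [Function.iterate_succ_apply']
    generalize (sweepStep x)^[k] ((lo x).map fun a => [a]) = C at ih
    unfold sweepStep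
    split_ifs with hm
    · exact ih
    · have hmem := moves_headD_mem hm
      generalize (moves x (heads C)).headD (0, 0) = p at hmem
      obtain ⟨v, u⟩ := p
      rw [h.mem_moves_iff ih.inIcc.1 ih.inIcc.2.2] at hmem
      obtain ⟨h1, h2, h3, h4, h5, h6⟩ := hmem
      exact ih.push h1 h2 h3.1 h4 h5 h6

theorem lt_of_mem_sweep (h : Represents x G A B) {k v : ℕ}
    (hv : v ∈ ((sweepStep x)^[k] ((lo x).map fun a => [a])).flatten) : v < x.n := by
  obtain ⟨Y, hY, hvY⟩ := (h.sweepInv_iterate k).exists_mem v hv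
  exact h.lt_of_mem hY.1 hvY

/-- If the tokens can be moved to the join of the separators then the algorithm does it. -/
theorem heads_sweep (h : Represents x G A B) {c : ℕ}
    (hst : Steps (JumpIn G x.src x.tgt (meet G x.src A B) (join G x.src A B)) c
      (meet G x.src A B) (join G x.src A B)) :
    (heads (sweep x)).toFinset = join G x.src A B := by
  -- Until the join is reached, every round records a further vertex.
  have key : ∀ k, (heads ((sweepStep x)^[k] ((lo x).map fun a => [a]))).toFinset =
      join G x.src A B ∨
      k ≤ ((sweepStep x)^[k] ((lo x).map fun a => [a])).flatten.length := by
    intro k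
    induction k with
    | zero => exact Or.inr (Nat.zero_le _)
    | succ k ih =>
      have hinv := h.sweepInv_iterate k
      rw [Function.iterate_succ_apply']
      generalize (sweepStep x)^[k] ((lo x).map fun a => [a]) = C at ih hinv
      unfold sweepStep
      split_ifs with hm
      · left
        by_contra hne
        obtain ⟨v, hv, u, hu, hsep, hside, hle⟩ := exists_advance hst (h.minA.meet h.minB)
          (h.minA.join h.minB) hinv.inIcc hne
        obtain ⟨u, -, h1, h2, h3, h4, h5⟩ := exists_min_advance h.adj_lt hinv.inIcc.1 hv hu hsep
          hside hle
        have := (h.mem_moves_iff hinv.inIcc.1 hinv.inIcc.2.2).2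
          ⟨List.mem_toFinset.1 hv, h1, h2, h3, h4, h5⟩
        rw [List.isEmpty_iff.1 hm] at this
        simp at this
      · right
        have hmem := moves_headD_mem hm
        generalize (moves x (heads C)).headD (0, 0) = p at hmem
        obtain ⟨v, u⟩ := p
        rw [h.mem_moves_iff hinv.inIcc.1 hinv.inIcc.2.2] at hmem
        obtain ⟨h1, h2, h3, h4, h5, h6⟩ := hmem
        -- The tokens had not arrived yet: a strict advance from the join could not stay below the
        -- join.
        have hk : k ≤ C.flatten.length := by
          refine ih.resolve_left fun e => h2 ?_
          have := h3.eq_of_le_of_le (h.minA.join h.minB) h5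
            (e ▸ (hinv.inIcc.1.le_iff h3).2 fun w hw => by
              by_cases hwv : w = v
              · exact Or.inl (hwv ▸ h4)
              · exact Or.inr (Finset.mem_insert_of_mem (Finset.mem_erase.2 ⟨hwv, hw⟩)))
          rw [e, ← this]
          exact Finset.mem_insert_self _ _
        obtain ⟨c, hc, hcv⟩ := List.mem_map.1 h1
        have hlt : ∀ C : List (List ℕ), (∃ c ∈ C, c.headD 0 = v) →
            C.flatten.length < (push C (v, u)).flatten.length := by
          intro C
          have hle : ∀ C : List (List ℕ), C.flatten.length ≤ (push C (v, u)).flatten.length := by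
            intro C
            induction C with
            | nil => exact le_rfl
            | cons a l ih =>
              simp only [push, List.map_cons, List.flatten_cons, List.length_append] at ih ⊢
              split_ifs
              · rw [List.length_cons]
                omega
              · omega
          induction C with
          | nil => simp
          | cons a l ih =>
            intro hex
            have hl := hle l
            simp only [push, List.map_cons, List.flatten_cons, List.length_append] at ih hl ⊢
            by_cases hav : a.headD 0 = v
            · rw [if_pos (decide_eq_true hav), List.length_cons]
              omega
            · obtain ⟨c, hc, hcv⟩ := hex
              have := ih ⟨c, (List.mem_cons.1 hc).resolve_left fun e => hav (e ▸ hcv), hcv⟩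
              split_ifs
              · rw [List.length_cons]
                omega
              · omega
        have := hlt C ⟨c, hc, hcv⟩
        omega
  -- The recorded vertices are distinct and smaller than `x.n`, so `x.n + 1` rounds cannot all
  -- record one.
  refine (key (x.n + 1)).resolve_right fun hlen => ?_
  have hnd := (h.sweepInv_iterate (x.n + 1)).nodup
  have h1 := List.toFinset_card_of_nodup hnd
  have h2 := Finset.card_le_card (show
    ((sweepStep x)^[x.n + 1] ((lo x).map fun a => [a])).flatten.toFinset ⊆ Finset.range x.n from
    fun v hv => by simpa using h.lt_of_mem_sweep (List.mem_toFinset.1 hv))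
  rw [Finset.card_range] at h2
  omega

end Represents

end MSR

namespace MSR

open Input

/-! ### The graph of the kernel -/

namespace Input

variable {x : Input}

/-- An entry of a matrix. -/
def entry (M : List (List Bool)) (i j : ℕ) : Bool := (M.getD i []).getD j false

theorem essential_symm (x : Input) (p q : Pos) : essential x p q = essential x q p := by
  unfold essential linked
  rw [Bool.or_comm (undominated x p q), Bool.or_comm (torso x p q),
    show decide (p.2.1 = q.2.1) = decide (q.2.1 = p.2.1) from decide_eq_decide.2 eq_comm]

theorem keepAdj_symm (x : Input) (p q : Pos) : keepAdj x p q = keepAdj x q p := by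
  unfold keepAdj
  rw [essential_symm, Bool.or_comm (consec x p q)]

theorem keepAdj_self (x : Input) (p : Pos) : keepAdj x p p = false := by
  simp [keepAdj, essential, linked, consec]

theorem entry_zero (l : ℕ) :
    entry (kernelMatrix x) 0 (l + 2) = ((keep x)[l]?.map isFirst).getD false := by
  simp [entry, kernelMatrix, firsts]

theorem entry_one (l : ℕ) :
    entry (kernelMatrix x) 1 (l + 2) = ((keep x)[l]?.map isLast).getD false := by
  simp [entry, kernelMatrix, lasts]

theorem entry_add_two (k j : ℕ) : entry (kernelMatrix x) (k + 2) j =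
    ((keep x)[k]?.map fun p => (row x p).getD j false).getD false := by
  show (((keep x).map fun p => row x p).getD k []).getD j false = _
  rw [List.getD_eq_getElem?_getD (l := (keep x).map fun p => row x p), List.getElem?_map]
  cases (keep x)[k]? <;> rfl

theorem entry_add_two_zero (k : ℕ) :
    entry (kernelMatrix x) (k + 2) 0 = ((keep x)[k]?.map isFirst).getD false :=
  entry_add_two k 0

theorem entry_add_two_one (k : ℕ) :
    entry (kernelMatrix x) (k + 2) 1 = ((keep x)[k]?.map isLast).getD false :=
  entry_add_two k 1

theorem entry_add_two_add_two (k l : ℕ) : entry (kernelMatrix x) (k + 2) (l + 2) =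
    ((keep x)[k]?.bind fun p => (keep x)[l]?.map fun q => keepAdj x p q).getD false := by
  rw [entry_add_two]
  cases (keep x)[k]? with
  | none => rfl
  | some p =>
    show ((keep x).map fun q => keepAdj x p q).getD l false = _
    rw [List.getD_eq_getElem?_getD, List.getElem?_map]
    rfl

theorem entry_symm (i j : ℕ) : entry (kernelMatrix x) i j = entry (kernelMatrix x) j i := by
  rcases i with _ | _ | k <;> rcases j with _ | _ | l
  · rfl
  · rfl
  · rw [entry_zero, entry_add_two_zero]
  · rfl
  · rfl
  · rw [entry_one, entry_add_two_one]
  · rw [entry_zero, entry_add_two_zero]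
  · rw [entry_one, entry_add_two_one]
  · rw [entry_add_two_add_two, entry_add_two_add_two]
    cases (keep x)[k]? with
    | none => cases (keep x)[l]? <;> rfl
    | some p =>
      cases (keep x)[l]? with
      | none => rfl
      | some q => simp [keepAdj_symm x p q]

theorem entry_self (i : ℕ) : entry (kernelMatrix x) i i = false := by
  rcases i with _ | _ | k
  · rfl
  · rfl
  · rw [entry_add_two_add_two]
    cases (keep x)[k]? <;> simp [keepAdj_self]

/-- The kernel as a graph on the natural numbers. -/
def kernelGraph (x : Input) : SimpleGraph ℕ where
  Adj i j := entry (kernelMatrix x) i j = true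
  symm := ⟨fun i j h => by rwa [entry_symm]⟩
  loopless := ⟨fun i h => by simp [entry_self] at h⟩

/-- The number of a kept position. -/
def vertex (x : Input) (p : Pos) : ℕ := (keep x).idxOf p + 2

theorem getElem?_idxOf_keep {p : Pos} (hp : p ∈ keep x) :
    (keep x)[(keep x).idxOf p]? = some p := List.getElem?_idxOf hp

theorem exists_vertex {i : ℕ} (hi : i < (keep x).length + 2) (hnd : (keep x).Nodup) :
    i = 0 ∨ i = 1 ∨ ∃ p ∈ keep x, vertex x p = i := by
  rcases i with _ | _ | k
  · exact Or.inl rfl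
  · exact Or.inr (Or.inl rfl)
  · have hk : k < (keep x).length := by omega
    exact Or.inr (Or.inr ⟨(keep x)[k], List.getElem_mem hk, by
      rw [vertex, List.Nodup.idxOf_getElem hnd]⟩)

theorem lt_of_entry {i j : ℕ} (h : entry (kernelMatrix x) i j = true) :
    i < (keep x).length + 2 := by
  by_contra hi
  have : (kernelMatrix x).length ≤ i := by
    simp only [kernelMatrix, List.length_cons, List.length_map]
    omega
  rw [entry, List.getD_eq_default _ _ this] at h
  simp at h

end Input

namespace Represents

variable {x : Input} {G : SimpleGraph ℕ} {A B : Finset ℕ}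

/-- The visited places. -/
abbrev places (x : Input) : Set ℕ := occupied (fixed (sweep x)) (positions x)

theorem mem_places {w : ℕ} : w ∈ places x ↔ w ∈ visited x := mem_occupied_iff

theorem lt_of_mem_positions (h : Represents x G A B) {p : Pos} (hp : p ∈ positions x) :
    p.1 < x.n :=
  h.lt_of_mem_sweep (k := x.n + 1) (mem_places.1 (Or.inr ⟨p, hp, rfl⟩))

theorem torso_iff (h : Represents x G A B) {p q : Pos} (hp : p ∈ positions x) :
    torso x p q = true ↔ ∃ w ∈ reachSet G (places x) p.1, G.Adj w q.1 := by
  have : {w | w ∈ visited x} = places x := Set.ext fun w => mem_places.symm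
  simp [torso, h.mem_reach (h.lt_of_mem_positions hp), h.adj_iff, this]

theorem linked_iff (h : Represents x G A B) {p q : Pos} (hp : p ∈ positions x)
    (hq : q ∈ positions x) : linked x p q = true ↔ Linked G (places x) p q := by
  simp only [linked, Bool.and_eq_true, Bool.or_eq_true, h.torso_iff hp, h.torso_iff hq,
    Bool.not_eq_true', decide_eq_false_iff_not, Linked, ne_eq]

theorem undominated_iff (h : Represents x G A B) {p q : Pos} :
    undominated x p q = true ↔ Undominated (positions x) (Linked G (places x)) p q := by
  simp only [undominated, Undominated, List.all_eq_true, Bool.or_eq_true, Bool.not_eq_true',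
    Bool.and_eq_true, decide_eq_true_eq, implied, Bool.and_eq_false_iff, decide_eq_false_iff_not]
  refine forall₂_congr fun p' hp' => forall₂_congr fun q' hq' => ?_
  rw [← h.linked_iff hp' hq', Bool.eq_false_iff]
  tauto

theorem essential_iff (h : Represents x G A B) {p q : Pos} (hp : p ∈ positions x)
    (hq : q ∈ positions x) :
    essential x p q = true ↔ Essential (positions x) (Linked G (places x)) p q := by
  simp only [essential, Bool.and_eq_true, Bool.or_eq_true, h.linked_iff hp hq, h.undominated_iff,
    Essential]

theorem mem_keep (h : Represents x G A B) {p : Pos} : p ∈ keep x ↔ p ∈ positions x ∧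
    (p.2.2.1 = 0 ∨ p.2.2.2 = true ∨
      ∃ q ∈ positions x, Essential (positions x) (Linked G (places x)) p q) := by
  simp only [keep, List.mem_filter, Bool.or_eq_true, isFirst, isLast, decide_eq_true_eq,
    List.any_eq_true, or_assoc]
  refine and_congr_right fun hp => or_congr_right (or_congr_right ?_)
  exact exists_congr fun q => and_congr_right fun hq => h.essential_iff hp hq

theorem keep_nodup : (keep x).Nodup := posList_nodup.filter _

theorem consec_iff {p q : Pos} : consec x p q = true ↔ Consec (keep x) p q := by
  simp only [consec, Consec, Bool.and_eq_true, decide_eq_true_eq, List.all_eq_true,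
    Bool.not_eq_true', Bool.and_eq_false_iff, decide_eq_false_iff_not, and_assoc]
  refine and_congr_right fun _ => and_congr_right fun _ => forall₂_congr fun r _ => ?_
  tauto

theorem two_le_of_mem_chains {c : List ℕ} (hc : c ∈ chains x) : 2 ≤ c.length :=
  (mem_moving.1 hc).2

theorem linked_symm {U : Set ℕ} (p q : Pos) (hpq : Linked G U p q) : Linked G U q p :=
  ⟨hpq.1.symm, hpq.2.symm⟩

theorem layout (h : Represents x G A B)
    (hC : (heads (sweep x)).toFinset = join G x.src A B) :
    Layout G x.src x.tgt (meet G x.src A B) (join G x.src A B) (fixed (sweep x)) (positions x)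
      (chains x).length :=
  (h.sweepInv_iterate (x.n + 1)).layout hC (h.minA.meet h.minB)

/-- Keeping the first and last position of every chain makes each column a full path from 0 to 1;
the offset 2 in `vertex` reserves these two numbers. -/
theorem columnGraph (h : Represents x G A B)
    (hC : (heads (sweep x)).toFinset = join G x.src A B) :
    ColumnGraph (kernelGraph x) (vertex x) (keep x) (chains x).length
      (Essential (positions x) (Linked G (places x))) := by
  have hlay := h.layout hC
  have hKQ : ∀ p ∈ keep x, p ∈ positions x := fun p hp => (h.mem_keep.1 hp).1
  refine ⟨⟨?_, fun p hp q hq => hlay.ext p (hKQ p hp) q (hKQ q hq),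
    fun p hp => hlay.col_lt p (hKQ p hp), by simp⟩, ?_, ?_, ?_, ?_, ?_, ?_, ?_, ?_, ?_⟩
  · intro p hp q hq e
    have e' : (keep x).idxOf p = (keep x).idxOf q := by
      unfold vertex at e
      omega
    have := getElem?_idxOf_keep hp
    rw [e', getElem?_idxOf_keep hq] at this
    exact (Option.some.inj this).symm
  · exact fun p _ => Nat.le_add_left _ _
  · intro u v huv
    exact exists_vertex (lt_of_entry huv) keep_nodup
  · intro h01
    exact absurd (show entry (kernelMatrix x) 0 1 = true from h01) Bool.false_ne_true
  · intro p hp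
    show entry (kernelMatrix x) 0 (vertex x p) = true ↔ _
    rw [vertex, entry_zero, getElem?_idxOf_keep hp]
    simp [isFirst]
  · intro p hp
    show entry (kernelMatrix x) (vertex x p) 1 = true ↔ _
    rw [vertex, entry_add_two_one, getElem?_idxOf_keep hp]
    simp [isLast]
  · intro p hp q hq
    show entry (kernelMatrix x) (vertex x p) (vertex x q) = true ↔ _
    rw [vertex, vertex, entry_add_two_add_two, getElem?_idxOf_keep hp, getElem?_idxOf_keep hq]
    simp [keepAdj, h.essential_iff (hKQ p hp) (hKQ q hq), consec_iff]
  · intro i hi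
    obtain ⟨p, hp, h1, h2⟩ := exists_first hi fun c hc => two_le_of_mem_chains hc
    exact ⟨p, h.mem_keep.2 ⟨hp, Or.inl h2⟩, h1, h2⟩
  · intro i hi
    obtain ⟨p, hp, h1, h2, -⟩ := exists_last hi fun c hc => two_le_of_mem_chains hc
    exact ⟨p, h.mem_keep.2 ⟨hp, Or.inr (Or.inl h2)⟩, h1, h2⟩
  · exact fun p hp q hq => le_of_isLast (hKQ p hp) (hKQ q hq)

/-- The kernel is equivalent to the original problem. -/
theorem exists_steps_kernel_iff (h : Represents x G A B)
    (hC : (heads (sweep x)).toFinset = join G x.src A B) (S T : Finset ℕ)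
    (hS : ∀ w, w ∈ S ↔ ∃ p ∈ keep x, vertex x p = w ∧ p.2.2.1 = 0)
    (hT : ∀ w, w ∈ T ↔ ∃ p ∈ keep x, vertex x p = w ∧ p.2.2.2 = true) :
    IsMinSeparator (kernelGraph x) 0 1 S ∧ IsMinSeparator (kernelGraph x) 0 1 T ∧
    ∀ ℓ, (∃ r ≤ ℓ, Steps (MinJump G x.src x.tgt) r A B) ↔
      ∃ r ≤ ℓ, Steps (MinJump (kernelGraph x) 0 1) r S T := by
  have hlay := h.layout hC
  have hne : ∀ c ∈ chains x, 2 ≤ c.length := fun c hc => two_le_of_mem_chains hc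
  have hcol := h.columnGraph hC
  have hKQ : ∀ p ∈ keep x, p ∈ positions x := fun p hp => (h.mem_keep.1 hp).1
  have hbot : IsState (positions x) (chains x).length (Linked G (places x)) (fun _ => 0) ∧
      meet G x.src A B = sepOf Prod.fst (fixed (sweep x)) (positions x) fun _ => 0 :=
    hlay.isState_bot hne
  obtain ⟨y, hy, hyH, hyl⟩ : ∃ y, IsState (positions x) (chains x).length
      (Linked G (places x)) y ∧ join G x.src A B = sepOf Prod.fst (fixed (sweep x)) (positions x) y ∧
      ∀ p ∈ positions x, p.2.2.1 = y p.2.1 ↔ p.2.2.2 = true := hlay.exists_state_top hne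
  have hlast : ∀ p ∈ positions x, ∃ q ∈ keep x, q.2.1 = p.2.1 ∧ p.2.2.1 ≤ q.2.2.1 := by
    intro p hp
    obtain ⟨q, hq, h1, h2⟩ := hcol.exists_last _ (hlay.col_lt p hp)
    exact ⟨q, hq, h1, le_of_isLast hp (hKQ q hq) h1.symm h2⟩
  have hF : ∀ p ∈ positions x, ∀ q ∈ positions x,
      Essential (positions x) (Linked G (places x)) p q → p ∈ keep x ∧ q ∈ keep x :=
    fun p hp q hq hpq => ⟨h.mem_keep.2 ⟨hp, Or.inr (Or.inr ⟨q, hq, hpq⟩)⟩,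
      h.mem_keep.2 ⟨hq, Or.inr (Or.inr ⟨p, hp, hpq.symm linked_symm⟩)⟩⟩
  have hyK : Valid (keep x) (chains x).length y := by
    refine ⟨fun i hi => ?_, hy.1.2⟩
    obtain ⟨q, hq, rfl, h2⟩ := hcol.exists_last i hi
    exact ⟨q, hq, rfl, (hyl q (hKQ q hq)).2 h2⟩
  have h0K := hcol.isState_zero
  have hyS : IsState (keep x) (chains x).length
      (Essential (positions x) (Linked G (places x))) y :=
    ⟨hyK, fun p hp q hq hpq hlt => hy.2 p (hKQ p hp) q (hKQ q hq) hpq.1 hlt⟩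
  have hSe : sepOf (vertex x) ∅ (keep x) (fun _ => 0) = S := by
    ext w
    rw [hS, mem_sepOf]
    simp
  have hTe : sepOf (vertex x) ∅ (keep x) y = T := by
    ext w
    rw [hT, mem_sepOf]
    simp only [Finset.notMem_empty, false_or]
    exact exists_congr fun p => and_congr_right fun hp => and_congr_right fun _ =>
      hyl p (hKQ p hp)
  refine ⟨hSe ▸ hcol.isMinSeparator_sepOf h0K, hTe ▸ hcol.isMinSeparator_sepOf hyS, fun ℓ => ?_⟩
  -- Jumps between the given separators are traded for jumps from their meet to their join.
  have e1 : (∃ r ≤ ℓ, Steps (MinJump G x.src x.tgt) r A B) ↔ ∃ r ≤ ℓ,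
      Steps (JumpIn G x.src x.tgt (meet G x.src A B) (join G x.src A B)) r (meet G x.src A B)
        (join G x.src A B) := by
    constructor
    · rintro ⟨r, hr, hst⟩
      obtain ⟨c, hc, hst'⟩ := exists_steps_meet_join h.minA h.minB hst
      exact ⟨c, hc.trans hr, hst'⟩
    · rintro ⟨r, hr, hst⟩
      obtain ⟨c, hc, hst'⟩ := exists_steps_of_meet_join h.minA h.minB hst
      exact ⟨c, hc.trans hr, hst'⟩
  -- Jumps in the interval become steps of rank vectors, and essential constraints define the same
  -- states as all constraints.
  have e2 : ∀ r, Steps (JumpIn G x.src x.tgt (meet G x.src A B) (join G x.src A B)) r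
      (meet G x.src A B) (join G x.src A B) ↔ Steps (StateStep (positions x) (chains x).length
        (Essential (positions x) (Linked G (places x)))) r (fun _ => 0) y := by
    intro r
    rw [show StateStep (positions x) (chains x).length (Essential (positions x)
      (Linked G (places x))) = StateStep (positions x) (chains x).length (Linked G (places x))
      from funext fun _ => funext fun _ => propext stateStep_essential_iff]
    have := hlay.steps_iff (fun _ => hlay.inIcc_iff) (c := r) hbot.1 hy
    rw [← hyH, ← hbot.2] at this
    exact this
  rw [e1]
  simp only [e2]
  -- Positions that are not kept are dropped; what remains is read as jumps in the column graph.
  rw [exists_steps_iff hKQ hcol.col_lt hlast hF h0K.1 hyK]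
  refine exists_congr fun r => and_congr_right fun _ => ?_
  rw [← hSe, ← hTe]
  exact (hcol.minJump_steps_iff h0K hyS).symm

end Represents

end MSR

namespace MSR

open Input

/-! ### The size of the kernel -/

theorem entryCount_cons (r : List Bool) (M : List (List Bool)) :
    entryCount (r :: M) = r.countP (fun b => b) + entryCount M := by
  simp [entryCount, List.countP_eq_length_filter]

theorem entryCount_map (K : List Pos) (f : Pos → List Bool) :
    entryCount (K.map f) = (K.map fun p => (f p).countP fun b => b).sum := by
  induction K with
  | nil => rfl
  | cons p K ih => rw [List.map_cons, entryCount_cons, ih, List.map_cons, List.sum_cons]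

theorem countP_map_eq_card {K : List Pos} (hK : K.Nodup) (f : Pos → Bool) :
    (K.map f).countP (fun b => b) = (K.toFinset.filter fun p => f p = true).card := by
  rw [List.countP_map, List.countP_eq_length_filter, ← List.toFinset_card_of_nodup (hK.filter _),
    List.toFinset_filter]
  rfl

theorem sum_map_eq {K : List Pos} (hK : K.Nodup) (f : Pos → ℕ) :
    (K.map f).sum = ∑ p ∈ K.toFinset, f p := (List.sum_toFinset f hK).symm

theorem card_filter_le_of_col {K : List Pos} {m : ℕ} (f : Pos → Bool)
    (hlt : ∀ p ∈ K, p.2.1 < m)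
    (hf : ∀ p ∈ K, ∀ q ∈ K, p.2.1 = q.2.1 → f p = true → f q = true → p = q) :
    (K.toFinset.filter fun p => f p = true).card ≤ m := by
  rw [← Finset.card_range m]
  refine Finset.card_le_card_of_injOn (fun p => p.2.1) (fun p hp => ?_) fun p hp q hq e => ?_
  · have := (Finset.mem_filter.1 hp).1
    simpa using hlt p (List.mem_toFinset.1 this)
  · obtain ⟨h1, h2⟩ := Finset.mem_filter.1 (Finset.mem_coe.1 hp)
    obtain ⟨h3, h4⟩ := Finset.mem_filter.1 (Finset.mem_coe.1 hq)
    exact hf p (List.mem_toFinset.1 h1) q (List.mem_toFinset.1 h3) e h2 h4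

/-- The number of entries of the adjacency matrix by kinds of adjacencies. -/
theorem entryCount_kernelMatrix_le {x : Input} {m N : ℕ} (hnd : (keep x).Nodup)
    (hlt : ∀ p ∈ keep x, p.2.1 < m)
    (hext : ∀ p ∈ keep x, ∀ q ∈ keep x, p.2.1 = q.2.1 → p.2.2.1 = q.2.2.1 → p = q)
    (hlast : ∀ p ∈ keep x, ∀ q ∈ keep x, p.2.1 = q.2.1 → isLast p = true → isLast q = true → p = q)
    (hess : (((keep x).toFinset ×ˢ (keep x).toFinset).filter
      fun a => essential x a.1 a.2 = true).card ≤ N) :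
    entryCount (kernelMatrix x) ≤ 4 * m + 2 * (keep x).length + N := by
  have hF := card_filter_le_of_col isFirst hlt fun p hp q hq e h1 h2 => hext p hp q hq e
    ((of_decide_eq_true h1).trans (of_decide_eq_true h2).symm)
  have hL := card_filter_le_of_col isLast hlt hlast
  have e1 : (firsts x).countP (fun b => b) =
      ((keep x).toFinset.filter fun p => isFirst p = true).card := by
    rw [← countP_map_eq_card hnd]
    simp [firsts]
  have e2 : (lasts x).countP (fun b => b) =
      ((keep x).toFinset.filter fun p => isLast p = true).card := by
    rw [← countP_map_eq_card hnd]
    simp [lasts]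
  -- A position has at most one successor and at most one predecessor in its column, which bounds
  -- the path edges in a row by 2.
  have hc : ∀ p q q', q ∈ keep x → q' ∈ keep x → consec x p q = true → consec x p q' = true →
      q = q' := by
    intro p q q' hq hq' h1 h2
    rw [Represents.consec_iff] at h1 h2
    have a1 := h1.2.2 q' hq' h2.1.symm h2.2.1
    have a2 := h2.2.2 q hq h1.1.symm h1.2.1
    exact hext q hq q' hq' (h1.1.symm.trans h2.1) (by omega)
  have hc' : ∀ p q q', q ∈ keep x → q' ∈ keep x → consec x q p = true → consec x q' p = true →
      q = q' := by
    intro p q q' hq hq' h1 h2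
    rw [Represents.consec_iff] at h1 h2
    have a1 := fun hlt => h1.2.2 q' hq' (h2.1.trans h1.1.symm) hlt h2.2.1
    have a2 := fun hlt => h2.2.2 q hq (h1.1.trans h2.1.symm) hlt h1.2.1
    refine hext q hq q' hq' (h1.1.trans h2.1.symm) ?_
    rcases lt_trichotomy q.2.2.1 q'.2.2.1 with h | h | h
    · exact (a1 h).elim
    · exact h
    · exact (a2 h).elim
  have hrow : ∀ p, (row x p).countP (fun b => b) ≤ ((if isFirst p = true then 1 else 0) +
      (if isLast p = true then 1 else 0)) +
      (((keep x).toFinset.filter fun q => essential x p q = true).card + 2) := by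
    intro p
    have h1 : (row x p).countP (fun b => b) = ((if isFirst p = true then 1 else 0) +
      (if isLast p = true then 1 else 0)) +
      ((keep x).toFinset.filter fun q => keepAdj x p q = true).card := by
      rw [← countP_map_eq_card hnd, row, List.countP_cons, List.countP_cons, add_assoc,
        add_comm, add_comm (if isFirst p = true then 1 else 0)]
    rw [h1]
    refine Nat.add_le_add_left ?_ _
    have hsub : ((keep x).toFinset.filter fun q => keepAdj x p q = true) ⊆
        ((keep x).toFinset.filter fun q => essential x p q = true) ∪
        (((keep x).toFinset.filter fun q => consec x p q = true) ∪
          ((keep x).toFinset.filter fun q => consec x q p = true)) := by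
      intro q
      simp only [keepAdj, Finset.mem_union, Finset.mem_filter, Bool.or_eq_true]
      tauto
    have h2 : ((keep x).toFinset.filter fun q => consec x p q = true).card ≤ 1 :=
      Finset.card_le_one.2 fun q hq q' hq' => by
        rw [Finset.mem_filter, List.mem_toFinset] at hq hq'
        exact hc p q q' hq.1 hq'.1 hq.2 hq'.2
    have h3 : ((keep x).toFinset.filter fun q => consec x q p = true).card ≤ 1 :=
      Finset.card_le_one.2 fun q hq q' hq' => by
        rw [Finset.mem_filter, List.mem_toFinset] at hq hq'
        exact hc' p q q' hq.1 hq'.1 hq.2 hq'.2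
    have h4 := Finset.card_union_le ((keep x).toFinset.filter fun q => consec x p q = true)
      ((keep x).toFinset.filter fun q => consec x q p = true)
    exact (Finset.card_le_card hsub).trans ((Finset.card_union_le _ _).trans (by omega))
  have e3 : ∑ p ∈ (keep x).toFinset, ((keep x).toFinset.filter
      fun q => essential x p q = true).card = (((keep x).toFinset ×ˢ (keep x).toFinset).filter
      fun a => essential x a.1 a.2 = true).card := by
    simp only [Finset.card_filter, Finset.sum_product]
  have hsum := Finset.sum_le_sum (s := (keep x).toFinset) fun p _ => hrow p
  rw [Finset.sum_add_distrib, Finset.sum_add_distrib, Finset.sum_add_distrib,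
    ← Finset.card_filter, ← Finset.card_filter, Finset.sum_const, smul_eq_mul, e3,
    List.toFinset_card_of_nodup hnd] at hsum
  -- At most `m` first and `m` last positions are counted in the rows of 0 and 1 and once more in
  -- their own rows, which gives `4 * m`.
  rw [kernelMatrix, entryCount_cons, entryCount_cons, entryCount_map, sum_map_eq hnd, e1, e2]
  omega

namespace Represents

variable {x : Input} {G : SimpleGraph ℕ} {A B : Finset ℕ}

theorem bound_eq {ℓ : ℕ} (hℓ : x.2.2.2.2.2.2.1 = ℓ.bits) : bound x = max 1 (min ℓ x.n) := by
  rw [bound, hℓ, truncVal_bits]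
  split_ifs with h
  · exact (max_eq_right (of_decide_eq_true h)).symm
  · have : ¬ 1 ≤ min ℓ x.n := fun h' => h (decide_eq_true h')
    omega

/-- The algorithm does not reject yes-instances. -/
theorem accepts_of_steps (h : Represents x G A B) {ℓ r : ℕ} (hℓ : x.2.2.2.2.2.2.1 = ℓ.bits)
    (hr : r ≤ ℓ) (hst : Steps (MinJump G x.src x.tgt) r A B) : accepts x = true := by
  have hM := h.minA.meet h.minB
  have hle : SideLE G x.src (meet G x.src A B) (join G x.src A B) :=
    IsMinSeparator.meet_le_left.1.trans IsMinSeparator.le_join_left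
  obtain ⟨c₀, hc₀, hst₀⟩ := exists_steps_meet_join h.minA h.minB hst
  -- A monotone sequence needs at most `x.n` jumps. This justifies size limits computed from `ℓ`
  -- truncated at `x.n`.
  obtain ⟨c, hc, hcn, hst'⟩ := exists_steps_le_card (W := Finset.range x.n)
    (fun X hX w hw => Finset.mem_range.2 (h.lt_of_mem hX.1 hw)) hle hM hst₀
  rw [Finset.card_range] at hcn
  have hC := h.heads_sweep hst'
  have hlay := h.layout hC
  have hne : ∀ c ∈ chains x, 2 ≤ c.length := fun c hc => two_le_of_mem_chains hc
  have hcol := h.columnGraph hC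
  have hKQ : ∀ p ∈ keep x, p ∈ positions x := fun p hp => (h.mem_keep.1 hp).1
  have hbot : IsState (positions x) (chains x).length (Linked G (places x)) (fun _ => 0) ∧
      meet G x.src A B = sepOf Prod.fst (fixed (sweep x)) (positions x) fun _ => 0 :=
    hlay.isState_bot hne
  obtain ⟨y, hy, hyH, hyl⟩ : ∃ y, IsState (positions x) (chains x).length
      (Linked G (places x)) y ∧ join G x.src A B = sepOf Prod.fst (fixed (sweep x)) (positions x) y ∧
      ∀ p ∈ positions x, p.2.2.1 = y p.2.1 ↔ p.2.2.2 = true := hlay.exists_state_top hne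
  have hsteps : Steps (StateStep (positions x) (chains x).length (Linked G (places x))) c
      (fun _ => 0) y := by
    have := hlay.steps_iff (fun _ => hlay.inIcc_iff) (c := c) hbot.1 hy
    rw [← hyH, ← hbot.2] at this
    exact this.1 hst'
  have hyt : ∀ p ∈ positions x, p.2.2.1 ≤ y p.2.1 := by
    intro p hp
    obtain ⟨q, hq, h1, h2, -⟩ := exists_last (hlay.col_lt p hp) hne
    have := le_of_isLast hp hq h1.symm h2
    rwa [(hyl q hq).2 h2, h1] at this
  -- Every chain has different first and last ranks, so each column changes and needs a step of its
  -- own.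
  have hm : (chains x).length ≤ c := by
    have := card_ne_le_of_steps hsteps
    rwa [Finset.filter_true_of_mem, Finset.card_range] at this
    intro i hi
    obtain ⟨q, hq, h1, h2, h3⟩ := exists_last (Finset.mem_range.1 hi) hne
    have := (hyl q hq).2 h2
    rw [← h1]
    omega
  obtain ⟨hb1, hb2⟩ := essential_bounds (fun p hp q hq => hlay.ext p hp q hq) hlay.col_lt
    linked_symm (fun p q hpq => hpq.1) hsteps (fun _ => rfl) hyt
  have hlen : (keep x).length ≤ ((chains x).length + c) * (2 * ((chains x).length - 1) + 1) := by
    rw [← List.toFinset_card_of_nodup keep_nodup]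
    refine hb1 _ fun p hp => ?_
    obtain ⟨h1, h2⟩ := h.mem_keep.1 (List.mem_toFinset.1 hp)
    exact ⟨h1, h2.imp_right fun h3 => h3.imp_left (hyl p h1).2⟩
  have hent := entryCount_kernelMatrix_le (x := x) keep_nodup hcol.col_lt
    (fun p hp q hq => hcol.ext p hp q hq)
    (fun p hp q hq e h1 h2 => hcol.ext p hp q hq e
      (le_antisymm (hcol.le_last p hp q hq e h2) (hcol.le_last q hq p hp e.symm h1)))
    (hb2 _ fun a ha => by
      obtain ⟨h1, h2⟩ := Finset.mem_filter.1 ha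
      rw [Finset.mem_product, List.mem_toFinset, List.mem_toFinset] at h1
      exact ⟨hKQ _ h1.1, hKQ _ h1.2, (h.essential_iff (hKQ _ h1.1) (hKQ _ h1.2)).1 h2⟩)
  -- Writing the bound as `d + 1` avoids truncated subtraction in `m - 1`; both the number of chains
  -- and `c` are at most `d + 1`.
  obtain ⟨d, hd⟩ : ∃ d, bound x = d + 1 := ⟨bound x - 1, by rw [bound_eq hℓ]; omega⟩
  have hcb : c ≤ d + 1 := by
    rw [← hd, bound_eq hℓ]
    omega
  have hp1 : ((chains x).length + c) * (2 * ((chains x).length - 1) + 1) ≤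
      (2 * d + 2) * (2 * d + 1) := Nat.mul_le_mul (by omega) (by omega)
  have hp2 : ((chains x).length + c) * (2 * ((chains x).length - 1)) ≤
      (2 * d + 2) * (2 * d) := Nat.mul_le_mul (by omega) (by omega)
  simp only [accepts, Bool.and_eq_true, List.all_eq_true, decide_eq_true_eq, maxVertices,
    maxEntries, hd]
  refine ⟨fun v hv => ?_, ?_, ?_⟩
  · rw [← List.mem_toFinset, h.toFinset_hi, ← hC]
    exact List.mem_toFinset.2 hv
  · nlinarith
  · nlinarith

end Represents

end MSR

namespace MSR

open Input

/-! ### Transport along embeddings -/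

section transport

variable {V W : Type*} {G : SimpleGraph V} {s t : V} {S A B : Finset V} {e : V ↪ W}

theorem map_mem_reachSet {D : Set V} {D' : Set W} (hD : ∀ v, e v ∈ D' ↔ v ∈ D) {a b : V} :
    e b ∈ reachSet (G.map e) D' (e a) ↔ b ∈ reachSet G D a := by
  constructor
  · intro h
    have : reachSet (G.map e) D' (e a) ⊆ {w | ∃ v ∈ reachSet G D a, e v = w} := by
      refine reachSet_subset ⟨a, self_mem_reachSet, rfl⟩ ?_
      rintro _ ⟨v, hv, rfl⟩ w hvw hw
      obtain ⟨-, v', w', hvw', h1, rfl⟩ := hvw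
      rw [e.injective h1] at hvw'
      exact ⟨w', reachSet_step hv hvw' (mt (hD w').2 hw), rfl⟩
    obtain ⟨v, hv, hvb⟩ := this h
    rwa [e.injective hvb] at hv
  · intro h
    induction h with
    | refl => exact self_mem_reachSet
    | tail _ h2 ih => exact reachSet_step ih ⟨e.injective.ne h2.1.ne, _, _, h2.1, rfl, rfl⟩ (mt (hD _).1 h2.2)

theorem isSeparator_map_iff : IsSeparator (G.map e) (e s) (e t) (S.map e) ↔
    IsSeparator G s t S := by
  rw [isSeparator_iff, isSeparator_iff, Finset.mem_map', Finset.mem_map',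
    map_mem_reachSet (D := S) (by simp)]

/-- The algorithm works on natural numbers, instances on `Fin n`. A separator of the larger graph
may use vertices outside of the image, but its preimage still separates and is no larger. -/
theorem isMinSeparator_map_iff : IsMinSeparator (G.map e) (e s) (e t) (S.map e) ↔
    IsMinSeparator G s t S := by
  unfold IsMinSeparator
  rw [isSeparator_map_iff]
  refine and_congr_right fun _ => ⟨fun h T hT => ?_, fun h T hT => ?_⟩
  · simpa using h _ (isSeparator_map_iff.2 hT)
  · set T' := T.preimage e e.injective.injOn
    have hT' : IsSeparator G s t T' := by
      rw [isSeparator_iff] at hT ⊢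
      rw [map_mem_reachSet (D := T') (by simp [T'])] at hT
      simpa [T'] using hT
    have h1 := h _ hT'
    have h2 := Finset.card_le_card (show T'.map e ⊆ T from fun w hw => by
      obtain ⟨v, hv, rfl⟩ := Finset.mem_map.1 hw
      exact Finset.mem_preimage.1 hv)
    rw [Finset.card_map] at h2 ⊢
    exact h1.trans h2

/-- Every vertex of a minimum separator has a neighbour, and vertices outside of the image are
isolated. -/
theorem exists_map_eq {T : Finset W} (hT : IsMinSeparator (G.map e) (e s) (e t) T) :
    ∃ S : Finset V, T = S.map e := by
  refine ⟨T.preimage e e.injective.injOn, ?_⟩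
  ext w
  constructor
  · intro hw
    obtain ⟨u, -, huw⟩ := hT.exists_adj hw
    obtain ⟨-, -, v, -, -, rfl⟩ := huw
    exact Finset.mem_map_of_mem e (Finset.mem_preimage.2 hw)
  · intro hw
    obtain ⟨v, hv, rfl⟩ := Finset.mem_map.1 hw
    exact Finset.mem_preimage.1 hv

variable [DecidableEq V] [DecidableEq W]

theorem tokenJump_map_iff : TokenJump (A.map e) (B.map e) ↔ TokenJump A B := by
  have key : ∀ v u, (A.map e \ {e v}) ∪ {e u} = ((A \ {v}) ∪ {u}).map e := fun v u => by
    ext w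
    simp only [Finset.mem_union, Finset.mem_sdiff, Finset.mem_map, Finset.mem_singleton]
    constructor
    · rintro (⟨⟨a, ha, rfl⟩, hne⟩ | rfl)
      · exact ⟨a, Or.inl ⟨ha, fun h => hne (h ▸ rfl)⟩, rfl⟩
      · exact ⟨u, Or.inr rfl, rfl⟩
    · rintro ⟨a, ⟨ha, hne⟩ | rfl, rfl⟩
      · exact Or.inl ⟨⟨a, ha, rfl⟩, fun h => hne (e.injective h)⟩
      · exact Or.inr rfl
  constructor
  · rintro ⟨v', hv, u', hu, h⟩
    obtain ⟨v, hv, rfl⟩ := Finset.mem_map.1 hv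
    have hmem : u' ∈ B.map e := by
      rw [h]
      simp
    obtain ⟨u, -, rfl⟩ := Finset.mem_map.1 hmem
    rw [key] at h
    exact ⟨v, by simpa using hv, u, by simpa using hu, Finset.map_injective e h⟩
  · rintro ⟨v, hv, u, hu, rfl⟩
    exact ⟨e v, Finset.mem_map_of_mem e hv, e u, by simpa using hu, (key v u).symm⟩

theorem minJump_map_iff : MinJump (G.map e) (e s) (e t) (A.map e) (B.map e) ↔
    MinJump G s t A B := by
  unfold MinJump
  rw [isMinSeparator_map_iff, isMinSeparator_map_iff, tokenJump_map_iff]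

theorem steps_map_iff {r : ℕ} : Steps (MinJump (G.map e) (e s) (e t)) r (A.map e) (B.map e) ↔
    Steps (MinJump G s t) r A B := by
  constructor
  · suffices ∀ X Y, Steps (MinJump (G.map e) (e s) (e t)) r X Y → ∀ B, X = A.map e →
        Y = B.map e → Steps (MinJump G s t) r A B from fun h => this _ _ h B rfl rfl
    intro X Y h
    induction h with
    | refl X =>
      intro B h1 h2
      rw [Finset.map_injective e (h1.symm.trans h2)]
      exact .refl _
    | snoc _ hr ih =>
      rintro B h1 rfl
      obtain ⟨S, rfl⟩ := exists_map_eq hr.1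
      exact .snoc (ih S h1 rfl) (minJump_map_iff.1 hr)
  · intro h
    induction h with
    | refl => exact .refl _
    | snoc _ hr ih => exact .snoc ih (minJump_map_iff.2 hr)

end transport

/-! ### Instances and inputs -/

theorem TJInstance.isYes_iff (I : TJInstance) :
    I.IsYes ↔ ∃ r ≤ I.ℓ, Steps (MinJump (I.G.map Fin.valEmbedding) I.s I.t) r
      (I.A.map Fin.valEmbedding) (I.B.map Fin.valEmbedding) := by
  refine exists_congr fun r => and_congr_right fun _ => ?_
  rw [reconfigurableIn_iff I.minA]
  exact steps_map_iff.symm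

open Classical in
/-- The input that describes an instance. -/
noncomputable def TJInstance.toInput (I : TJInstance) : Input :=
  (I.n, List.ofFn fun i => List.ofFn fun j => decide (I.G.Adj i j), I.s, I.t,
    List.ofFn fun i => decide (i ∈ I.A), List.ofFn fun i => decide (i ∈ I.B), I.ℓ.bits, ())

/-- The trailing unit is encoded by `leaf`, the end of a list, so the nested tuple is the list of
the input format. -/
theorem TJInstance.enc_toInput (I : TJInstance) : Enc.enc I.toInput = I.encode := by
  have h : ∀ (n : ℕ) (g : Fin n → Bool), Enc.enc (List.ofFn g) =
      Data.ofList (List.ofFn fun i => Data.ofBool (g i)) := fun n g => by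
    show Data.ofList ((List.ofFn g).map Data.ofBool) = _
    rw [List.map_ofFn]
    rfl
  have h2 : ∀ (n : ℕ) (g : Fin n → Fin n → Bool),
      Enc.enc (List.ofFn fun i => List.ofFn fun j => g i j) =
        Data.ofList (List.ofFn fun i => Data.ofList (List.ofFn fun j => Data.ofBool (g i j))) := by
    intro n g
    show Data.ofList ((List.ofFn fun i => List.ofFn fun j => g i j).map Enc.enc) = _
    rw [List.map_ofFn]
    congr 2
    funext i
    exact h n _
  unfold TJInstance.encode
  rw [← h, ← h, ← h2]
  rfl

/-- The graph with a given adjacency matrix. -/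
def matrixGraph (M : List (List Bool)) (N : ℕ) (hsymm : ∀ i j, entry M i j = entry M j i)
    (hself : ∀ i, entry M i i = false) : SimpleGraph (Fin N) where
  Adj i j := entry M i j = true
  symm := ⟨fun i j h => by rwa [hsymm]⟩
  loopless := ⟨fun i h => by simp [hself] at h⟩

/-- The set with a given characteristic vector. -/
def charSet (l : List Bool) (N : ℕ) : Finset (Fin N) :=
  Finset.univ.filter fun i => l.getD i false = true

theorem ofFn_getD {α : Type*} {l : List α} {N : ℕ} (hl : l.length = N) (d : α) :
    (List.ofFn fun i : Fin N => l.getD i d) = l := by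
  subst hl
  refine List.ext_getElem (by simp) fun i h1 h2 => ?_
  simp

theorem ofFn_charSet {l : List Bool} {N : ℕ} (hl : l.length = N) [DecidableEq (Fin N)]
    [∀ i : Fin N, Decidable (i ∈ charSet l N)] :
    (List.ofFn fun i => decide (i ∈ charSet l N)) = l := by
  conv_rhs => rw [← ofFn_getD hl false]
  congr 1
  funext i
  rw [Bool.eq_iff_iff]
  simp [charSet]

theorem entryCount_ofFn {N : ℕ} (g : Fin N → Fin N → Bool) :
    entryCount (List.ofFn fun i => List.ofFn fun j => g i j) =
      ∑ i, (Finset.univ.filter fun j => g i j = true).card := by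
  have h1 : ∀ M : List (List Bool), entryCount M =
      (M.map fun r => (r.map Bool.toNat).sum).sum := by
    have h2 : ∀ r : List Bool, r.countP (fun b => b) = (r.map Bool.toNat).sum := by
      intro r
      induction r with
      | nil => rfl
      | cons b r ih => cases b <;> simp_all; omega
    intro M
    induction M with
    | nil => rfl
    | cons r M ih => rw [entryCount_cons, ih, h2, List.map_cons, List.sum_cons]
  rw [h1, List.map_ofFn, List.sum_ofFn]
  refine Finset.sum_congr rfl fun i _ => ?_
  rw [Function.comp_apply, List.map_ofFn, List.sum_ofFn, Finset.card_filter]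
  refine Finset.sum_congr rfl fun j _ => ?_
  cases h : g i j <;> simp [h]

theorem two_mul_ncard_edgeSet {M : List (List Bool)} {N : ℕ}
    (hsymm : ∀ i j, entry M i j = entry M j i) (hself : ∀ i, entry M i i = false)
    (hM : M = List.ofFn fun i : Fin N => List.ofFn fun j : Fin N => entry M i j) :
    2 * (matrixGraph M N hsymm hself).edgeSet.ncard = entryCount M := by
  classical
  have h1 := (matrixGraph M N hsymm hself).sum_degrees_eq_twice_card_edges
  have h2 := entryCount_ofFn fun i j : Fin N => entry M i j
  rw [← hM] at h2
  rw [← SimpleGraph.coe_edgeFinset, Set.ncard_coe_finset, ← h1, h2]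
  refine Finset.sum_congr rfl fun i _ => ?_
  rw [← SimpleGraph.card_neighborFinset_eq_degree, SimpleGraph.neighborFinset_eq_filter]
  refine congrArg Finset.card (Finset.ext fun j => ?_)
  rw [Finset.mem_filter, Finset.mem_filter]
  rfl

theorem matrix_eq_ofFn {M : List (List Bool)} {N : ℕ} (h : M.length = N)
    (hrow : ∀ r ∈ M, r.length = N) :
    M = List.ofFn fun i : Fin N => List.ofFn fun j : Fin N => entry M i j := by
  conv_lhs => rw [← ofFn_getD h []]
  congr 1
  funext i
  exact (ofFn_getD (hrow _ (by
    rw [List.getD_eq_getElem _ _ (h ▸ i.2)]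
    exact List.getElem_mem _)) false).symm

end MSR

namespace MSR

open Input

theorem mem_map_charSet {l : List Bool} {N w : ℕ} :
    w ∈ (charSet l N).map Fin.valEmbedding ↔ w < N ∧ l.getD w false = true := by
  simp only [charSet, Finset.mem_map, Finset.mem_filter, Finset.mem_univ, true_and,
    Fin.valEmbedding_apply]
  constructor
  · rintro ⟨i, hi, rfl⟩
    exact ⟨i.2, hi⟩
  · rintro ⟨h1, h2⟩
    exact ⟨⟨w, h1⟩, h2, rfl⟩

theorem map_matrixGraph_adj {M : List (List Bool)} {N : ℕ}
    (hsymm : ∀ i j, entry M i j = entry M j i) (hself : ∀ i, entry M i i = false) {i j : ℕ} :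
    ((matrixGraph M N hsymm hself).map Fin.valEmbedding).Adj i j ↔
      i < N ∧ j < N ∧ entry M i j = true := by
  constructor
  · rintro ⟨-, a, b, hab, rfl, rfl⟩
    exact ⟨a.2, b.2, hab⟩
  · rintro ⟨hi, hj, h⟩
    have hne : i ≠ j := by
      rintro rfl
      simp [hself] at h
    exact ⟨hne, ⟨i, hi⟩, ⟨j, hj⟩, h, rfl, rfl⟩

theorem TJInstance.represents (I : TJInstance) : Represents I.toInput
    (I.G.map Fin.valEmbedding) (I.A.map Fin.valEmbedding) (I.B.map Fin.valEmbedding) := by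
  classical
  have hset : ∀ (S : Finset (Fin I.n)) (v : ℕ), (v ∈ (List.range I.n).filter fun v =>
      (List.ofFn fun i => decide (i ∈ S)).getD v false) ↔ v ∈ S.map Fin.valEmbedding := by
    intro S v
    simp only [List.mem_filter, List.mem_range, Finset.mem_map, Fin.valEmbedding_apply]
    constructor
    · rintro ⟨h1, h2⟩
      exact ⟨⟨v, h1⟩, by simpa [List.getD_eq_getElem?_getD, h1] using h2, rfl⟩
    · rintro ⟨i, hi, rfl⟩
      exact ⟨i.2, by simpa [List.getD_eq_getElem?_getD] using hi⟩
  refine ⟨fun u v => ?_, ?_, I.s.2, fun v => ?_, fun v => ?_, isMinSeparator_map_iff.2 I.minA,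
    isMinSeparator_map_iff.2 I.minB⟩
  · constructor
    · intro h
      have hu : u < I.n := by
        by_contra hu
        simp [adj, TJInstance.toInput, List.getD_eq_getElem?_getD, hu] at h
      have hv : v < I.n := by
        by_contra hv
        simp [adj, TJInstance.toInput, List.getD_eq_getElem?_getD, hu, hv] at h
      have h' : I.G.Adj ⟨u, hu⟩ ⟨v, hv⟩ := by
        simpa [adj, TJInstance.toInput, List.getD_eq_getElem?_getD, hu, hv] using h
      exact ⟨fun e => h'.ne (Fin.ext e), _, _, h', rfl, rfl⟩
    · rintro ⟨-, a, b, hab, rfl, rfl⟩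
      simpa [adj, TJInstance.toInput, List.getD_eq_getElem?_getD] using hab
  · rintro u v ⟨-, a, b, -, -, rfl⟩
    exact b.2
  · rw [← hset]
    simp only [setA, TJInstance.toInput]
  · rw [← hset]
    simp only [setB, TJInstance.toInput]

/-- The instance described by an input. -/
theorem exists_toInput_eq {M : List (List Bool)} {N : ℕ} {a b : List Bool} {ℓ : ℕ}
    (hsymm : ∀ i j, entry M i j = entry M j i) (hself : ∀ i, entry M i i = false)
    (hM : M.length = N) (hrow : ∀ r ∈ M, r.length = N) (ha : a.length = N) (hb : b.length = N)
    (h2 : 2 ≤ N)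
    (hA : IsMinSeparator ((matrixGraph M N hsymm hself).map Fin.valEmbedding) 0 1
      ((charSet a N).map Fin.valEmbedding))
    (hB : IsMinSeparator ((matrixGraph M N hsymm hself).map Fin.valEmbedding) 0 1
      ((charSet b N).map Fin.valEmbedding)) :
    ∃ J : TJInstance, J.toInput = (N, M, 0, 1, a, b, ℓ.bits, ()) ∧ J.ℓ = ℓ ∧ J.n = N ∧
      2 * J.G.edgeSet.ncard = entryCount M ∧ (J.IsYes ↔ ∃ r ≤ ℓ,
        Steps (MinJump ((matrixGraph M N hsymm hself).map Fin.valEmbedding) 0 1) r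
          ((charSet a N).map Fin.valEmbedding) ((charSet b N).map Fin.valEmbedding)) := by
  have hMf := matrix_eq_ofFn hM hrow
  refine ⟨⟨N, matrixGraph M N hsymm hself, ⟨0, by omega⟩, ⟨1, by omega⟩, charSet a N, charSet b N,
    ℓ, isMinSeparator_map_iff.1 hA, isMinSeparator_map_iff.1 hB⟩, ?_, rfl, rfl,
    two_mul_ncard_edgeSet hsymm hself hMf, TJInstance.isYes_iff _⟩
  have e : (List.ofFn fun i : Fin N => List.ofFn fun j : Fin N =>
      @decide ((matrixGraph M N hsymm hself).Adj i j) (Classical.propDecidable _)) = M := by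
    conv_rhs => rw [hMf]
    congr 1
    funext i
    congr 1
    funext j
    rw [Bool.eq_iff_iff]
    exact @decide_eq_true_iff _ (Classical.propDecidable _)
  show (N, _, 0, 1, _, _, ℓ.bits, ()) = _
  rw [e, ofFn_charSet ha, ofFn_charSet hb]

theorem exists_noOutput :
    ∃ J : TJInstance, J.toInput = noOutput ∧ J.ℓ = 0 ∧ J.n = 4 ∧ J.G.edgeSet.ncard = 3 ∧
      ¬ J.IsYes := by
  have hsymm : ∀ i j, entry noOutput.2.1 i j = entry noOutput.2.1 j i := by
    intro i j
    rcases i with _ | _ | _ | _ | i <;> rcases j with _ | _ | _ | _ | j <;> rfl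
  have hself : ∀ i, entry noOutput.2.1 i i = false := by
    intro i
    rcases i with _ | _ | _ | _ | i <;> rfl
  set Γ := (matrixGraph noOutput.2.1 4 hsymm hself).map Fin.valEmbedding with hΓ
  have hadj : ∀ i j, Γ.Adj i j ↔ i < 4 ∧ j < 4 ∧ entry noOutput.2.1 i j = true :=
    fun i j => map_matrixGraph_adj hsymm hself
  have h02 : Γ.Adj 0 2 := (hadj _ _).2 ⟨by omega, by omega, rfl⟩
  have h23 : Γ.Adj 2 3 := (hadj _ _).2 ⟨by omega, by omega, rfl⟩
  have h31 : Γ.Adj 3 1 := (hadj _ _).2 ⟨by omega, by omega, rfl⟩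
  have h0 : ∀ v, Γ.Adj 0 v → v = 2 := by
    intro v hv
    obtain ⟨-, h1, h2⟩ := (hadj _ _).1 hv
    interval_cases v <;> first | rfl | exact absurd h2 Bool.false_ne_true
  have h2 : ∀ v, Γ.Adj 2 v → v = 0 ∨ v = 3 := by
    intro v hv
    obtain ⟨-, h1, h2⟩ := (hadj _ _).1 hv
    interval_cases v <;> first | exact Or.inl rfl | exact Or.inr rfl | exact absurd h2 Bool.false_ne_true
  have hpos : ∀ T : Finset ℕ, IsSeparator Γ 0 1 T → 1 ≤ T.card := by
    intro T hT
    rw [Nat.one_le_iff_ne_zero, Ne, Finset.card_eq_zero]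
    rintro rfl
    exact (isSeparator_iff.1 hT).2.2 (reachSet_step (reachSet_step (reachSet_step
      self_mem_reachSet h02 (by simp)) h23 (by simp)) h31 (by simp))
  have hA : (charSet noOutput.2.2.2.2.1 4).map Fin.valEmbedding = {2} := by decide
  have hB : (charSet noOutput.2.2.2.2.2.1 4).map Fin.valEmbedding = {3} := by decide
  have hsA : IsMinSeparator Γ 0 1 {2} := by
    refine ⟨isSeparator_of_region (U := {0}) (by simp) (by simp) rfl (by simp) ?_, hpos⟩
    rintro u rfl v huv hv
    exact absurd (h0 v huv) (by simpa using hv)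
  have hsB : IsMinSeparator Γ 0 1 {3} := by
    refine ⟨isSeparator_of_region (U := {0, 2}) (by simp) (by simp) (by simp) (by simp) ?_, hpos⟩
    rintro u (rfl | rfl) v huv hv
    · exact Or.inr (h0 v huv)
    · exact Or.inl ((h2 v huv).resolve_right (by simpa using hv))
  obtain ⟨J, j1, j2, j3, j4, j5⟩ := exists_toInput_eq (N := 4) (ℓ := 0) hsymm hself rfl (by decide)
    (a := noOutput.2.2.2.2.1) (b := noOutput.2.2.2.2.2.1) rfl rfl (by omega) (hA ▸ hsA) (hB ▸ hsB)
  refine ⟨J, j1, j2, j3, ?_, fun hY => ?_⟩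
  · have : entryCount noOutput.2.1 = 6 := by decide
    omega
  · obtain ⟨r, hr, hst⟩ := j5.1 hY
    obtain rfl := Nat.le_zero.1 hr
    obtain ⟨f, e1, e2, -⟩ := Steps.iff_seq.1 hst
    rw [hA] at e1
    rw [hB, e1] at e2
    simp at e2

/-- The kernelization of an instance. -/
theorem exists_kernel (I : TJInstance) : ∃ J : TJInstance, J.toInput = output I.toInput ∧
    (I.IsYes ↔ J.IsYes) ∧ J.ℓ ≤ I.ℓ ∧ J.n ≤ 8 * (max 1 I.ℓ) ^ 2 + 5 * max 1 I.ℓ ∧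
    J.G.edgeSet.ncard ≤ 12 * (max 1 I.ℓ) ^ 2 + 7 * max 1 I.ℓ := by
  have hI := I.represents
  set x := I.toInput
  have hℓ : x.2.2.2.2.2.2.1 = I.ℓ.bits := rfl
  have hyes := I.isYes_iff
  have h1 : 1 ≤ max 1 I.ℓ := le_max_left _ _
  by_cases hacc : accepts x = true
  · have hout : output x = ((keep x).length + 2, kernelMatrix x, 0, 1, firsts x, lasts x,
        I.ℓ.bits, ()) := if_pos hacc
    simp only [accepts, Bool.and_eq_true, List.all_eq_true, decide_eq_true_eq] at hacc
    obtain ⟨ha1, ha2, ha3⟩ := hacc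
    -- Acceptance gives an inclusion of minimum separators, and these have equal size.
    have hC : (heads (sweep x)).toFinset = join _ x.src _ _ :=
      (hI.sweepInv_iterate (x.n + 1)).inIcc.1.eq_of_subset (hI.minA.join hI.minB) fun w hw => by
        rw [← hI.toFinset_hi, List.mem_toFinset]
        exact ha1 w (List.mem_toFinset.1 hw)
    have hset : ∀ (f : Pos → Bool) (w : ℕ), w ∈ (charSet (false :: false :: (keep x).map f)
        ((keep x).length + 2)).map Fin.valEmbedding ↔
        ∃ p ∈ keep x, vertex x p = w ∧ f p = true := by
      intro f w
      rw [mem_map_charSet]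
      have hv : ∀ p ∈ keep x, (false :: false :: (keep x).map f).getD (vertex x p) false = f p := by
        intro p hp
        show ((keep x).map f).getD ((keep x).idxOf p) false = _
        rw [List.getD_eq_getElem?_getD, List.getElem?_map, getElem?_idxOf_keep hp]
        rfl
      constructor
      · rintro ⟨h2, h3⟩
        rcases exists_vertex h2 Represents.keep_nodup with rfl | rfl | ⟨p, hp, rfl⟩
        · simp at h3
        · simp at h3
        · exact ⟨p, hp, rfl, (hv p hp).symm.trans h3⟩
      · rintro ⟨p, hp, rfl, h3⟩
        refine ⟨?_, (hv p hp).trans h3⟩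
        have := List.idxOf_lt_length_iff.2 hp
        unfold vertex
        omega
    have hG : (matrixGraph (kernelMatrix x) ((keep x).length + 2) entry_symm entry_self).map
        Fin.valEmbedding = kernelGraph x := by
      ext i j
      rw [map_matrixGraph_adj]
      exact ⟨fun h => h.2.2, fun h => ⟨lt_of_entry h, lt_of_entry ((entry_symm j i).trans h), h⟩⟩
    obtain ⟨k1, k2, k3⟩ := hI.exists_steps_kernel_iff hC _ _
      (fun w => (hset isFirst w).trans (by simp [isFirst])) (hset isLast)
    rw [← hG] at k1 k2 k3
    obtain ⟨J, j1, j2, j3, j4, j5⟩ := exists_toInput_eq (M := kernelMatrix x) (ℓ := I.ℓ)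
      entry_symm entry_self (by simp [kernelMatrix])
      (by
        intro r hr
        simp only [kernelMatrix, List.mem_cons, List.mem_map] at hr
        rcases hr with rfl | rfl | ⟨p, -, rfl⟩ <;> simp [firsts, lasts, row])
      (by simp) (by simp) (Nat.le_add_left _ _) k1 k2
    rw [Represents.bound_eq hℓ] at ha2 ha3
    -- The limits that were tested use the truncated `ℓ`, so they are at most the claimed ones.
    have hb : max 1 (min I.ℓ x.n) ≤ max 1 I.ℓ := max_le_max le_rfl (min_le_left _ _)
    have hb2 := Nat.mul_le_mul hb hb
    unfold maxVertices at ha2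
    unfold maxEntries at ha3
    refine ⟨J, j1.trans hout.symm, hyes.trans ((k3 I.ℓ).trans j5.symm), j2.le, ?_, ?_⟩
    · rw [j3, sq]
      omega
    · rw [sq]
      omega
  · obtain ⟨J, j1, j2, j3, j4, j5⟩ := exists_noOutput
    refine ⟨J, j1.trans (if_neg hacc).symm, ⟨fun hY => ?_, fun hY => absurd hY j5⟩, by omega, ?_, ?_⟩
    -- A rejected instance is a no-instance, because every yes-instance passes the tests.
    · obtain ⟨r, hr, hst⟩ := hyes.1 hY
      exact absurd (hI.accepts_of_steps hℓ hr hst) hacc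
    · rw [j3]
      nlinarith
    · rw [j4]
      nlinarith

end MSR

theorem mainTheorem4 :
    ∃ f : MSR.TJInstance → MSR.TJInstance,
      MSR.PolyTimeComputable f ∧
      ∀ I : MSR.TJInstance,
        (I.IsYes ↔ (f I).IsYes) ∧
        (f I).ℓ ≤ I.ℓ ∧
        (f I).n ≤ 8 * (max 1 I.ℓ) ^ 2 + 5 * max 1 I.ℓ ∧
        (f I).G.edgeSet.ncard ≤ 12 * (max 1 I.ℓ) ^ 2 + 7 * max 1 I.ℓ := by
  -- The instances are picked by choice; computability concerns only their encodings, which are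
  -- those of the computed `output`.
  choose f hf using MSR.exists_kernel
  obtain ⟨p, P, hp⟩ := MSR.Input.comp_output
  refine ⟨f, ⟨p, P, fun I => ?_⟩, fun I => (hf I).2⟩
  have := hp I.toInput
  rw [← (hf I).1, MSR.TJInstance.enc_toInput, MSR.TJInstance.enc_toInput, MSR.sz,
    MSR.TJInstance.enc_toInput] at this
  exact this
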